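/- **Theorem 2.** Let $k_1,k_2\ge 1$ be fixed integers. Let $(F_t)_{t\ge1}$ be random $k_1\times k_2$ matrices, $(e_{ij,t})_{i,j,t\ge 1}$ real random variables on the same probability space, and $(R_{ia})_{i\ge1,\,a\le k_1}$, $(C_{jb})_{j\ge1,\,b\le k_2}$ deterministic arrays. For $p_1,p_2,T\ge1$ let $R$ ($p_1\times k_1$), $C$ ($p_2\times k_2$) and $E_t=(e_{ij,t})$ ($p_1\times p_2$) be the corresponding truncations, and let $$X_t=RF_tC'+E_t,\qquad 1\le t\le T .$$ Let $M_r=(Tp_1)^{-1}\sum_{t=1}^TX_t'X_t$. For $p_2\ge k_2$ let $\widehat C=\sqrt{p_2}\,Q$, where the columns of $Q$ are orthonormal eigenvectors of $M_r$ for its $k_2$ largest eigenvalues (any choice of these), and put $$\widetilde Y_t=X_t\widehat C/p_2,\qquad \widetilde M_1=\frac1T\sum_{t=1}^T\widetilde Y_t\widetilde Y_t' .$$ Let $\widetilde\lambda_j$ be the $j$-th largest eigenvalue of $\widetilde M_1$. Below, $\|\cdot\|$ is the spectral norm, $\|\cdot\|_{\max}$ the largest absolute entry, and $c_0$ a finite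 constant that depends on none of $p_1,p_2,T$, the indices or the vectors $v,w$ (it may differ from line to line). Bounds are required for all $p_1,p_2,T\ge1$ and all indices $i,l_1\le p_1$, $j,h_1\le p_2$, $t\le T$. Assume: * **B1.** (i) $E(F_t)=0$ and $E\|F_t\|^{4+\epsilon_0}\le c_0$ for some $\epsilon_0>0$. (ii) Almost surely, as $T\to\infty$, $T^{-1}\sum_{t\le T}F_tF_t'\to\Sigma_1$ and $T^{-1}\sum_{t\le T}F_t'F_t\to\Sigma_2$, with $\Sigma_1,\Sigma_2$ (deterministic) positive definite, each with distinct eigenvalues. (iii) For all entries $(a,b)$, $(a',b')$ of $F_t$: $E\max_{1\le\tilde t\le T}\big(\sum_{t=1}^{\tilde t}(F_{ab,t}F_{a'b',t}-E(F_{ab,t}F_{a'b',t}))\big)^2\le c_0T$. * **B2.** (i) The entries of $R$ and $C$ are bounded by $c_0$ in absolute value. (ii) $\|p_1^{-1}R'R-I_{k_1}\|\to0$ as $p_1\to\infty$ and $\|p_2^{-1}C'C-I_{k_2}\|\to0$ as $p_2\to\infty$. * **B3.** (i) $E(e_{ij,t})=0$ and $E(e_{ij,t}^8)\le c_0$. (ii)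 $\sum_{s\le T}\sum_{l\le p_1}\sum_{h\le p_2}|E(e_{ij,t}e_{lh,s})|\le c_0$ and $\sum_{l\le p_1}\sum_{h\le p_2}|E(e_{lj,t}e_{ih,t})|\le c_0$. (iii) $$\sum_{s\le T}\sum_{l_2\le p_1}\sum_{h\le p_2}|Cov(e_{ij,t}e_{l_1j,t},e_{ih,s}e_{l_2h,s})|\le c_0,\quad \sum_{s\le T}\sum_{l\le p_1}\sum_{h_2\le p_2}|Cov(e_{ij,t}e_{ih_1,t},e_{lj,s}e_{lh_2,s})|\le c_0,$$ $$\sum_{s\le T}\sum_{l\le p_1}\sum_{h\le p_2}|Cov(e_{ij,t}^2,e_{lh,s}^2)|\le c_0,$$ $$\sum_{s\le T}\sum_{l_2\le p_1}\sum_{h_2\le p_2}|Cov(e_{ij,t}e_{l_1h_1,t},e_{ij,s}e_{l_2h_2,s})+Cov(e_{l_1j,t}e_{ih_1,t},e_{l_2j,s}e_{ih_2,s})|\le c_0 .$$ (iv) The smallest eigenvalue of $E\big((p_2T)^{-1}\sum_{t\le T}E_tE_t'\big)$ is positive. * **B4.** (i) For all deterministic unit vectors $v\in\mathbb R^{p_1}$,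 $w\in\mathbb R^{p_2}$: $E\big\|T^{-1/2}\sum_{t\le T}F_t\,v'E_tw\big\|^2\le c_0$. (ii) With $\bar\zeta_{ij}=\mathrm{Vec}(\sum_{t\le T}F_te_{ij,t}/\sqrt T)$, which has finite fourth moments, $$\Big\|\sum_{h\le p_2}E(\bar\zeta_{ij}\otimes\bar\zeta_{ih})\Big\|_{\max}\le c_0,\qquad \Big\|\sum_{l\le p_1}E(\bar\zeta_{ij}\otimes\bar\zeta_{lj})\Big\|_{\max}\le c_0,$$ $$\Big\|\sum_{l\le p_1}\sum_{h_2\le p_2}Cov(\bar\zeta_{ij}\otimes\bar\zeta_{ih_1},\bar\zeta_{lj}\otimes\bar\zeta_{lh_2})\Big\|_{\max}\le c_0,\qquad \Big\|\sum_{l_2\le p_1}\sum_{h\le p_2}Cov(\bar\zeta_{ij}\otimes\bar\zeta_{l_1j},\bar\zeta_{ih}\otimes\bar\zeta_{l_2h})\Big\|_{\max}\le c_0 .$$ Then, as $\min\{p_1,p_2,T\}\to\infty$ (with no restriction on the relative rates): 1. for every $1\le j\le k_1$, $\widetilde\lambda_j=\Omega_{a.s.}(p_1)$, that is, there is a constant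 $c>0$ with $\widetilde\lambda_j/p_1\to c$ almost surely; 2. for every $j>k_1$ and every $\epsilon>0$, $$\widetilde\lambda_j=o_{a.s.}\left(\Big(\frac1{p_2}+\frac1T+\frac{p_1}{\sqrt{Tp_2}}\Big)\big(\ln^2p_1\,\ln p_2\,\ln T\big)^{1+\epsilon}\right),$$ that is, the ratio of the two sides tends to $0$ almost surely. -/

import Mathlib

open MeasureTheory Filter Topology Finset

noncomputable section

namespace MatrixFactor

/-! Indices are 0-based: row `i < p₁`, column `j < p₂`, time `t < T`. All arrays are nested: the
data of size `(p₁, p₂, T)` is the corner of one infinite array. -/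

/-! ### Linear algebra -/

/-- The spectral norm of a real matrix. -/
def specNorm {m n : ℕ} (A : Matrix (Fin m) (Fin n) ℝ) : ℝ :=
  ‖(Matrix.toEuclideanLin A).toContinuousLinearMap‖

/-- The `j`-th largest eigenvalue (`1 ≤ j ≤ n`, with multiplicity) of a symmetric `n × n` matrix;
the value is `0` by convention if there is no such eigenvalue. -/
def eig {n : ℕ} (A : Matrix (Fin n) (Fin n) ℝ) (j : ℕ) : ℝ :=
  open Classical in
  if h : A.IsHermitian ∧ 1 ≤ j ∧ j ≤ n then
    h.1.eigenvalues₀ ⟨j - 1, by rw [Fintype.card_fin]; omega⟩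
  else 0

/-- The columns of `Q` are orthonormal eigenvectors of `M` that belong to its `k` largest
eigenvalues, in decreasing order. -/
def IsLeadingEigenvectors {n k : ℕ} (M : Matrix (Fin n) (Fin n) ℝ)
    (Q : Matrix (Fin n) (Fin k) ℝ) : Prop :=
  Q.transpose * Q = 1 ∧ ∀ j : Fin k, M.mulVec (Q.col j) = eig M (j + 1) • Q.col j

/-! ### Almost sure rates as `min {p₁, p₂, T} → ∞` -/

section Rates

variable {Ω : Type*} [MeasurableSpace Ω]

/-- `a = o_{a.s.}(b)`: almost surely `a / b → 0` as `min {p₁, p₂, T} → ∞`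
(this is the filter `atTop` of the product order on triples). -/
def IsLittleOAS (μ : Measure Ω) (a : ℕ → ℕ → ℕ → Ω → ℝ) (b : ℕ → ℕ → ℕ → ℝ) : Prop :=
  ∀ᵐ ω ∂μ, Tendsto (fun p : ℕ × ℕ × ℕ => a p.1 p.2.1 p.2.2 ω / b p.1 p.2.1 p.2.2)
    atTop (𝓝 0)

/-- `a = Ω_{a.s.}(b)`: almost surely `a / b → c₀` for a constant `c₀ > 0`, as
`min {p₁, p₂, T} → ∞`. -/
def IsOmegaAS (μ : Measure Ω) (a : ℕ → ℕ → ℕ → Ω → ℝ) (b : ℕ → ℕ → ℕ → ℝ) : Prop :=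
  ∃ c₀ : ℝ, 0 < c₀ ∧
    ∀ᵐ ω ∂μ, Tendsto (fun p : ℕ × ℕ × ℕ => a p.1 p.2.1 p.2.2 ω / b p.1 p.2.1 p.2.2)
      atTop (𝓝 c₀)

end Rates

/-! ### The model and the projected covariance matrix -/

section Model

variable {Ω : Type*} {k₁ k₂ : ℕ}

/-- The `p × k` loading matrix whose rows are the first `p` rows of the infinite array `L`. -/
def loadingMat {k : ℕ} (L : ℕ → Fin k → ℝ) (p : ℕ) : Matrix (Fin p) (Fin k) ℝ :=
  Matrix.of fun i a => L i a

/-- The idiosyncratic `p₁ × p₂` matrix `E_t`. -/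
def errMat (e : ℕ → ℕ → ℕ → Ω → ℝ) (p₁ p₂ t : ℕ) (ω : Ω) : Matrix (Fin p₁) (Fin p₂) ℝ :=
  Matrix.of fun i j => e i j t ω

/-- The observation `X_t = R F_t C' + E_t`. -/
def obs (R : ℕ → Fin k₁ → ℝ) (C : ℕ → Fin k₂ → ℝ) (F : ℕ → Ω → Matrix (Fin k₁) (Fin k₂) ℝ)
    (e : ℕ → ℕ → ℕ → Ω → ℝ) (p₁ p₂ t : ℕ) (ω : Ω) : Matrix (Fin p₁) (Fin p₂) ℝ :=
  loadingMat R p₁ * F t ω * (loadingMat C p₂).transpose + errMat e p₁ p₂ t ω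

/-- `M_r = (T p₁)⁻¹ ∑_t X_t' X_t`. -/
def rowCov (R : ℕ → Fin k₁ → ℝ) (C : ℕ → Fin k₂ → ℝ)
    (F : ℕ → Ω → Matrix (Fin k₁) (Fin k₂) ℝ) (e : ℕ → ℕ → ℕ → Ω → ℝ)
    (p₁ p₂ T : ℕ) (ω : Ω) : Matrix (Fin p₂) (Fin p₂) ℝ :=
  ((T : ℝ) * (p₁ : ℝ))⁻¹ •
    ∑ t ∈ range T, (obs R C F e p₁ p₂ t ω).transpose * obs R C F e p₁ p₂ t ω

/-- The projected data `Ỹ_t = X_t Ĉ / p₂`, where `Ĉ = √p₂ Q`. -/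
def projObs (R : ℕ → Fin k₁ → ℝ) (C : ℕ → Fin k₂ → ℝ)
    (F : ℕ → Ω → Matrix (Fin k₁) (Fin k₂) ℝ) (e : ℕ → ℕ → ℕ → Ω → ℝ)
    (Q : (p₁ p₂ T : ℕ) → Ω → Matrix (Fin p₂) (Fin k₂) ℝ)
    (p₁ p₂ T t : ℕ) (ω : Ω) : Matrix (Fin p₁) (Fin k₂) ℝ :=
  (p₂ : ℝ)⁻¹ • (obs R C F e p₁ p₂ t ω * (Real.sqrt p₂ • Q p₁ p₂ T ω))

/-- `M̃₁ = T⁻¹ ∑_t Ỹ_t Ỹ_t'`. -/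
def projCov (R : ℕ → Fin k₁ → ℝ) (C : ℕ → Fin k₂ → ℝ)
    (F : ℕ → Ω → Matrix (Fin k₁) (Fin k₂) ℝ) (e : ℕ → ℕ → ℕ → Ω → ℝ)
    (Q : (p₁ p₂ T : ℕ) → Ω → Matrix (Fin p₂) (Fin k₂) ℝ)
    (p₁ p₂ T : ℕ) (ω : Ω) : Matrix (Fin p₁) (Fin p₁) ℝ :=
  (T : ℝ)⁻¹ • ∑ t ∈ range T,
    projObs R C F e Q p₁ p₂ T t ω * (projObs R C F e Q p₁ p₂ T t ω).transpose

/-- The entries of `ζ̄_{ij} = Vec(∑_t F_t e_{ij,t} / √T)`, indexed by the entries of `F_t`. -/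
def zetaBar (F : ℕ → Ω → Matrix (Fin k₁) (Fin k₂) ℝ) (e : ℕ → ℕ → ℕ → Ω → ℝ)
    (T i j : ℕ) (q : Fin k₁ × Fin k₂) (ω : Ω) : ℝ :=
  (∑ t ∈ range T, F t ω q.1 q.2 * e i j t ω) / Real.sqrt T

end Model

/-! ### Assumptions -/

section Assumptions

variable {Ω : Type*} [MeasurableSpace Ω] {k₁ k₂ : ℕ}

/-- Assumptions on the common factors. -/
structure FactorAssumption (μ : Measure Ω) (F : ℕ → Ω → Matrix (Fin k₁) (Fin k₂) ℝ) : Prop where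
  measurable : ∀ t a b, Measurable fun ω => F t ω a b
  mean_zero : ∀ t a b, ∫ ω, F t ω a b ∂μ = 0
  moment : ∃ ε > 0, ∃ c₀ : ℝ, ∀ t,
    Integrable (fun ω => specNorm (F t ω) ^ (4 + ε : ℝ)) μ ∧
      ∫ ω, specNorm (F t ω) ^ (4 + ε : ℝ) ∂μ ≤ c₀
  cov_left : ∃ (S : Matrix (Fin k₁) (Fin k₁) ℝ) (hS : S.PosDef),
    Function.Injective hS.isHermitian.eigenvalues ∧
      ∀ᵐ ω ∂μ, Tendsto
        (fun T : ℕ => (T : ℝ)⁻¹ • ∑ t ∈ range T, F t ω * (F t ω).transpose) atTop (𝓝 S)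
  cov_right : ∃ (S : Matrix (Fin k₂) (Fin k₂) ℝ) (hS : S.PosDef),
    Function.Injective hS.isHermitian.eigenvalues ∧
      ∀ᵐ ω ∂μ, Tendsto
        (fun T : ℕ => (T : ℝ)⁻¹ • ∑ t ∈ range T, (F t ω).transpose * F t ω) atTop (𝓝 S)
  maximal : ∃ c₀ : ℝ, ∀ (a a' : Fin k₁) (b b' : Fin k₂) (T : ℕ),
    ∫ ω, (⨆ τ : Fin T, (∑ t ∈ range (τ + 1),
      (F t ω a b * F t ω a' b' - ∫ ω', F t ω' a b * F t ω' a' b' ∂μ)) ^ 2) ∂μ ≤ c₀ * T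

/-- Assumptions on a loading matrix: bounded entries and `p⁻¹ L'L → I`. -/
structure LoadingAssumption {k : ℕ} (L : ℕ → Fin k → ℝ) : Prop where
  bounded : ∃ c₀ : ℝ, ∀ i a, |L i a| ≤ c₀
  gram : Tendsto (fun p : ℕ =>
    specNorm ((p : ℝ)⁻¹ • ((loadingMat L p).transpose * loadingMat L p) - 1)) atTop (𝓝 0)

/-- Assumptions on the idiosyncratic components. -/
structure ErrorAssumption (μ : Measure Ω) (e : ℕ → ℕ → ℕ → Ω → ℝ) : Prop where
  measurable : ∀ i j t, Measurable (e i j t)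
  mean_zero : ∀ i j t, ∫ ω, e i j t ω ∂μ = 0
  moment : ∃ c₀ : ℝ, ∀ i j t,
    Integrable (fun ω => e i j t ω ^ 8) μ ∧ ∫ ω, e i j t ω ^ 8 ∂μ ≤ c₀
  corr_a : ∃ c₀ : ℝ, ∀ p₁ p₂ T i j t, i < p₁ → j < p₂ → t < T →
    ∑ s ∈ range T, ∑ l ∈ range p₁, ∑ h ∈ range p₂, |∫ ω, e i j t ω * e l h s ω ∂μ| ≤ c₀
  corr_b : ∃ c₀ : ℝ, ∀ p₁ p₂ i j t, i < p₁ → j < p₂ →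
    ∑ l ∈ range p₁, ∑ h ∈ range p₂, |∫ ω, e l j t ω * e i h t ω ∂μ| ≤ c₀
  cov_a₁ : ∃ c₀ : ℝ, ∀ p₁ p₂ T i l₁ j t, i < p₁ → l₁ < p₁ → j < p₂ → t < T →
    ∑ s ∈ range T, ∑ l₂ ∈ range p₁, ∑ h ∈ range p₂,
      |ProbabilityTheory.covariance (fun ω => e i j t ω * e l₁ j t ω)
        (fun ω => e i h s ω * e l₂ h s ω) μ| ≤ c₀
  cov_a₂ : ∃ c₀ : ℝ, ∀ p₁ p₂ T i j h₁ t, i < p₁ → j < p₂ → h₁ < p₂ → t < T →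
    ∑ s ∈ range T, ∑ l ∈ range p₁, ∑ h₂ ∈ range p₂,
      |ProbabilityTheory.covariance (fun ω => e i j t ω * e i h₁ t ω)
        (fun ω => e l j s ω * e l h₂ s ω) μ| ≤ c₀
  cov_a₃ : ∃ c₀ : ℝ, ∀ p₁ p₂ T i j t, i < p₁ → j < p₂ → t < T →
    ∑ s ∈ range T, ∑ l ∈ range p₁, ∑ h ∈ range p₂,
      |ProbabilityTheory.covariance (fun ω => e i j t ω * e i j t ω)
        (fun ω => e l h s ω * e l h s ω) μ| ≤ c₀
  cov_b : ∃ c₀ : ℝ, ∀ p₁ p₂ T i l₁ j h₁ t,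
    i < p₁ → l₁ < p₁ → j < p₂ → h₁ < p₂ → t < T →
    ∑ s ∈ range T, ∑ l₂ ∈ range p₁, ∑ h₂ ∈ range p₂,
      |ProbabilityTheory.covariance (fun ω => e i j t ω * e l₁ h₁ t ω)
          (fun ω => e i j s ω * e l₂ h₂ s ω) μ +
        ProbabilityTheory.covariance (fun ω => e l₁ j t ω * e i h₁ t ω)
          (fun ω => e l₂ j s ω * e i h₂ s ω) μ| ≤ c₀
  /-- The smallest eigenvalue of `E((p₂ T)⁻¹ ∑_t E_t E_t')` is positive. -/
  min_eig : ∀ p₁ p₂ T : ℕ, 0 < p₁ → 0 < p₂ → 0 < T →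
    0 < eig (Matrix.of fun i l : Fin p₁ => ∫ ω, (((p₂ : ℝ) * (T : ℝ))⁻¹ •
      ∑ t ∈ range T, errMat e p₁ p₂ t ω * (errMat e p₁ p₂ t ω).transpose) i l ∂μ) p₁

/-- Assumptions on the dependence between factors and idiosyncratic components. The maximum norms
of Kronecker products and of their covariance matrices are written entry by entry. -/
structure DependenceAssumption (μ : Measure Ω) (F : ℕ → Ω → Matrix (Fin k₁) (Fin k₂) ℝ)
    (e : ℕ → ℕ → ℕ → Ω → ℝ) : Prop where
  weak : ∃ c₀ : ℝ, ∀ (p₁ p₂ T : ℕ) (v : Fin p₁ → ℝ) (w : Fin p₂ → ℝ),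
    ∑ i, v i ^ 2 = 1 → ∑ j, w j ^ 2 = 1 →
    ∫ ω, specNorm ((Real.sqrt T)⁻¹ • ∑ t ∈ range T,
      (v ⬝ᵥ (errMat e p₁ p₂ t ω).mulVec w) • F t ω) ^ 2 ∂μ ≤ c₀
  mean_cols : ∃ c₀ : ℝ, ∀ (p₂ T i j : ℕ) (q q' : Fin k₁ × Fin k₂), j < p₂ →
    |∑ h ∈ range p₂, ∫ ω, zetaBar F e T i j q ω * zetaBar F e T i h q' ω ∂μ| ≤ c₀
  mean_rows : ∃ c₀ : ℝ, ∀ (p₁ T i j : ℕ) (q q' : Fin k₁ × Fin k₂), i < p₁ →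
    |∑ l ∈ range p₁, ∫ ω, zetaBar F e T i j q ω * zetaBar F e T l j q' ω ∂μ| ≤ c₀
  /-- Finite fourth moments, so that the covariances below exist. -/
  memLp : ∀ T i j q, MemLp (zetaBar F e T i j q) 4 μ
  cov_rows : ∃ c₀ : ℝ, ∀ (p₁ p₂ T i j h₁ : ℕ) (q₁ q₂ q₃ q₄ : Fin k₁ × Fin k₂),
    i < p₁ → j < p₂ → h₁ < p₂ →
    |∑ l ∈ range p₁, ∑ h₂ ∈ range p₂, ProbabilityTheory.covariance
      (fun ω => zetaBar F e T i j q₁ ω * zetaBar F e T i h₁ q₂ ω)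
      (fun ω => zetaBar F e T l j q₃ ω * zetaBar F e T l h₂ q₄ ω) μ| ≤ c₀
  cov_cols : ∃ c₀ : ℝ, ∀ (p₁ p₂ T i l₁ j : ℕ) (q₁ q₂ q₃ q₄ : Fin k₁ × Fin k₂),
    i < p₁ → l₁ < p₁ → j < p₂ →
    |∑ l₂ ∈ range p₁, ∑ h ∈ range p₂, ProbabilityTheory.covariance
      (fun ω => zetaBar F e T i j q₁ ω * zetaBar F e T l₁ j q₂ ω)
      (fun ω => zetaBar F e T i h q₃ ω * zetaBar F e T l₂ h q₄ ω) μ| ≤ c₀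

end Assumptions

end MatrixFactor

end

noncomputable section

namespace MatrixFactor

open Matrix

/-! ### Quadratic forms and eigenvalues -/

/-! Everything is read off the quadratic form (T p₂)⁻¹ Σ_t |Q' X_t' v|² of the projected covariance
(`projCov_quad`), where X_t' v = C F_t' R' v + E_t' v. Eigenvalues are compared with such forms by
counting dimensions (`le_eig`, `eig_le`).

The eigenvector equation itself puts Q near the column space of C. If Λ q = Σ X_t' X_t q, then q = C
g + r with r = Λ⁻¹ Σ E_t' X_t q. The signal alone forces k₂ eigenvalues Λ of order at least T p₁ p₂,
so |r|² is controlled by Σ E_t' R F_t and Σ E_t' E_t (`exists_decomp`, `Regular.exists_decomp`).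

For j ≤ k₁, the noise form is eventually below any multiple of T p₁ p₂
(`WeakDep.ae_eventually_rowOn`) and Q' is almost isometric on the range of C (`nsq_proj_ge`). Hence
the form is asymptotically that of R Σ₁ R', and the j-th eigenvalue divided by p₁ tends to that of
Σ₁.

For j > k₁, restrict to the kernel of R', whose codimension is at most k₁: only the noise is left.
With bounds A for Σ (E_t C)(E_t C)', B for Σ E_t E_t' and D for |r|², the form is at most (T p₂)⁻¹
k₂ (16 A / p₂ + 2 D B) (`sum_nsq_proj_noise_le`), and `decomp_rate` and `noise_rate` turn this into
the rate.

The almost sure bounds share one scheme. A random Gram matrix is split into its mean, whose absolute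
row sums are bounded by weak correlation, and a centred part measured in Frobenius norm, whose
second moment is a sum of covariances (`quad_le`). At sizes that are powers of two, these moments
become summable after division by their order times a power slightly above one of the product of the
exponents, so a single random constant serves all triples (`ae_le_wt`); this costs the logarithms.
General sizes follow by monotonicity (`RowOn.mono`). Two quantities are not monotone: for E_t C the
range of columns is cut into dyadic blocks (`BlockDep.ae_rowOn`), and for Σ_t F_t e_{ij,t} the time
T is compared with a grid point, the remaining window being treated by Cauchy–Schwarz
(`DependenceAssumption.ae_interSq`). -/

/-- The squared Euclidean norm. -/
def nsq {ι : Type*} [Fintype ι] (v : ι → ℝ) : ℝ := v ⬝ᵥ v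

lemma nsq_eq_sum {ι : Type*} [Fintype ι] (v : ι → ℝ) : nsq v = ∑ i, v i ^ 2 := by
  simp [nsq, dotProduct, sq]

lemma nsq_nonneg {ι : Type*} [Fintype ι] (v : ι → ℝ) : 0 ≤ nsq v := by
  rw [nsq_eq_sum]; positivity

lemma nsq_eq_zero {ι : Type*} [Fintype ι] {v : ι → ℝ} : nsq v = 0 ↔ v = 0 :=
  dotProduct_self_eq_zero

lemma nsq_pos {ι : Type*} [Fintype ι] {v : ι → ℝ} (hv : v ≠ 0) : 0 < nsq v :=
  lt_of_le_of_ne (nsq_nonneg v) fun h => hv (nsq_eq_zero.1 h.symm)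

lemma nsq_smul {ι : Type*} [Fintype ι] (c : ℝ) (v : ι → ℝ) : nsq (c • v) = c ^ 2 * nsq v := by
  simp [nsq, sq, mul_assoc]

lemma dot_sq_le {ι : Type*} [Fintype ι] (v w : ι → ℝ) : (v ⬝ᵥ w) ^ 2 ≤ nsq v * nsq w := by
  rw [nsq_eq_sum, nsq_eq_sum]
  exact Finset.sum_mul_sq_le_sq_mul_sq _ _ _

lemma nsq_add_le {ι : Type*} [Fintype ι] (v w : ι → ℝ) {δ : ℝ} (hδ : 0 < δ) :
    nsq (v + w) ≤ (1 + δ) * nsq v + (1 + 1 / δ) * nsq w := by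
  simp only [nsq_eq_sum, Finset.mul_sum, ← Finset.sum_add_distrib]
  refine Finset.sum_le_sum fun i _ => ?_
  have h : 0 ≤ (δ * v i - w i) ^ 2 / δ := by positivity
  have h2 : (δ * v i - w i) ^ 2 / δ = δ * v i ^ 2 - 2 * v i * w i + 1 / δ * w i ^ 2 := by
    field_simp
    ring
  simp only [Pi.add_apply]
  nlinarith

lemma nsq_add_ge {ι : Type*} [Fintype ι] (v w : ι → ℝ) {δ : ℝ} (hδ : 0 < δ) :
    (1 - δ) * nsq v - 1 / δ * nsq w ≤ nsq (v + w) := by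
  simp only [nsq_eq_sum, Finset.mul_sum, ← Finset.sum_sub_distrib]
  refine Finset.sum_le_sum fun i _ => ?_
  have h : 0 ≤ (δ * v i + w i) ^ 2 / δ := by positivity
  have h2 : (δ * v i + w i) ^ 2 / δ = δ * v i ^ 2 + 2 * v i * w i + 1 / δ * w i ^ 2 := by
    field_simp
    ring
  simp only [Pi.add_apply]
  nlinarith [sq_nonneg (w i)]

lemma nsq_add_le_two {ι : Type*} [Fintype ι] (v w : ι → ℝ) :
    nsq (v + w) ≤ 2 * nsq v + 2 * nsq w := by
  have := nsq_add_le v w one_pos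
  norm_num at this; linarith

lemma isHermitian_of_eig_ne {n : ℕ} {A : Matrix (Fin n) (Fin n) ℝ} {j : ℕ} (h : eig A j ≠ 0) :
    A.IsHermitian ∧ 1 ≤ j ∧ j ≤ n := by
  by_contra hc
  exact h (by simp only [eig]; exact dif_neg hc)

lemma eig_antitone {n : ℕ} {A : Matrix (Fin n) (Fin n) ℝ} (hA : A.IsHermitian) {i j : ℕ}
    (hi : 1 ≤ i) (hij : i ≤ j) (hj : j ≤ n) : eig A j ≤ eig A i := by
  have h1 : A.IsHermitian ∧ 1 ≤ i ∧ i ≤ n := ⟨hA, hi, hij.trans hj⟩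
  have h2 : A.IsHermitian ∧ 1 ≤ j ∧ j ≤ n := ⟨hA, hi.trans hij, hj⟩
  simp only [eig]
  rw [dif_pos h1, dif_pos h2]
  apply hA.eigenvalues₀_antitone
  simp only [Fin.mk_le_mk]; omega

/-- Spectral decomposition of a symmetric matrix, with the eigenvalues in decreasing order. -/
lemma exists_eigenbasis {n : ℕ} {A : Matrix (Fin n) (Fin n) ℝ} (hA : A.IsHermitian) :
    ∃ u : Fin n → Fin n → ℝ, (∀ i j, u i ⬝ᵥ u j = if i = j then 1 else 0) ∧
      (∀ i, A *ᵥ u i = eig A (i + 1) • u i) ∧ ∀ v, v = ∑ i, (u i ⬝ᵥ v) • u i := by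
  let e : Fin (Fintype.card (Fin n)) ≃ Fin n := Fintype.equivOfCardEq (Fintype.card_fin _)
  let f : Fin n ≃ Fin n := (finCongr (Fintype.card_fin n)).symm.trans e
  let b := hA.eigenvectorBasis.reindex f.symm
  have hb : ∀ i, b i = hA.eigenvectorBasis (f i) := fun i => by simp [b]
  refine ⟨fun i => b i, ?_, ?_, ?_⟩
  · intro i j
    have := orthonormal_iff_ite.1 b.orthonormal i j
    rw [← this, EuclideanSpace.inner_eq_star_dotProduct]
    simp [dotProduct_comm]
  · intro i
    have h : A.IsHermitian ∧ 1 ≤ (i : ℕ) + 1 ∧ (i : ℕ) + 1 ≤ n := ⟨hA, by omega, by omega⟩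
    have h2 : eig A (i + 1) = hA.eigenvalues (f i) := by
      simp only [eig]
      rw [dif_pos h]
      simp only [Matrix.IsHermitian.eigenvalues]
      congr 1
      simp only [f, e, Equiv.trans_apply]
      rw [Equiv.symm_apply_apply]
      ext; simp
    rw [h2]
    change A *ᵥ (b i).ofLp = _ • (b i).ofLp
    rw [hb]
    exact hA.mulVec_eigenvectorBasis _
  · intro v
    have h := b.sum_repr' (WithLp.toLp 2 v)
    have h3 : v = (WithLp.toLp 2 v : EuclideanSpace ℝ (Fin n)).ofLp := rfl
    conv_lhs => rw [h3, ← h]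
    rw [WithLp.ofLp_sum]
    refine Finset.sum_congr rfl fun i _ => ?_
    rw [WithLp.ofLp_smul, EuclideanSpace.inner_eq_star_dotProduct]
    simp [dotProduct_comm]

section Eigenbasis

variable {n : ℕ} {A : Matrix (Fin n) (Fin n) ℝ} {u : Fin n → Fin n → ℝ}

lemma nsq_eq_sum_basis (h3 : ∀ v, v = ∑ i, (u i ⬝ᵥ v) • u i) (v : Fin n → ℝ) :
    nsq v = ∑ i, (u i ⬝ᵥ v) ^ 2 := by
  unfold nsq
  nth_rewrite 1 [h3 v]
  rw [sum_dotProduct]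
  exact Finset.sum_congr rfl fun i _ => by rw [smul_dotProduct, smul_eq_mul, sq]

lemma quad_eq_sum_basis (h2 : ∀ i, A *ᵥ u i = eig A (i + 1) • u i)
    (h3 : ∀ v, v = ∑ i, (u i ⬝ᵥ v) • u i) (v : Fin n → ℝ) :
    v ⬝ᵥ A *ᵥ v = ∑ i : Fin n, eig A (i + 1) * (u i ⬝ᵥ v) ^ 2 := by
  nth_rewrite 2 [h3 v]
  rw [mulVec_sum, dotProduct_sum]
  refine Finset.sum_congr rfl fun i _ => ?_
  rw [mulVec_smul, h2, dotProduct_smul, dotProduct_smul, dotProduct_comm v]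
  simp only [smul_eq_mul]; ring

end Eigenbasis

/-- A quadratic form bounded below on a `j`-dimensional space bounds the `j`-th eigenvalue. -/
lemma le_eig {n j : ℕ} {A : Matrix (Fin n) (Fin n) ℝ} (hA : A.IsHermitian) (hj : 1 ≤ j)
    (B : (Fin j → ℝ) →ₗ[ℝ] (Fin n → ℝ)) (hB : ∀ y, B y = 0 → y = 0) {c : ℝ}
    (h : ∀ y, c * nsq (B y) ≤ B y ⬝ᵥ A *ᵥ B y) : c ≤ eig A j := by
  have hjn : j ≤ n := by
    have := LinearMap.finrank_le_finrank_of_injective (f := B)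
      ((injective_iff_map_eq_zero B).2 hB)
    simpa using this
  obtain ⟨u, h1, h2, h3⟩ := exists_eigenbasis hA
  -- Being orthogonal to the first j - 1 eigenvectors is j - 1 conditions on a j-dimensional space.
  -- A nonzero solution only meets eigenvalues up to the j-th.
  let L : (Fin j → ℝ) →ₗ[ℝ] (Fin (j - 1) → ℝ) :=
    { toFun := fun y i => u ⟨i, by omega⟩ ⬝ᵥ B y
      map_add' := fun x y => by ext i; simp
      map_smul' := fun c y => by ext i; simp }
  have hk : LinearMap.ker L ≠ ⊥ := LinearMap.ker_ne_bot_of_finrank_lt (by simp; omega)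
  obtain ⟨y, hy, hy0⟩ := Submodule.exists_mem_ne_zero_of_ne_bot hk
  have hz : ∀ i : Fin n, (i : ℕ) < j - 1 → u i ⬝ᵥ B y = 0 := fun i hi =>
    congrFun (LinearMap.mem_ker.1 hy) ⟨i, hi⟩
  have hpos : 0 < nsq (B y) := nsq_pos fun h0 => hy0 (hB y h0)
  have hle : B y ⬝ᵥ A *ᵥ B y ≤ eig A j * nsq (B y) := by
    rw [quad_eq_sum_basis h2 h3, nsq_eq_sum_basis h3, Finset.mul_sum]
    refine Finset.sum_le_sum fun i _ => ?_
    by_cases hi : (i : ℕ) < j - 1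
    · simp [hz i hi]
    · exact mul_le_mul_of_nonneg_right (eig_antitone hA hj (by omega) (by omega)) (sq_nonneg _)
  exact le_of_mul_le_mul_right ((h y).trans hle) hpos

/-- A quadratic form bounded above on a space of codimension `r < j` bounds the `j`-th
eigenvalue. -/
lemma eig_le {n j r : ℕ} {A : Matrix (Fin n) (Fin n) ℝ} (hA : A.IsHermitian) (hrj : r < j)
    (L : (Fin n → ℝ) →ₗ[ℝ] (Fin r → ℝ)) {c : ℝ} (hc : 0 ≤ c)
    (h : ∀ v, L v = 0 → v ⬝ᵥ A *ᵥ v ≤ c * nsq v) : eig A j ≤ c := by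
  -- Past the dimension the eigenvalue is 0 by convention; this is where 0 ≤ c is used.
  by_cases hjn : j ≤ n
  swap
  · have : eig A j = 0 := by
      by_contra h0
      exact hjn (isHermitian_of_eig_ne h0).2.2
    rwa [this]
  obtain ⟨u, h1, h2, h3⟩ := exists_eigenbasis hA
  -- The span of the first j eigenvectors meets the kernel of L, since r < j.
  let B : (Fin j → ℝ) →ₗ[ℝ] (Fin n → ℝ) :=
    { toFun := fun y => ∑ i, y i • u (Fin.castLE hjn i)
      map_add' := fun x y => by simp [add_smul, Finset.sum_add_distrib]
      map_smul' := fun c y => by simp [Finset.smul_sum, mul_smul] }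
  have hk : LinearMap.ker (L ∘ₗ B) ≠ ⊥ := LinearMap.ker_ne_bot_of_finrank_lt (by simpa using hrj)
  obtain ⟨y, hy, hy0⟩ := Submodule.exists_mem_ne_zero_of_ne_bot hk
  have hdot : ∀ i : Fin j, u (Fin.castLE hjn i) ⬝ᵥ B y = y i := fun i => by
    simp [B, dotProduct_sum, dotProduct_smul, h1]
  have hdot0 : ∀ i : Fin n, j ≤ (i : ℕ) → u i ⬝ᵥ B y = 0 := fun i hi => by
    simp only [B, LinearMap.coe_mk, AddHom.coe_mk, dotProduct_sum, dotProduct_smul, h1]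
    refine Finset.sum_eq_zero fun k _ => ?_
    rw [if_neg, smul_zero]
    intro hik
    have := congrArg Fin.val hik
    simp at this; omega
  have hpos : 0 < nsq (B y) := by
    refine nsq_pos fun h0 => hy0 ?_
    ext i
    rw [← hdot i, h0]; simp
  have hle : eig A j * nsq (B y) ≤ B y ⬝ᵥ A *ᵥ B y := by
    rw [quad_eq_sum_basis h2 h3, nsq_eq_sum_basis h3, Finset.mul_sum]
    refine Finset.sum_le_sum fun i _ => ?_
    by_cases hi : j ≤ (i : ℕ)
    · simp [hdot0 i hi]
    · exact mul_le_mul_of_nonneg_right (eig_antitone hA (by omega) (by omega) hjn) (sq_nonneg _)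
  exact le_of_mul_le_mul_right (hle.trans (h _ (LinearMap.mem_ker.1 hy))) hpos

lemma eig_nonneg {n : ℕ} {A : Matrix (Fin n) (Fin n) ℝ} (h : ∀ v, 0 ≤ v ⬝ᵥ A *ᵥ v) (j : ℕ) :
    0 ≤ eig A j := by
  by_contra hc
  obtain ⟨hA, h1, h2⟩ := isHermitian_of_eig_ne (ne_of_lt (not_le.1 hc))
  obtain ⟨u, hu, hu2, -⟩ := exists_eigenbasis hA
  have := h (u ⟨j - 1, by omega⟩)
  rw [hu2, dotProduct_smul, hu] at this
  simp only [if_true, smul_eq_mul, mul_one] at this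
  rw [show j - 1 + 1 = j by omega] at this
  exact hc this

/-- Test spaces on which a quadratic form is at least, respectively at most, its `j`-th
eigenvalue. -/
lemma exists_test_spaces {n j : ℕ} {A : Matrix (Fin n) (Fin n) ℝ} (hA : A.IsHermitian)
    (hj : 1 ≤ j) (hjn : j ≤ n) :
    (∃ B : (Fin j → ℝ) →ₗ[ℝ] (Fin n → ℝ), (∀ y, B y = 0 → y = 0) ∧
      ∀ y, eig A j * nsq (B y) ≤ B y ⬝ᵥ A *ᵥ B y) ∧
    ∃ L : (Fin n → ℝ) →ₗ[ℝ] (Fin (j - 1) → ℝ), ∀ v, L v = 0 →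
      v ⬝ᵥ A *ᵥ v ≤ eig A j * nsq v := by
  obtain ⟨u, h1, h2, h3⟩ := exists_eigenbasis hA
  refine ⟨⟨
    { toFun := fun y => ∑ i, y i • u (Fin.castLE hjn i)
      map_add' := fun x y => by simp [add_smul, Finset.sum_add_distrib]
      map_smul' := fun c y => by simp [Finset.smul_sum, mul_smul] }, ?_, ?_⟩,
    { toFun := fun v i => u ⟨i, by omega⟩ ⬝ᵥ v
      map_add' := fun x y => by ext i; simp
      map_smul' := fun c y => by ext i; simp }, ?_⟩
  · intro y hy
    ext i
    have : u (Fin.castLE hjn i) ⬝ᵥ (∑ i, y i • u (Fin.castLE hjn i)) = y i := by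
      simp [dotProduct_sum, dotProduct_smul, h1]
    simp only [LinearMap.coe_mk, AddHom.coe_mk] at hy
    rw [← this, hy]; simp
  · intro y
    simp only [LinearMap.coe_mk, AddHom.coe_mk]
    rw [quad_eq_sum_basis h2 h3, nsq_eq_sum_basis h3, Finset.mul_sum]
    refine Finset.sum_le_sum fun i _ => ?_
    by_cases hi : j ≤ (i : ℕ)
    · have : u i ⬝ᵥ (∑ i, y i • u (Fin.castLE hjn i)) = 0 := by
        simp only [dotProduct_sum, dotProduct_smul, h1]
        refine Finset.sum_eq_zero fun k _ => ?_
        rw [if_neg, smul_zero]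
        intro hik
        have := congrArg Fin.val hik
        simp at this; omega
      simp [this]
    · exact mul_le_mul_of_nonneg_right (eig_antitone hA (by omega) (by omega) hjn) (sq_nonneg _)
  · intro v hv
    rw [quad_eq_sum_basis h2 h3, nsq_eq_sum_basis h3, Finset.mul_sum]
    refine Finset.sum_le_sum fun i _ => ?_
    by_cases hi : (i : ℕ) < j - 1
    · have := congrFun hv ⟨i, hi⟩
      simp only [LinearMap.coe_mk, AddHom.coe_mk, Pi.zero_apply] at this
      simp [this]
    · exact mul_le_mul_of_nonneg_right (eig_antitone hA hj (by omega) (by omega)) (sq_nonneg _)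

lemma eig_pos {n j : ℕ} {A : Matrix (Fin n) (Fin n) ℝ} (hA : A.PosDef)
    (hj : 1 ≤ j) (hjn : j ≤ n) : 0 < eig A j := by
  obtain ⟨u, hu, hu2, -⟩ := exists_eigenbasis hA.isHermitian
  have hne : u ⟨j - 1, by omega⟩ ≠ 0 := fun h0 => by
    have := hu ⟨j - 1, by omega⟩ ⟨j - 1, by omega⟩
    rw [h0] at this; simp at this
  have := hA.dotProduct_mulVec_pos hne
  simp only [star_trivial] at this
  rw [hu2, dotProduct_smul, hu] at this
  simp only [if_true, smul_eq_mul, mul_one] at this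
  rwa [show j - 1 + 1 = j by omega] at this

/-- The quadratic form of a positive definite matrix is bounded below. -/
lemma exists_quad_ge {n : ℕ} {A : Matrix (Fin n) (Fin n) ℝ} (hA : A.PosDef) :
    ∃ s > 0, ∀ v, s * nsq v ≤ v ⬝ᵥ A *ᵥ v := by
  rcases Nat.eq_zero_or_pos n with rfl | hn
  · exact ⟨1, one_pos, fun v => by simp [nsq]⟩
  refine ⟨eig A n, eig_pos hA hn le_rfl, fun v => ?_⟩
  obtain ⟨u, h1, h2, h3⟩ := exists_eigenbasis hA.isHermitian
  rw [quad_eq_sum_basis h2 h3, nsq_eq_sum_basis h3, Finset.mul_sum]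
  refine Finset.sum_le_sum fun i _ => ?_
  exact mul_le_mul_of_nonneg_right
    (eig_antitone hA.isHermitian (by omega) (by omega) le_rfl) (sq_nonneg _)

/-! ### Deterministic bounds for the projected covariance matrix -/

/-- `∑_t E_t E_t' ≤ K` as quadratic forms. -/
def RowBd {m n : ℕ} (E : ℕ → Matrix (Fin m) (Fin n) ℝ) (T : ℕ) (K : ℝ) : Prop :=
  ∀ v, ∑ t ∈ range T, nsq ((E t)ᵀ *ᵥ v) ≤ K * nsq v

/-- `∑_t E_t' E_t ≤ K` as quadratic forms. -/
def ColBd {m n : ℕ} (E : ℕ → Matrix (Fin m) (Fin n) ℝ) (T : ℕ) (K : ℝ) : Prop :=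
  ∀ w, ∑ t ∈ range T, nsq (E t *ᵥ w) ≤ K * nsq w

/-- Cauchy–Schwarz for √g and √h, for summands of which only the squares are bounded, such as inner
products. -/
lemma sum_sq_le_of_sq_le {ι : Type*} (s : Finset ι) {f g h : ι → ℝ} (hg : ∀ i, 0 ≤ g i)
    (hh : ∀ i, 0 ≤ h i) (hf : ∀ i, f i ^ 2 ≤ g i * h i) :
    (∑ i ∈ s, f i) ^ 2 ≤ (∑ i ∈ s, g i) * ∑ i ∈ s, h i := by
  have h1 : |∑ i ∈ s, f i| ≤ ∑ i ∈ s, √(g i) * √(h i) :=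
    (Finset.abs_sum_le_sum_abs _ _).trans (Finset.sum_le_sum fun i _ => by
      rw [← Real.sqrt_mul (hg i)]
      exact Real.abs_le_sqrt (hf i))
  calc (∑ i ∈ s, f i) ^ 2 = |∑ i ∈ s, f i| ^ 2 := (sq_abs _).symm
    _ ≤ (∑ i ∈ s, √(g i) * √(h i)) ^ 2 := by gcongr
    _ ≤ (∑ i ∈ s, √(g i) ^ 2) * ∑ i ∈ s, √(h i) ^ 2 := Finset.sum_mul_sq_le_sq_mul_sq _ _ _
    _ = _ := by simp only [Real.sq_sqrt (hg _), Real.sq_sqrt (hh _)]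

/-- The map w ↦ (E_t w)_t and its adjoint z ↦ Σ E_t' z_t have the same norm. -/
lemma ColBd.dual {m n : ℕ} {E : ℕ → Matrix (Fin m) (Fin n) ℝ} {T : ℕ} {K : ℝ} (hK : 0 ≤ K)
    (h : ColBd E T K) (z : ℕ → Fin m → ℝ) :
    nsq (∑ t ∈ range T, (E t)ᵀ *ᵥ z t) ≤ K * ∑ t ∈ range T, nsq (z t) := by
  set w := ∑ t ∈ range T, (E t)ᵀ *ᵥ z t with hw
  have h1 : nsq w = ∑ t ∈ range T, E t *ᵥ w ⬝ᵥ z t := by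
    conv_lhs => rw [nsq]
    nth_rewrite 2 [hw]
    rw [dotProduct_sum]
    refine Finset.sum_congr rfl fun t _ => ?_
    rw [dotProduct_mulVec, vecMul_transpose]
  have h0 : 0 ≤ ∑ t ∈ range T, nsq (z t) := Finset.sum_nonneg fun _ _ => nsq_nonneg _
  have h2 : nsq w ^ 2 ≤ (K * nsq w) * ∑ t ∈ range T, nsq (z t) := by
    calc nsq w ^ 2 = (∑ t ∈ range T, E t *ᵥ w ⬝ᵥ z t) ^ 2 := by rw [h1]
      _ ≤ (∑ t ∈ range T, nsq (E t *ᵥ w)) * ∑ t ∈ range T, nsq (z t) :=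
          sum_sq_le_of_sq_le _ (fun _ => nsq_nonneg _) (fun _ => nsq_nonneg _)
            fun _ => dot_sq_le _ _
      _ ≤ _ := mul_le_mul_of_nonneg_right (h w) h0
  rcases (nsq_nonneg w).eq_or_lt with h3 | h3
  · rw [← h3]; positivity
  · nlinarith

lemma nsq_transpose_mulVec_le {m n : ℕ} {A : Matrix (Fin m) (Fin n) ℝ} {K : ℝ} (hK : 0 ≤ K)
    (h : ∀ w, nsq (A *ᵥ w) ≤ K * nsq w) (v : Fin m → ℝ) :
    nsq (Aᵀ *ᵥ v) ≤ K * nsq v := by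
  have h1 : ColBd (fun _ => A) 1 K := fun w => by simpa using h w
  simpa using h1.dual hK fun _ => v

lemma nsq_mulVec_le_frobenius {m n : ℕ} (A : Matrix (Fin m) (Fin n) ℝ) (w : Fin n → ℝ) :
    nsq (A *ᵥ w) ≤ (∑ i, ∑ j, A i j ^ 2) * nsq w := by
  rw [nsq_eq_sum (A *ᵥ w), Finset.sum_mul]
  refine Finset.sum_le_sum fun i _ => ?_
  rw [← nsq_eq_sum (A i)]
  exact dot_sq_le _ _

lemma dot_mulVec_eq {m n : ℕ} (A : Matrix (Fin m) (Fin n) ℝ) (v : Fin m → ℝ) (w : Fin n → ℝ) :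
    v ⬝ᵥ A *ᵥ w = (Aᵀ *ᵥ v) ⬝ᵥ w := by
  rw [dotProduct_mulVec, mulVec_transpose]

lemma nsq_neg {ι : Type*} [Fintype ι] (v : ι → ℝ) : nsq (-v) = nsq v := by simp [nsq]

lemma nsq_sum_smul_le {ι κ : Type*} [Fintype ι] [Fintype κ] (a : κ → ℝ) (r : κ → ι → ℝ) {D : ℝ}
    (hr : ∀ m, nsq (r m) ≤ D) : nsq (∑ m, a m • r m) ≤ (Fintype.card κ * D) * nsq a := by
  have : nsq (∑ m, a m • r m) ≤ ∑ i, (∑ m, a m ^ 2) * ∑ m, r m i ^ 2 := by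
    rw [nsq_eq_sum]
    refine Finset.sum_le_sum fun i _ => ?_
    simp only [Finset.sum_apply, Pi.smul_apply, smul_eq_mul]
    exact Finset.sum_mul_sq_le_sq_mul_sq _ _ _
  refine this.trans ?_
  rw [← Finset.mul_sum, ← nsq_eq_sum, mul_comm, Finset.sum_comm]
  refine mul_le_mul_of_nonneg_right ?_ (nsq_nonneg _)
  calc ∑ m, ∑ i, r m i ^ 2 ≤ ∑ _m : κ, D :=
        Finset.sum_le_sum fun m _ => by rw [← nsq_eq_sum]; exact hr m
    _ = _ := by simp

section Deterministic

variable {k₁ k₂ p₁ p₂ T : ℕ} {R : Matrix (Fin p₁) (Fin k₁) ℝ} {C : Matrix (Fin p₂) (Fin k₂) ℝ}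
  {F : ℕ → Matrix (Fin k₁) (Fin k₂) ℝ} {E X : ℕ → Matrix (Fin p₁) (Fin p₂) ℝ}
  {Q : Matrix (Fin p₂) (Fin k₂) ℝ}

lemma obs_mulVec (hX : ∀ t, X t = R * F t * Cᵀ + E t) (t : ℕ) (x : Fin p₂ → ℝ) :
    X t *ᵥ x = R *ᵥ F t *ᵥ Cᵀ *ᵥ x + E t *ᵥ x := by
  rw [hX, add_mulVec, mulVec_mulVec, mulVec_mulVec, Matrix.mul_assoc]

lemma obs_transpose_mulVec (hX : ∀ t, X t = R * F t * Cᵀ + E t) (t : ℕ) (v : Fin p₁ → ℝ) :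
    (X t)ᵀ *ᵥ v = C *ᵥ (F t)ᵀ *ᵥ Rᵀ *ᵥ v + (E t)ᵀ *ᵥ v := by
  rw [hX, transpose_add, add_mulVec, mulVec_mulVec, mulVec_mulVec, transpose_mul, transpose_mul,
    transpose_transpose, Matrix.mul_assoc]

/-- The signal dominates the quadratic form of `∑_t X_t' X_t` on the column space of `C`. -/
lemma sum_nsq_obs_ge (hX : ∀ t, X t = R * F t * Cᵀ + E t) {s η : ℝ} (hs : 0 ≤ s)
    (hp₂ : 0 < p₂)
    (hR : ∀ y, (p₁ / 2 : ℝ) * nsq y ≤ nsq (R *ᵥ y)) (hC : ∀ y, (p₂ / 2 : ℝ) * nsq y ≤ nsq (C *ᵥ y))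
    (hF : ∀ y, s * T * nsq y ≤ ∑ t ∈ range T, nsq (F t *ᵥ y))
    (hE : ColBd E T (η * (T * p₁ * p₂))) (y : Fin k₂ → ℝ) :
    (s / 8 - 2 * η) * (T * p₁ * p₂) * nsq (C *ᵥ y) ≤
      ∑ t ∈ range T, nsq (X t *ᵥ C *ᵥ y) := by
  set x := C *ᵥ y with hx
  -- C' is bounded below on the range of C: |x|² = C'x · y ≤ |C'x| |y|, while |y|² ≤ (2 / p₂) |x|².
  have h1 : (p₂ / 2 : ℝ) * nsq x ≤ nsq (Cᵀ *ᵥ x) := by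
    have ha : nsq x ^ 2 ≤ nsq (Cᵀ *ᵥ x) * nsq y := by
      have : nsq x = (Cᵀ *ᵥ x) ⬝ᵥ y := by
        rw [← dot_mulVec_eq]; exact rfl
      rw [this]; exact dot_sq_le _ _
    have hb := hC y
    rw [← hx] at hb
    rcases (nsq_nonneg x).eq_or_lt with h3 | h3
    · rw [← h3, mul_zero]; exact nsq_nonneg _
    · have hp : (0 : ℝ) < p₂ := by exact_mod_cast hp₂
      have hc := nsq_nonneg (Cᵀ *ᵥ x)
      have : (p₂ / 2 : ℝ) * nsq x ^ 2 ≤ nsq (Cᵀ *ᵥ x) * nsq x := by nlinarith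
      rw [sq, ← mul_assoc] at this
      exact le_of_mul_le_mul_right this h3
  have h2 : ∀ t, (1 / 2 : ℝ) * (p₁ / 2 * nsq (F t *ᵥ Cᵀ *ᵥ x)) - 2 * nsq (E t *ᵥ x) ≤
      nsq (X t *ᵥ x) := fun t => by
    rw [obs_mulVec hX]
    have := nsq_add_ge (R *ᵥ F t *ᵥ Cᵀ *ᵥ x) (E t *ᵥ x) (δ := 1 / 2) (by norm_num)
    have := hR (F t *ᵥ Cᵀ *ᵥ x)
    norm_num at *
    linarith
  have h3 := Finset.sum_le_sum fun t (_ : t ∈ range T) => h2 t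
  rw [Finset.sum_sub_distrib, ← Finset.mul_sum, ← Finset.mul_sum, ← Finset.mul_sum] at h3
  refine le_trans ?_ h3
  have h4 := hE x
  have h5 := hF (Cᵀ *ᵥ x)
  have h6 : s * T * (p₂ / 2 * nsq x) ≤ ∑ t ∈ range T, nsq (F t *ᵥ Cᵀ *ᵥ x) :=
    (mul_le_mul_of_nonneg_left h1 (by positivity)).trans h5
  have h7 : (p₁ / 2 : ℝ) * (s * T * (p₂ / 2 * nsq x)) ≤
      p₁ / 2 * ∑ t ∈ range T, nsq (F t *ᵥ Cᵀ *ᵥ x) := by gcongr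
  linarith

/-- A leading eigenvector is close to the column space of `C`. -/
lemma exists_decomp (hX : ∀ t, X t = R * F t * Cᵀ + E t) {Λ L σ K : ℝ} (hL : 0 < L) (hΛ : L ≤ Λ)
    (hK : 0 ≤ K) (hσ : 0 ≤ σ)
    (hC : ∀ y, nsq (C *ᵥ y) ≤ 2 * p₂ * nsq y) (hE : ColBd E T K)
    (hS : ∀ y, nsq (∑ t ∈ range T, (E t)ᵀ *ᵥ R *ᵥ F t *ᵥ y) ≤ σ * nsq y)
    {q : Fin p₂ → ℝ} (hq : nsq q = 1)
    (hev : ∑ t ∈ range T, (X t)ᵀ *ᵥ X t *ᵥ q = Λ • q) :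
    ∃ g r, q = C *ᵥ g + r ∧ nsq r ≤ 2 * (2 * p₂ * σ + K ^ 2) / L ^ 2 := by
  have hΛ0 : 0 < Λ := hL.trans_le hΛ
  -- In Λ q = Σ X_t' X_t q only the left factor X_t' is split into signal and noise; its signal part
  -- lies in the range of C.
  refine ⟨Λ⁻¹ • ∑ t ∈ range T, (F t)ᵀ *ᵥ Rᵀ *ᵥ X t *ᵥ q,
    Λ⁻¹ • ∑ t ∈ range T, (E t)ᵀ *ᵥ X t *ᵥ q, ?_, ?_⟩
  · rw [mulVec_smul, ← smul_add, mulVec_sum, ← Finset.sum_add_distrib]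
    simp only [← obs_transpose_mulVec hX]
    rw [hev, smul_smul, inv_mul_cancel₀ hΛ0.ne', one_smul]
  · rw [nsq_smul]
    have h1 : ∑ t ∈ range T, (E t)ᵀ *ᵥ X t *ᵥ q =
        ∑ t ∈ range T, (E t)ᵀ *ᵥ R *ᵥ F t *ᵥ Cᵀ *ᵥ q + ∑ t ∈ range T, (E t)ᵀ *ᵥ E t *ᵥ q := by
      rw [← Finset.sum_add_distrib]
      refine Finset.sum_congr rfl fun t _ => ?_
      rw [obs_mulVec hX, mulVec_add]
    have h2 : nsq (∑ t ∈ range T, (E t)ᵀ *ᵥ E t *ᵥ q) ≤ K ^ 2 := by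
      refine (hE.dual hK _).trans ?_
      have := hE q
      rw [hq, mul_one] at this
      rw [sq]; gcongr
    have h3 : nsq (Cᵀ *ᵥ q) ≤ 2 * p₂ := by
      have := nsq_transpose_mulVec_le (by positivity) hC q
      rwa [hq, mul_one] at this
    have h4 : nsq (∑ t ∈ range T, (E t)ᵀ *ᵥ X t *ᵥ q) ≤ 2 * (2 * p₂ * σ + K ^ 2) := by
      rw [h1]
      refine (nsq_add_le_two _ _).trans ?_
      have := (hS (Cᵀ *ᵥ q)).trans (mul_le_mul_of_nonneg_left h3 hσ)
      linarith
    rw [inv_pow, inv_mul_eq_div]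
    gcongr

/-- The quadratic form of the projected noise. -/
lemma sum_nsq_proj_noise_le {A B D : ℝ} (hD : D ≤ 1) (hp₂ : 0 < p₂)
    (hC : ∀ y, (p₂ / 2 : ℝ) * nsq y ≤ nsq (C *ᵥ y)) (hQ : Qᵀ * Q = 1)
    {g : Fin k₂ → Fin k₂ → ℝ} {r : Fin k₂ → Fin p₂ → ℝ}
    (hdec : ∀ m, Q.col m = C *ᵥ g m + r m) (hr : ∀ m, nsq (r m) ≤ D)
    (hB : RowBd E T B) (hAv : RowBd (fun t => E t * C) T A) (v : Fin p₁ → ℝ) :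
    ∑ t ∈ range T, nsq (Qᵀ *ᵥ (E t)ᵀ *ᵥ v) ≤ k₂ * (16 / p₂ * A + 2 * D * B) * nsq v := by
  have hp : (0 : ℝ) < p₂ := by exact_mod_cast hp₂
  have hq : ∀ m, nsq (Q.col m) = 1 := fun m => by
    have := congrFun (congrFun hQ m) m
    simpa [nsq, Matrix.mul_apply, dotProduct] using this
  -- C g = q - r has squared norm at most 2 + 2D ≤ 4, and C expands squared norms by at least p₂ /
  -- 2.
  have hg : ∀ m, nsq (g m) ≤ 8 / p₂ := fun m => by
    have h1 : nsq (C *ᵥ g m) ≤ 4 := by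
      have : C *ᵥ g m = Q.col m + -r m := by rw [hdec]; simp
      rw [this]
      refine (nsq_add_le_two _ _).trans ?_
      rw [nsq_neg, hq]; linarith [hr m]
    rw [le_div_iff₀ hp]
    linarith [hC (g m)]
  have h1 : ∀ t m, (Qᵀ *ᵥ (E t)ᵀ *ᵥ v) m ^ 2 ≤
      16 / p₂ * nsq ((E t * C)ᵀ *ᵥ v) + 2 * D * nsq ((E t)ᵀ *ᵥ v) := fun t m => by
    have ha : (Qᵀ *ᵥ (E t)ᵀ *ᵥ v) m =
        g m ⬝ᵥ ((E t * C)ᵀ *ᵥ v) + r m ⬝ᵥ ((E t)ᵀ *ᵥ v) := by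
      have : (Qᵀ *ᵥ (E t)ᵀ *ᵥ v) m = Q.col m ⬝ᵥ ((E t)ᵀ *ᵥ v) := rfl
      rw [this, hdec, add_dotProduct, transpose_mul, ← mulVec_mulVec,
        dot_mulVec_eq Cᵀ, transpose_transpose]
    have hb := dot_sq_le (g m) ((E t * C)ᵀ *ᵥ v)
    have hc := dot_sq_le (r m) ((E t)ᵀ *ᵥ v)
    have hd := mul_le_mul_of_nonneg_right (hg m) (nsq_nonneg ((E t * C)ᵀ *ᵥ v))
    have he := mul_le_mul_of_nonneg_right (hr m) (nsq_nonneg ((E t)ᵀ *ᵥ v))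
    rw [ha]
    have : (16 : ℝ) / p₂ = 2 * (8 / p₂) := by ring
    rw [this]
    nlinarith [sq_nonneg (g m ⬝ᵥ ((E t * C)ᵀ *ᵥ v) - r m ⬝ᵥ ((E t)ᵀ *ᵥ v))]
  have h2 : ∀ t, nsq (Qᵀ *ᵥ (E t)ᵀ *ᵥ v) ≤
      k₂ * (16 / p₂ * nsq ((E t * C)ᵀ *ᵥ v) + 2 * D * nsq ((E t)ᵀ *ᵥ v)) := fun t => by
    rw [nsq_eq_sum]
    refine (Finset.sum_le_sum fun m _ => h1 t m).trans ?_
    rw [Finset.sum_const, Finset.card_univ, Fintype.card_fin, nsmul_eq_mul]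
  -- That D is nonnegative is only known through a column of Q, so the case without columns is
  -- separate.
  rcases Nat.eq_zero_or_pos k₂ with rfl | hk
  · refine (Finset.sum_le_sum fun t _ => h2 t).trans ?_
    simp
  have hD0 : 0 ≤ D := (nsq_nonneg _).trans (hr ⟨0, hk⟩)
  refine (Finset.sum_le_sum fun t _ => h2 t).trans ?_
  rw [← Finset.mul_sum, Finset.sum_add_distrib, ← Finset.mul_sum, ← Finset.mul_sum]
  have h3 := mul_le_mul_of_nonneg_left (hAv v) (by positivity : (0 : ℝ) ≤ 16 / p₂)
  have h4 := mul_le_mul_of_nonneg_left (hB v) (by positivity : (0 : ℝ) ≤ 2 * D)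
  have h5 : (0 : ℝ) ≤ k₂ := by positivity
  nlinarith

lemma nsq_mulVec_of_orthonormal (hQ : Qᵀ * Q = 1) (y : Fin k₂ → ℝ) : nsq (Q *ᵥ y) = nsq y := by
  rw [nsq, dot_mulVec_eq, mulVec_mulVec, hQ, one_mulVec]; rfl

lemma nsq_transpose_mulVec_of_orthonormal (hQ : Qᵀ * Q = 1) (x : Fin p₂ → ℝ) :
    nsq (Qᵀ *ᵥ x) ≤ nsq x := by
  have := nsq_transpose_mulVec_le (A := Q) zero_le_one
    (fun w => by rw [nsq_mulVec_of_orthonormal hQ, one_mul]) x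
  rwa [one_mul] at this

/-- `Q'` is almost isometric on the column space of `C`. -/
lemma nsq_proj_ge {D δ : ℝ} (hδ : 0 < δ) (hδ1 : δ ≤ 1 / 5) (hD : k₂ * D ≤ δ ^ 2)
    (hQ : Qᵀ * Q = 1) {g : Fin k₂ → Fin k₂ → ℝ} {r : Fin k₂ → Fin p₂ → ℝ}
    (hdec : ∀ m, Q.col m = C *ᵥ g m + r m) (hr : ∀ m, nsq (r m) ≤ D) (z : Fin k₂ → ℝ) :
    (1 - 5 * δ) * nsq (C *ᵥ z) ≤ nsq (Qᵀ *ᵥ C *ᵥ z) := by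
  -- Linear combinations of the columns decompose as Q α = C G(α) + ρ(α), with |ρ(α)| ≤ δ |α|.
  let G : (Fin k₂ → ℝ) →ₗ[ℝ] (Fin k₂ → ℝ) :=
    { toFun := fun α => ∑ m, α m • g m
      map_add' := fun x y => by simp [add_smul, Finset.sum_add_distrib]
      map_smul' := fun c y => by simp [Finset.smul_sum, mul_smul] }
  set ρ : (Fin k₂ → ℝ) → Fin p₂ → ℝ := fun α => ∑ m, α m • r m with hρ
  have hQα : ∀ α, Q *ᵥ α = C *ᵥ G α + ρ α := fun α => by
    have h1 : Q *ᵥ α = ∑ m, α m • Q.col m := by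
      ext i; simp [mulVec, dotProduct, Matrix.col, mul_comm]
    rw [h1]
    simp only [hdec, smul_add, Finset.sum_add_distrib, G, LinearMap.coe_mk, AddHom.coe_mk, hρ,
      mulVec_sum, mulVec_smul]
  have hρn : ∀ α, nsq (ρ α) ≤ δ ^ 2 * nsq α := fun α => by
    have := nsq_sum_smul_le α r hr
    rw [Fintype.card_fin] at this
    exact this.trans (mul_le_mul_of_nonneg_right hD (nsq_nonneg _))
  -- A kernel vector satisfies |α| = |Q α| = |ρ(α)| ≤ δ |α|. As G is square it is also onto, so
  -- every C z has the form Q α - ρ(α).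
  have hinj : Function.Injective G := by
    refine (injective_iff_map_eq_zero G).2 fun α hα => ?_
    have h1 := hQα α
    rw [hα, mulVec_zero, zero_add] at h1
    have h2 := hρn α
    rw [← h1, nsq_mulVec_of_orthonormal hQ] at h2
    have h3 := nsq_nonneg α
    have h4 : δ ^ 2 ≤ 1 / 2 := by nlinarith
    refine nsq_eq_zero.1 (le_antisymm ?_ h3)
    nlinarith
  obtain ⟨α, rfl⟩ := (LinearMap.injective_iff_surjective.1 hinj) z
  have hC : C *ᵥ G α = Q *ᵥ α + -ρ α := by rw [hQα]; simp
  have hQC : Qᵀ *ᵥ C *ᵥ G α = α + -(Qᵀ *ᵥ ρ α) := by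
    rw [hC, mulVec_add, mulVec_mulVec, hQ, one_mulVec, mulVec_neg]
  -- This gives at least (1 - 2δ)|α|² for the projected vector and at most (1 + 3δ)|α|² for C z, and
  -- (1 - 5δ)(1 + 3δ) ≤ 1 - 2δ.
  have h1 := nsq_add_ge α (-(Qᵀ *ᵥ ρ α)) hδ
  have h2 := nsq_add_le (Q *ᵥ α) (-ρ α) hδ
  rw [nsq_neg] at h1 h2
  rw [← hQC] at h1
  rw [← hC, nsq_mulVec_of_orthonormal hQ] at h2
  have h3 := (nsq_transpose_mulVec_of_orthonormal hQ (ρ α)).trans (hρn α)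
  have h4 := hρn α
  have h5 := nsq_nonneg α
  have h6 : 1 / δ * nsq (Qᵀ *ᵥ ρ α) ≤ δ * nsq α := by
    rw [div_mul_eq_mul_div, one_mul, div_le_iff₀ hδ]; linarith
  have h7 : 1 / δ * nsq (ρ α) ≤ δ * nsq α := by
    rw [div_mul_eq_mul_div, one_mul, div_le_iff₀ hδ]; linarith
  have h10 : δ ^ 2 * nsq α ≤ δ * nsq α := by gcongr; nlinarith
  have h8 : nsq (C *ᵥ G α) ≤ (1 + 3 * δ) * nsq α := by nlinarith
  have h9 : (1 - 5 * δ) * nsq (C *ᵥ G α) ≤ (1 - 5 * δ) * ((1 + 3 * δ) * nsq α) :=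
    mul_le_mul_of_nonneg_left h8 (by linarith)
  nlinarith

/-- Upper bound for the projected quadratic form. -/
lemma sum_nsq_proj_le (hX : ∀ t, X t = R * F t * Cᵀ + E t) {δ η s : ℝ} (hδ : 0 < δ)
    (hs : 0 ≤ s) {S : Matrix (Fin k₁) (Fin k₁) ℝ}
    (hR : ∀ y, nsq (R *ᵥ y) ≤ (1 + δ) * p₁ * nsq y) (hC : ∀ y, nsq (C *ᵥ y) ≤ (1 + δ) * p₂ * nsq y)
    (hF : ∀ y, ∑ t ∈ range T, nsq ((F t)ᵀ *ᵥ y) ≤ T * (y ⬝ᵥ S *ᵥ y) + δ * T * nsq y)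
    (hE : RowBd E T (η * (T * p₁ * p₂))) (hQ : Qᵀ * Q = 1) {v : Fin p₁ → ℝ}
    (hv : (Rᵀ *ᵥ v) ⬝ᵥ S *ᵥ (Rᵀ *ᵥ v) ≤ s * nsq (Rᵀ *ᵥ v)) :
    ∑ t ∈ range T, nsq (Qᵀ *ᵥ (X t)ᵀ *ᵥ v) ≤
      ((1 + δ) ^ 3 * (s + δ) + (1 + 1 / δ) * η) * (T * p₁ * p₂) * nsq v := by
  have h1 : ∀ t, nsq (Qᵀ *ᵥ (X t)ᵀ *ᵥ v) ≤
      (1 + δ) * ((1 + δ) * p₂ * nsq ((F t)ᵀ *ᵥ Rᵀ *ᵥ v)) + (1 + 1 / δ) * nsq ((E t)ᵀ *ᵥ v) :=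
    fun t => by
    refine (nsq_transpose_mulVec_of_orthonormal hQ _).trans ?_
    rw [obs_transpose_mulVec hX]
    refine (nsq_add_le _ _ hδ).trans ?_
    gcongr
    exact hC _
  refine (Finset.sum_le_sum fun t _ => h1 t).trans ?_
  rw [Finset.sum_add_distrib, ← Finset.mul_sum, ← Finset.mul_sum, ← Finset.mul_sum]
  have h2 := hF (Rᵀ *ᵥ v)
  have h3 := nsq_transpose_mulVec_le (by positivity) hR v
  have h4 := hE v
  have h5 : ∑ t ∈ range T, nsq ((F t)ᵀ *ᵥ Rᵀ *ᵥ v) ≤ T * (s + δ) * ((1 + δ) * p₁ * nsq v) := by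
    calc _ ≤ _ := h2
      _ ≤ T * (s * nsq (Rᵀ *ᵥ v)) + δ * T * nsq (Rᵀ *ᵥ v) := by gcongr
      _ = T * (s + δ) * nsq (Rᵀ *ᵥ v) := by ring
      _ ≤ _ := by gcongr
  have h6 : (1 + δ) * ((1 + δ) * p₂ * ∑ t ∈ range T, nsq ((F t)ᵀ *ᵥ Rᵀ *ᵥ v)) ≤
      (1 + δ) * ((1 + δ) * p₂ * (T * (s + δ) * ((1 + δ) * p₁ * nsq v))) := by gcongr
  have h7 : (1 + 1 / δ) * ∑ t ∈ range T, nsq ((E t)ᵀ *ᵥ v) ≤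
      (1 + 1 / δ) * (η * (T * p₁ * p₂) * nsq v) := by gcongr
  linarith

/-- Lower bound for the projected quadratic form at `v = R w`. -/
lemma le_sum_nsq_proj (hX : ∀ t, X t = R * F t * Cᵀ + E t) {δ η s : ℝ} (hδ : 0 < δ)
    (hδ1 : δ ≤ 1 / 5) (hs : δ ≤ s) {S : Matrix (Fin k₁) (Fin k₁) ℝ}
    (hR : ∀ y, (1 - δ) * p₁ * nsq y ≤ nsq (R *ᵥ y)) (hC : ∀ y, (1 - δ) * p₂ * nsq y ≤ nsq (C *ᵥ y))
    (hQC : ∀ z, (1 - 5 * δ) * nsq (C *ᵥ z) ≤ nsq (Qᵀ *ᵥ C *ᵥ z))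
    (hF : ∀ y, T * (y ⬝ᵥ S *ᵥ y) - δ * T * nsq y ≤ ∑ t ∈ range T, nsq ((F t)ᵀ *ᵥ y))
    (hE : RowBd E T (η * (T * p₁ * p₂))) (hQ : Qᵀ * Q = 1) {w : Fin k₁ → ℝ}
    (hv : s * nsq (Rᵀ *ᵥ R *ᵥ w) ≤ (Rᵀ *ᵥ R *ᵥ w) ⬝ᵥ S *ᵥ (Rᵀ *ᵥ R *ᵥ w)) :
    ((1 - 5 * δ) * (1 - δ) ^ 3 * (s - δ) - η / δ) * (T * p₁ * p₂) * nsq (R *ᵥ w) ≤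
      ∑ t ∈ range T, nsq (Qᵀ *ᵥ (X t)ᵀ *ᵥ R *ᵥ w) := by
  set v := R *ᵥ w with hvw
  set y := Rᵀ *ᵥ v with hy
  have hδ2 : 0 ≤ 1 - δ := by linarith
  have hδ3 : 0 ≤ 1 - 5 * δ := by linarith
  have hsδ : 0 ≤ s - δ := by linarith
  have h1 : ∀ t, (1 - δ) * ((1 - 5 * δ) * ((1 - δ) * p₂ * nsq ((F t)ᵀ *ᵥ y))) -
      1 / δ * nsq ((E t)ᵀ *ᵥ v) ≤ nsq (Qᵀ *ᵥ (X t)ᵀ *ᵥ v) := fun t => by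
    rw [obs_transpose_mulVec hX, mulVec_add]
    refine le_trans ?_ (nsq_add_ge _ _ hδ)
    have ha := (mul_le_mul_of_nonneg_left (hC ((F t)ᵀ *ᵥ y)) hδ3).trans (hQC _)
    have hb := nsq_transpose_mulVec_of_orthonormal hQ ((E t)ᵀ *ᵥ v)
    have hc : 0 ≤ 1 / δ := by positivity
    gcongr
  refine le_trans ?_ (Finset.sum_le_sum fun t _ => h1 t)
  rw [Finset.sum_sub_distrib, ← Finset.mul_sum, ← Finset.mul_sum, ← Finset.mul_sum,
    ← Finset.mul_sum]
  -- R' is bounded below on the range of R, because |v|² = R'v · w for v = R w.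
  have h2 : (1 - δ) * p₁ * nsq v ≤ nsq y := by
    have ha : nsq v ^ 2 ≤ nsq y * nsq w := by
      have : nsq v = y ⬝ᵥ w := by rw [hy, ← dot_mulVec_eq, ← hvw]; rfl
      rw [this]; exact dot_sq_le _ _
    have hb := hR w
    rw [← hvw] at hb
    rcases (nsq_nonneg v).eq_or_lt with h3 | h3
    · rw [← h3, mul_zero]; exact nsq_nonneg _
    · have hc := nsq_nonneg y
      have : (1 - δ) * p₁ * nsq v ^ 2 ≤ nsq y * nsq v := by
        have : 0 ≤ (1 - δ) * p₁ := by positivity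
        nlinarith
      rw [sq, ← mul_assoc] at this
      exact le_of_mul_le_mul_right this h3
  have h3 := hF y
  have h4 := hE v
  have h5 : T * (s - δ) * ((1 - δ) * p₁ * nsq v) ≤ ∑ t ∈ range T, nsq ((F t)ᵀ *ᵥ y) := by
    calc _ ≤ T * (s - δ) * nsq y := by gcongr
      _ = T * (s * nsq y) - δ * T * nsq y := by ring
      _ ≤ T * (y ⬝ᵥ S *ᵥ y) - δ * T * nsq y := by gcongr
      _ ≤ _ := h3
  have h6 : (1 - δ) * ((1 - 5 * δ) * ((1 - δ) * p₂ * (T * (s - δ) * ((1 - δ) * p₁ * nsq v)))) ≤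
      (1 - δ) * ((1 - 5 * δ) * ((1 - δ) * p₂ * ∑ t ∈ range T, nsq ((F t)ᵀ *ᵥ y))) := by gcongr
  have h7 : 1 / δ * ∑ t ∈ range T, nsq ((E t)ᵀ *ᵥ v) ≤
      1 / δ * (η * (T * p₁ * p₂) * nsq v) := by gcongr
  have h8 : η / δ = 1 / δ * η := by ring
  rw [h8]
  linarith

end Deterministic

/-! ### The matrices of the model -/

section ModelMatrices

variable {Ω : Type*} {k₁ k₂ : ℕ} {R : ℕ → Fin k₁ → ℝ} {C : ℕ → Fin k₂ → ℝ}
  {F : ℕ → Ω → Matrix (Fin k₁) (Fin k₂) ℝ} {e : ℕ → ℕ → ℕ → Ω → ℝ}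
  {Q : (p₁ p₂ T : ℕ) → Ω → Matrix (Fin p₂) (Fin k₂) ℝ} {p₁ p₂ T : ℕ} {ω : Ω}

lemma rowCov_isHermitian : (rowCov R C F e p₁ p₂ T ω).IsHermitian := by
  unfold Matrix.IsHermitian rowCov
  rw [conjTranspose_eq_transpose_of_trivial]
  simp [transpose_sum, transpose_mul]

lemma projCov_isHermitian : (projCov R C F e Q p₁ p₂ T ω).IsHermitian := by
  unfold Matrix.IsHermitian projCov
  rw [conjTranspose_eq_transpose_of_trivial]
  simp [transpose_sum, transpose_mul]

lemma rowCov_mulVec (x : Fin p₂ → ℝ) : rowCov R C F e p₁ p₂ T ω *ᵥ x =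
    ((T : ℝ) * p₁)⁻¹ • ∑ t ∈ range T, (obs R C F e p₁ p₂ t ω)ᵀ *ᵥ obs R C F e p₁ p₂ t ω *ᵥ x := by
  rw [rowCov, smul_mulVec, sum_mulVec]
  simp [mulVec_mulVec]

lemma rowCov_quad (x : Fin p₂ → ℝ) : x ⬝ᵥ rowCov R C F e p₁ p₂ T ω *ᵥ x =
    ((T : ℝ) * p₁)⁻¹ * ∑ t ∈ range T, nsq (obs R C F e p₁ p₂ t ω *ᵥ x) := by
  rw [rowCov_mulVec, dotProduct_smul, smul_eq_mul, dotProduct_sum]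
  simp only [dot_mulVec_eq _ x, transpose_transpose]
  rfl

lemma projCov_quad (hp₂ : 0 < p₂) (v : Fin p₁ → ℝ) : v ⬝ᵥ projCov R C F e Q p₁ p₂ T ω *ᵥ v =
    ((T : ℝ) * p₂)⁻¹ * ∑ t ∈ range T, nsq ((Q p₁ p₂ T ω)ᵀ *ᵥ (obs R C F e p₁ p₂ t ω)ᵀ *ᵥ v) := by
  have hp : (0 : ℝ) < p₂ := by exact_mod_cast hp₂
  have h : ∀ t, v ⬝ᵥ (projObs R C F e Q p₁ p₂ T t ω * (projObs R C F e Q p₁ p₂ T t ω)ᵀ) *ᵥ v =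
      (p₂ : ℝ)⁻¹ * nsq ((Q p₁ p₂ T ω)ᵀ *ᵥ (obs R C F e p₁ p₂ t ω)ᵀ *ᵥ v) := fun t => by
    rw [← mulVec_mulVec, dot_mulVec_eq]
    have : (projObs R C F e Q p₁ p₂ T t ω)ᵀ *ᵥ v = ((p₂ : ℝ)⁻¹ * √p₂) •
        ((Q p₁ p₂ T ω)ᵀ *ᵥ (obs R C F e p₁ p₂ t ω)ᵀ *ᵥ v) := by
      simp [projObs, mulVec_mulVec, smul_smul, smul_mulVec]
    rw [this]
    change nsq _ = _
    rw [nsq_smul, mul_pow, Real.sq_sqrt hp.le]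
    congr 1
    field_simp
  rw [projCov, smul_mulVec, sum_mulVec, dotProduct_smul, smul_eq_mul, dotProduct_sum]
  simp only [h]
  rw [← Finset.mul_sum, mul_inv, mul_assoc]

end ModelMatrices

/-! ### A bound for quadratic forms of random Gram matrices -/

/-- The form is that of the Gram matrix G = m + (G - m). The symmetric matrix m is bounded by its
absolute row sums (Schur test), and G - m by its Frobenius norm. -/
lemma quad_le {ι κ : Type*} (X : Finset ι) (S : Finset κ) (y : ι → κ → ℝ) (m : ι → ι → ℝ) {ρ Φ : ℝ}
    (hm : ∀ x ∈ X, ∑ x' ∈ X, |m x x'| ≤ ρ) (hsym : ∀ x x', m x x' = m x' x)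
    (hΦ : ∑ x ∈ X, ∑ x' ∈ X, (∑ s ∈ S, y x s * y x' s - m x x') ^ 2 ≤ Φ) (v : ι → ℝ) :
    ∑ s ∈ S, (∑ x ∈ X, v x * y x s) ^ 2 ≤ (ρ + √Φ) * ∑ x ∈ X, v x ^ 2 := by
  set G : ι → ι → ℝ := fun x x' => ∑ s ∈ S, y x s * y x' s with hG
  have h1 : ∑ s ∈ S, (∑ x ∈ X, v x * y x s) ^ 2 = ∑ x ∈ X, ∑ x' ∈ X, v x * v x' * G x x' := by
    have ha : ∀ s, (∑ x ∈ X, v x * y x s) ^ 2 =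
        ∑ x ∈ X, ∑ x' ∈ X, v x * y x s * (v x' * y x' s) := fun s => by
      rw [sq, Finset.sum_mul_sum]
    simp only [ha, hG, Finset.mul_sum]
    rw [Finset.sum_comm]
    refine Finset.sum_congr rfl fun x _ => ?_
    rw [Finset.sum_comm]
    refine Finset.sum_congr rfl fun x' _ => Finset.sum_congr rfl fun s _ => by ring
  have h2 : ∑ x ∈ X, ∑ x' ∈ X, v x * v x' * m x x' ≤ ρ * ∑ x ∈ X, v x ^ 2 := by
    have ha : ∀ x x', v x * v x' * m x x' ≤ v x ^ 2 / 2 * |m x x'| + v x' ^ 2 / 2 * |m x' x| := by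
      intro x x'
      rw [hsym x' x, ← add_mul]
      calc v x * v x' * m x x' ≤ |v x * v x'| * |m x x'| := by
            rw [← abs_mul]; exact le_abs_self _
        _ ≤ _ := by
            gcongr
            rw [abs_le]
            constructor <;> nlinarith [sq_nonneg (v x - v x'), sq_nonneg (v x + v x')]
    have hb : ∑ x ∈ X, ∑ x' ∈ X, v x ^ 2 / 2 * |m x x'| ≤ ρ / 2 * ∑ x ∈ X, v x ^ 2 := by
      rw [Finset.mul_sum]
      refine Finset.sum_le_sum fun x hx => ?_
      rw [← Finset.mul_sum]
      have := mul_le_mul_of_nonneg_left (hm x hx) (by positivity : 0 ≤ v x ^ 2 / 2)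
      linarith
    calc _ ≤ ∑ x ∈ X, ∑ x' ∈ X, (v x ^ 2 / 2 * |m x x'| + v x' ^ 2 / 2 * |m x' x|) :=
          Finset.sum_le_sum fun x _ => Finset.sum_le_sum fun x' _ => ha x x'
      _ = ∑ x ∈ X, ∑ x' ∈ X, v x ^ 2 / 2 * |m x x'| +
          ∑ x ∈ X, ∑ x' ∈ X, v x ^ 2 / 2 * |m x x'| := by
          simp only [Finset.sum_add_distrib]
          congr 1
          exact Finset.sum_comm
      _ ≤ _ := by linarith
  have h3 : ∑ x ∈ X, ∑ x' ∈ X, v x * v x' * (G x x' - m x x') ≤ √Φ * ∑ x ∈ X, v x ^ 2 := by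
    simp only [← Finset.sum_product'] at hΦ ⊢
    have ha := Finset.sum_mul_sq_le_sq_mul_sq (X ×ˢ X) (fun z => v z.1 * v z.2)
      (fun z => G z.1 z.2 - m z.1 z.2)
    have hb : ∑ z ∈ X ×ˢ X, (v z.1 * v z.2) ^ 2 = (∑ x ∈ X, v x ^ 2) ^ 2 := by
      rw [Finset.sum_product, sq (∑ x ∈ X, v x ^ 2), Finset.sum_mul_sum]
      simp only [mul_pow]
    rw [hb] at ha
    have hc := Real.le_sqrt_of_sq_le (ha.trans (mul_le_mul_of_nonneg_left hΦ (sq_nonneg _)))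
    rwa [Real.sqrt_mul (sq_nonneg _), Real.sqrt_sq (Finset.sum_nonneg fun _ _ => sq_nonneg _),
      mul_comm] at hc
  rw [h1, add_mul]
  refine le_trans (le_of_eq ?_) (add_le_add h2 h3)
  rw [← Finset.sum_add_distrib]
  refine Finset.sum_congr rfl fun x _ => ?_
  rw [← Finset.sum_add_distrib]
  exact Finset.sum_congr rfl fun x' _ => by ring

/-! ### Almost sure bounds from summable expectations -/

section AlmostSure

variable {Ω : Type*} [MeasurableSpace Ω] {μ : Measure Ω}

/-- By Tonelli the sum has finite expectation, so it is almost surely finite. -/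
lemma ae_summable_of_integral_le {ι : Type*} [Countable ι] {Φ : ι → Ω → ℝ}
    (h0 : ∀ d ω, 0 ≤ Φ d ω) (hi : ∀ d, Integrable (Φ d) μ) {b : ι → ℝ}
    (hb : ∀ d, ∫ ω, Φ d ω ∂μ ≤ b d) (hs : Summable b) :
    ∀ᵐ ω ∂μ, Summable fun d => Φ d ω := by
  have h1 : ∫⁻ ω, ∑' d, ENNReal.ofReal (Φ d ω) ∂μ ≠ ⊤ := by
    rw [lintegral_tsum fun d => (hi d).aestronglyMeasurable.aemeasurable.ennreal_ofReal]
    have h2 : ∀ d, ∫⁻ ω, ENNReal.ofReal (Φ d ω) ∂μ = ENNReal.ofReal (∫ ω, Φ d ω ∂μ) := fun d =>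
      (ofReal_integral_eq_lintegral_ofReal (hi d) (ae_of_all _ (h0 d))).symm
    simp only [h2]
    refine ne_top_of_le_ne_top ?_ (ENNReal.tsum_le_tsum fun d => ENNReal.ofReal_le_ofReal (hb d))
    rw [← ENNReal.ofReal_tsum_of_nonneg
      (fun d => (integral_nonneg (h0 d)).trans (hb d)) hs]
    exact ENNReal.ofReal_ne_top
  have h3 := ae_lt_top' (AEMeasurable.tsum fun d =>
    (hi d).aestronglyMeasurable.aemeasurable.ennreal_ofReal) h1
  filter_upwards [h3] with ω hω
  have := ENNReal.summable_toReal hω.ne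
  simpa only [ENNReal.toReal_ofReal (h0 _ ω)] using this

/-- The weight `((a + 1) (m + 1) (n + 1)) ^ (1 + θ)` of a triple of dyadic exponents. -/
def wt (θ : ℝ) (d : ℕ × ℕ × ℕ) : ℝ :=
  (((d.1 : ℝ) + 1) * (((d.2.1 : ℝ) + 1) * ((d.2.2 : ℝ) + 1))) ^ (1 + θ)

lemma wt_pos (θ : ℝ) (d : ℕ × ℕ × ℕ) : 0 < wt θ d := by unfold wt; positivity

lemma one_le_wt {θ : ℝ} (hθ : 0 < θ) (d : ℕ × ℕ × ℕ) : 1 ≤ wt θ d := by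
  unfold wt
  refine Real.one_le_rpow ?_ (by linarith)
  have h1 : (1 : ℝ) ≤ (d.1 : ℝ) + 1 := by linarith [Nat.cast_nonneg (α := ℝ) d.1]
  have h2 : (1 : ℝ) ≤ (d.2.1 : ℝ) + 1 := by linarith [Nat.cast_nonneg (α := ℝ) d.2.1]
  have h3 : (1 : ℝ) ≤ (d.2.2 : ℝ) + 1 := by linarith [Nat.cast_nonneg (α := ℝ) d.2.2]
  exact one_le_mul_of_one_le_of_one_le h1 (one_le_mul_of_one_le_of_one_le h2 h3)

lemma summable_triple {f : ℕ → ℝ} (h0 : ∀ n, 0 ≤ f n) (hf : Summable f) :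
    Summable fun d : ℕ × ℕ × ℕ => f d.1 * (f d.2.1 * f d.2.2) := by
  have h1 : Summable fun d : ℕ × ℕ => f d.1 * f d.2 := hf.mul_of_nonneg hf h0 h0
  exact hf.mul_of_nonneg h1 h0 fun d => mul_nonneg (h0 _) (h0 _)

lemma summable_inv_wt {θ : ℝ} (hθ : 0 < θ) : Summable fun d => (wt θ d)⁻¹ := by
  have h1 : Summable fun n : ℕ => (((n : ℝ) + 1) ^ (1 + θ))⁻¹ := by
    have := (summable_nat_add_iff 1).2
      (Real.summable_nat_rpow_inv.2 (by linarith : 1 < 1 + θ))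
    simpa using this
  refine (summable_triple (fun n => by positivity) h1).congr fun d => ?_
  unfold wt
  rw [Real.mul_rpow (by positivity) (by positivity), Real.mul_rpow (by positivity) (by positivity),
    mul_inv, mul_inv]

/-- Divided by B and the weight, the expectations are summable. The quotients are then almost surely
summable, and their sum is a random constant that bounds all of them at once. -/
lemma ae_le_wt {θ : ℝ} (hθ : 0 < θ) {Φ : ℕ × ℕ × ℕ → Ω → ℝ} (h0 : ∀ d ω, 0 ≤ Φ d ω)
    (hi : ∀ d, Integrable (Φ d) μ) {B : ℕ × ℕ × ℕ → ℝ} (hB : ∀ d, 0 < B d) {c : ℝ}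
    (hb : ∀ d, ∫ ω, Φ d ω ∂μ ≤ c * B d) :
    ∀ᵐ ω ∂μ, ∃ K, 0 ≤ K ∧ ∀ d, Φ d ω ≤ K * (B d * wt θ d) := by
  have hpos : ∀ d, 0 < B d * wt θ d := fun d => mul_pos (hB d) (wt_pos θ d)
  have h := ae_summable_of_integral_le (μ := μ) (Φ := fun d ω => Φ d ω / (B d * wt θ d))
    (fun d ω => div_nonneg (h0 d ω) (hpos d).le) (fun d => (hi d).div_const _)
    (b := fun d => c * (wt θ d)⁻¹) (fun d => by
      rw [integral_div, div_le_iff₀ (hpos d)]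
      have := wt_pos θ d
      have h1 : c * (wt θ d)⁻¹ * (B d * wt θ d) = c * B d := by field_simp
      rw [h1]; exact hb d) ((summable_inv_wt hθ).mul_left c)
  filter_upwards [h] with ω hω
  refine ⟨∑' d, Φ d ω / (B d * wt θ d),
    tsum_nonneg fun d => div_nonneg (h0 d ω) (hpos d).le, fun d => ?_⟩
  rw [← div_le_iff₀ (hpos d)]
  exact hω.le_tsum d fun d' _ => div_nonneg (h0 d' ω) (hpos d').le

/-! ### Second moments of sums -/

lemma memLp_sum_sub [IsProbabilityMeasure μ] {κ : Type*} (S : Finset κ) {Z : κ → Ω → ℝ}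
    (hZ : ∀ s, MemLp (Z s) 2 μ)
    (a : κ → ℝ) : MemLp (fun ω => ∑ s ∈ S, a s * (Z s ω - ∫ ω', Z s ω' ∂μ)) 2 μ :=
  memLp_finsetSum _ fun s _ => ((hZ s).sub (memLp_const _)).const_mul (a s)

lemma integral_sq_sum_eq [IsProbabilityMeasure μ] {κ : Type*} (S : Finset κ) {Z : κ → Ω → ℝ}
    (hZ : ∀ s, MemLp (Z s) 2 μ)
    (a : κ → ℝ) :
    ∫ ω, (∑ s ∈ S, a s * (Z s ω - ∫ ω', Z s ω' ∂μ)) ^ 2 ∂μ =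
      ∑ s ∈ S, ∑ s' ∈ S, a s * a s' * ProbabilityTheory.covariance (Z s) (Z s') μ := by
  have hi : ∀ s, Integrable (Z s) μ := fun s => (hZ s).integrable (by norm_num)
  have h1 := ProbabilityTheory.variance_fun_sum' (s := S) (X := fun s ω => a s * Z s ω) (μ := μ)
    fun s _ => (hZ s).const_mul (a s)
  rw [ProbabilityTheory.variance_eq_integral
    (memLp_finsetSum _ fun s _ => (hZ s).const_mul (a s)).aestronglyMeasurable.aemeasurable] at h1
  rw [integral_finsetSum _ fun s _ => (hi s).const_mul (a s)] at h1
  simp only [ProbabilityTheory.covariance_const_mul_left,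
    ProbabilityTheory.covariance_const_mul_right, integral_const_mul, ← Finset.sum_sub_distrib,
    ← mul_sub] at h1
  rw [h1]
  exact Finset.sum_congr rfl fun s _ => Finset.sum_congr rfl fun s' _ => by ring

lemma integral_sq_sum_le [IsProbabilityMeasure μ] {κ : Type*} (S : Finset κ) {Z : κ → Ω → ℝ}
    (hZ : ∀ s, MemLp (Z s) 2 μ)
    {c : ℝ} (h : ∀ s ∈ S, ∑ s' ∈ S, |ProbabilityTheory.covariance (Z s) (Z s') μ| ≤ c) :
    ∫ ω, (∑ s ∈ S, Z s ω - ∑ s ∈ S, ∫ ω', Z s ω' ∂μ) ^ 2 ∂μ ≤ c * S.card := by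
  have h1 := integral_sq_sum_eq S hZ fun _ => 1
  simp only [one_mul, Finset.sum_sub_distrib] at h1
  rw [h1, mul_comm, ← nsmul_eq_mul]
  exact Finset.sum_le_card_nsmul _ _ _ fun s hs =>
    (Finset.sum_le_sum fun s' _ => le_abs_self _).trans (h s hs)

lemma integrable_sq_sum_sub [IsProbabilityMeasure μ] {κ : Type*} (S : Finset κ) {Z : κ → Ω → ℝ}
    (hZ : ∀ s, MemLp (Z s) 2 μ) :
    Integrable (fun ω => (∑ s ∈ S, Z s ω - ∑ s ∈ S, ∫ ω', Z s ω' ∂μ) ^ 2) μ := by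
  have h1 := (memLp_sum_sub (μ := μ) S hZ fun _ => 1).integrable_sq
  simpa only [one_mul, Finset.sum_sub_distrib] using h1

lemma memLp_two_mul {f g : Ω → ℝ} (hf : MemLp f 4 μ) (hg : MemLp g 4 μ) :
    MemLp (fun ω => f ω * g ω) 2 μ := by
  have : ENNReal.HolderTriple 4 4 2 := ⟨by
    rw [← two_mul, show (4 : ENNReal) = 2 * 2 by norm_num,
      ENNReal.mul_inv (by norm_num) (by norm_num), ← mul_assoc,
      ENNReal.mul_inv_cancel (by norm_num) (by norm_num), one_mul]⟩
  exact hg.mul' hf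

end AlmostSure

/-! ### Dyadic exponents -/

/-- The dyadic exponent `a` with `p < 2 ^ a ≤ 2 p`. -/
def dy (p : ℕ) : ℕ := Nat.log 2 p + 1

lemma lt_two_pow_dy (p : ℕ) : p < 2 ^ dy p := Nat.lt_pow_succ_log_self (by norm_num) p

lemma two_pow_dy_le {p : ℕ} (hp : 0 < p) : 2 ^ dy p ≤ 2 * p := by
  have := Nat.pow_log_le_self 2 hp.ne'
  rw [dy, pow_succ]; omega

lemma le_two_pow_dy_cast (p : ℕ) : (p : ℝ) ≤ 2 ^ dy p := by
  exact_mod_cast (lt_two_pow_dy p).le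

lemma two_pow_dy_le_cast {p : ℕ} (hp : 0 < p) : (2 : ℝ) ^ dy p ≤ 2 * p := by
  exact_mod_cast two_pow_dy_le hp

/-- The weight at the dyadic exponents of `(p₁, p₂, T)`. -/
def dwt (θ : ℝ) (p₁ p₂ T : ℕ) : ℝ := wt θ (dy p₁, dy p₂, dy T)

lemma one_le_dwt {θ : ℝ} (hθ : 0 < θ) (p₁ p₂ T : ℕ) : 1 ≤ dwt θ p₁ p₂ T := one_le_wt hθ _

/-! ### Quadratic forms of the error array -/

/-- A bound for the quadratic form `v ↦ ∑_{t ∈ I} ∑_{j ∈ J} (∑_{i < p} v_i x_{ijt})²`. -/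
def RowOn (x : ℕ → ℕ → ℕ → ℝ) (p : ℕ) (J I : Finset ℕ) (K : ℝ) : Prop :=
  ∀ v : ℕ → ℝ, ∑ t ∈ I, ∑ j ∈ J, (∑ i ∈ range p, v i * x i j t) ^ 2 ≤ K * ∑ i ∈ range p, v i ^ 2

/-- Pad v by zeros and add squares. This allows every size to be rounded up to a power of two, so
that only countably many well-spaced sizes need a moment bound. -/
lemma RowOn.mono {x : ℕ → ℕ → ℕ → ℝ} {p p' : ℕ} {J J' I I' : Finset ℕ} {K K' : ℝ}
    (h : RowOn x p' J' I' K) (hp : p ≤ p') (hJ : J ⊆ J') (hI : I ⊆ I') (hK : K ≤ K') :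
    RowOn x p J I K' := by
  intro v
  have h1 := h fun i => if i < p then v i else 0
  have h2 : ∀ f : ℕ → ℝ, ∑ i ∈ range p', (if i < p then f i else 0) = ∑ i ∈ range p, f i := by
    intro f
    rw [← Finset.sum_filter]
    congr 1
    ext i; simp; omega
  simp only [ite_mul, zero_mul, ite_pow, ne_eq, OfNat.ofNat_ne_zero, not_false_eq_true,
    zero_pow, h2] at h1
  calc _ ≤ ∑ t ∈ I', ∑ j ∈ J', (∑ i ∈ range p, v i * x i j t) ^ 2 := by
        refine (Finset.sum_le_sum_of_subset_of_nonneg hI fun _ _ _ =>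
          Finset.sum_nonneg fun _ _ => sq_nonneg _).trans' ?_
        exact Finset.sum_le_sum fun t _ =>
          Finset.sum_le_sum_of_subset_of_nonneg hJ fun _ _ _ => sq_nonneg _
    _ ≤ _ := h1
    _ ≤ _ := mul_le_mul_of_nonneg_right hK (Finset.sum_nonneg fun _ _ => sq_nonneg _)

section

variable {Ω : Type*} {e : ℕ → ℕ → ℕ → Ω → ℝ} {p₁ p₂ T : ℕ} {ω : Ω} {K : ℝ}

lemma nsq_errMat_transpose_mulVec (t : ℕ) (v : ℕ → ℝ) :
    nsq ((errMat e p₁ p₂ t ω)ᵀ *ᵥ fun i => v i) =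
      ∑ j ∈ range p₂, (∑ i ∈ range p₁, v i * e i j t ω) ^ 2 := by
  rw [nsq_eq_sum, ← Fin.sum_univ_eq_sum_range (fun j => (∑ i ∈ range p₁, v i * e i j t ω) ^ 2)]
  refine Finset.sum_congr rfl fun j _ => ?_
  rw [← Fin.sum_univ_eq_sum_range (fun i => v i * e i j t ω)]
  simp [mulVec, dotProduct, errMat, mul_comm]

lemma exists_extension {n : ℕ} (v : Fin n → ℝ) : ∃ v' : ℕ → ℝ, v = fun i : Fin n => v' i :=
  ⟨fun i => if h : i < n then v ⟨i, h⟩ else 0, by ext i; simp⟩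

lemma nsq_eq_sum_range {n : ℕ} (v : ℕ → ℝ) :
    nsq (fun i : Fin n => v i) = ∑ i ∈ range n, v i ^ 2 := by
  rw [nsq_eq_sum, ← Fin.sum_univ_eq_sum_range fun i => v i ^ 2]

lemma rowBd_iff : RowBd (fun t => errMat e p₁ p₂ t ω) T K ↔
    RowOn (fun i j t => e i j t ω) p₁ (range p₂) (range T) K := by
  constructor
  · intro h v
    have := h fun i => v i
    simpa only [nsq_errMat_transpose_mulVec, nsq_eq_sum_range] using this
  · intro h v
    obtain ⟨v, rfl⟩ := exists_extension v
    simpa only [nsq_errMat_transpose_mulVec, nsq_eq_sum_range] using h v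

lemma colBd_iff : ColBd (fun t => errMat e p₁ p₂ t ω) T K ↔
    RowOn (fun j i t => e i j t ω) p₂ (range p₁) (range T) K :=
  rowBd_iff (e := fun j i t ω => e i j t ω)

end

/-! ### Frobenius fluctuations of the row Gram matrices. -/

section FrobeniusFluctuation

variable {Ω : Type*} [MeasurableSpace Ω] {μ : Measure Ω} {e : ℕ → ℕ → ℕ → Ω → ℝ} {c : ℝ}

/-- The consequences of the error assumptions that are symmetric in rows and columns. -/
structure WeakDep (μ : Measure Ω) (e : ℕ → ℕ → ℕ → Ω → ℝ) (c : ℝ) : Prop where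
  memLp : ∀ i j t, MemLp (e i j t) 4 μ
  row : ∀ n i j t, ∑ l ∈ range n, |∫ ω, e i j t ω * e l j t ω ∂μ| ≤ c
  col : ∀ n i j t, ∑ h ∈ range n, |∫ ω, e i j t ω * e i h t ω ∂μ| ≤ c
  covRow : ∀ (I J : Finset ℕ) (i l j t : ℕ), ∑ s ∈ I ×ˢ J,
    |ProbabilityTheory.covariance (fun ω => e i j t ω * e l j t ω)
      (fun ω => e i s.2 s.1 ω * e l s.2 s.1 ω) μ| ≤ c
  covCol : ∀ (I J : Finset ℕ) (i j h t : ℕ), ∑ s ∈ I ×ˢ J,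
    |ProbabilityTheory.covariance (fun ω => e i j t ω * e i h t ω)
      (fun ω => e s.2 j s.1 ω * e s.2 h s.1 ω) μ| ≤ c

/-- Transposing every E_t exchanges the conditions, so results on Σ E_t E_t' also give those on Σ
E_t' E_t and on single rows or time points. -/
lemma WeakDep.swap (h : WeakDep μ e c) : WeakDep μ (fun i j t => e j i t) c :=
  ⟨fun i j t => h.memLp j i t, fun n i j t => h.col n j i t, fun n i j t => h.row n j i t,
    fun I J i l j t => h.covCol I J j i l t, fun I J i j h' t => h.covRow I J j h' i t⟩

lemma WeakDep.nonneg (h : WeakDep μ e c) : 0 ≤ c := by simpa using h.row 0 0 0 0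

lemma ErrorAssumption.memLp_four [IsProbabilityMeasure μ] (he : ErrorAssumption μ e) (i j t : ℕ) :
    MemLp (e i j t) 4 μ := by
  obtain ⟨c₀, hc⟩ := he.moment
  have h8 : MemLp (e i j t) 8 μ := by
    rw [← integrable_norm_rpow_iff (he.measurable i j t).aestronglyMeasurable
      (by norm_num) (by norm_num)]
    refine (hc i j t).1.congr (ae_of_all _ fun ω => ?_)
    simp only [ENNReal.toReal_ofNat, Real.norm_eq_abs]
    rw [show (8 : ℝ) = ((8 : ℕ) : ℝ) by norm_num, Real.rpow_natCast]
    exact (Even.pow_abs (by decide) _).symm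
  exact h8.mono_exponent (by norm_num)

lemma exists_range_superset (I J : Finset ℕ) (a : ℕ) :
    ∃ N, a < N ∧ I ⊆ range N ∧ J ⊆ range N := by
  refine ⟨I.sup id + J.sup id + a + 1, by omega, fun x hx => ?_, fun x hx => ?_⟩
  · have := Finset.le_sup (f := id) hx
    simp at this ⊢; omega
  · have := Finset.le_sup (f := id) hx
    simp at this ⊢; omega

/-- Each sum is part of a sum of absolute values in the assumptions, once all ranges are enlarged to
a common cube. From the covariance sums only the terms with l₂ = l, respectively h₂ = h, are kept.
-/
lemma ErrorAssumption.exists_weakDep [IsProbabilityMeasure μ] (he : ErrorAssumption μ e) :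
    ∃ c, WeakDep μ e c := by
  obtain ⟨c₁, h₁⟩ := he.corr_a
  obtain ⟨c₂, h₂⟩ := he.cov_a₁
  obtain ⟨c₃, h₃⟩ := he.cov_a₂
  have hrc : ∀ n i j t, ∑ l ∈ range n, ∑ h ∈ range n, |∫ ω, e i j t ω * e l h t ω ∂μ| ≤ c₁ := by
    intro n i j t
    obtain ⟨N, hN, hs, -⟩ := exists_range_superset (range n) ∅ (i + j + t)
    refine le_trans ?_ (h₁ N N N i j t (by omega) (by omega) (by omega))
    refine le_trans ?_ (Finset.single_le_sum (f := fun s => ∑ l ∈ range N, ∑ h ∈ range N,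
      |∫ ω, e i j t ω * e l h s ω ∂μ|) (fun _ _ => by positivity)
      (mem_range.2 (by omega : t < N)))
    refine (Finset.sum_le_sum_of_subset_of_nonneg hs fun _ _ _ => by positivity).trans' ?_
    exact Finset.sum_le_sum fun l _ =>
      Finset.sum_le_sum_of_subset_of_nonneg hs fun _ _ _ => by positivity
  refine ⟨max c₁ (max c₂ c₃), he.memLp_four, ?_, ?_, ?_, ?_⟩
  · intro n i j t
    refine le_trans ?_ ((hrc (n + j + 1) i j t).trans (le_max_left _ _))
    refine (Finset.sum_le_sum_of_subset_of_nonneg (t := range (n + j + 1)) (by simp; omega)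
      fun _ _ _ => by positivity).trans ?_
    exact Finset.sum_le_sum fun l _ => Finset.single_le_sum
      (f := fun h => |∫ ω, e i j t ω * e l h t ω ∂μ|) (fun _ _ => by positivity)
      (mem_range.2 (by omega))
  · intro n i j t
    refine le_trans ?_ ((hrc (n + i + 1) i j t).trans (le_max_left _ _))
    refine (Finset.sum_le_sum_of_subset_of_nonneg (t := range (n + i + 1)) (by simp; omega)
      fun _ _ _ => by positivity).trans ?_
    exact Finset.single_le_sum
      (f := fun l => ∑ h ∈ range (n + i + 1), |∫ ω, e i j t ω * e l h t ω ∂μ|)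
      (fun _ _ => by positivity) (mem_range.2 (by omega))
  · intro I J i l j t
    obtain ⟨N, hN, hI, hJ⟩ := exists_range_superset I J (i + l + j + t)
    refine le_trans ?_ (((h₂ N N N i l j t (by omega) (by omega) (by omega) (by omega)).trans
      (le_max_left _ _)).trans (le_max_right _ _))
    rw [Finset.sum_product]
    refine (Finset.sum_le_sum_of_subset_of_nonneg hI fun _ _ _ => by positivity).trans' ?_
    refine Finset.sum_le_sum fun s _ => ?_
    refine (Finset.sum_le_sum_of_subset_of_nonneg hJ fun _ _ _ => by positivity).trans ?_
    exact Finset.single_le_sum (f := fun l₂ => ∑ h ∈ range N,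
      |ProbabilityTheory.covariance (fun ω => e i j t ω * e l j t ω)
        (fun ω => e i h s ω * e l₂ h s ω) μ|) (fun _ _ => by positivity)
      (mem_range.2 (by omega : l < N))
  · intro I J i j h t
    obtain ⟨N, hN, hI, hJ⟩ := exists_range_superset I J (i + h + j + t)
    refine le_trans ?_ (((h₃ N N N i j h t (by omega) (by omega) (by omega) (by omega)).trans
      (le_max_right _ _)).trans (le_max_right _ _))
    rw [Finset.sum_product]
    refine (Finset.sum_le_sum_of_subset_of_nonneg hI fun _ _ _ => by positivity).trans' ?_
    refine Finset.sum_le_sum fun s _ => ?_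
    refine (Finset.sum_le_sum_of_subset_of_nonneg hJ fun _ _ _ => by positivity).trans ?_
    exact Finset.sum_le_sum fun l _ => Finset.single_le_sum (f := fun h₂ =>
      |ProbabilityTheory.covariance (fun ω => e i j t ω * e i h t ω)
        (fun ω => e l j s ω * e l h₂ s ω) μ|) (fun _ _ => by positivity)
      (mem_range.2 (by omega : h < N))

/-- The squared Frobenius norm of the centred Gram matrix of the rows. -/
def rowFl (μ : Measure Ω) (e : ℕ → ℕ → ℕ → Ω → ℝ) (p : ℕ) (J I : Finset ℕ) (ω : Ω) : ℝ :=
  ∑ i ∈ range p, ∑ l ∈ range p, (∑ s ∈ I ×ˢ J, e i s.2 s.1 ω * e l s.2 s.1 ω -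
    ∑ s ∈ I ×ˢ J, ∫ ω', e i s.2 s.1 ω' * e l s.2 s.1 ω' ∂μ) ^ 2

lemma rowFl_nonneg (p : ℕ) (J I : Finset ℕ) (ω : Ω) : 0 ≤ rowFl μ e p J I ω := by
  unfold rowFl; positivity

lemma WeakDep.memLp_mul (h : WeakDep μ e c) (i j t i' j' t' : ℕ) :
    MemLp (fun ω => e i j t ω * e i' j' t' ω) 2 μ :=
  memLp_two_mul (h.memLp i j t) (h.memLp i' j' t')

variable [IsProbabilityMeasure μ]

lemma WeakDep.integrable_rowFl (h : WeakDep μ e c) (p : ℕ) (J I : Finset ℕ) :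
    Integrable (rowFl μ e p J I) μ :=
  integrable_finsetSum _ fun i _ => integrable_finsetSum _ fun l _ =>
    integrable_sq_sum_sub (I ×ˢ J) (Z := fun s ω => e i s.2 s.1 ω * e l s.2 s.1 ω)
      fun _ => h.memLp_mul _ _ _ _ _ _

/-- There are p² entries, and each is a centred sum of |I| |J| products whose covariances are
summable, hence of variance at most c |I| |J|. -/
lemma WeakDep.integral_rowFl_le (h : WeakDep μ e c) (p : ℕ) (J I : Finset ℕ) :
    ∫ ω, rowFl μ e p J I ω ∂μ ≤ c * ((p : ℝ) ^ 2 * (J.card * I.card)) := by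
  have hZ : ∀ i l, ∀ s : ℕ × ℕ, MemLp (fun ω => e i s.2 s.1 ω * e l s.2 s.1 ω) 2 μ :=
    fun i l s => h.memLp_mul _ _ _ _ _ _
  unfold rowFl
  rw [integral_finsetSum _ fun i _ => integrable_finsetSum _ fun l _ =>
    integrable_sq_sum_sub (I ×ˢ J) (hZ i l)]
  have h1 : ∀ i ∈ range p, ∫ ω, ∑ l ∈ range p, (∑ s ∈ I ×ˢ J, e i s.2 s.1 ω * e l s.2 s.1 ω -
      ∑ s ∈ I ×ˢ J, ∫ ω', e i s.2 s.1 ω' * e l s.2 s.1 ω' ∂μ) ^ 2 ∂μ ≤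
      p * (c * (I ×ˢ J).card) := fun i _ => by
    rw [integral_finsetSum _ fun l _ => integrable_sq_sum_sub (I ×ˢ J) (hZ i l)]
    refine (Finset.sum_le_card_nsmul _ _ (c * (I ×ˢ J).card) fun l _ => ?_).trans ?_
    · exact integral_sq_sum_le (I ×ˢ J) (hZ i l) fun s _ => h.covRow I J i l s.2 s.1
    · simp
  refine (Finset.sum_le_card_nsmul _ _ _ h1).trans (le_of_eq ?_)
  simp only [card_range, card_product, nsmul_eq_mul, Nat.cast_mul]
  ring

omit [IsProbabilityMeasure μ] in
-- Apply `quad_le` with m the mean of the Gram matrix: each of the |I| |J| pairs contributes at most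
-- c to an absolute row sum.
lemma WeakDep.rowOn (h : WeakDep μ e c) (p : ℕ) (J I : Finset ℕ) (ω : Ω) :
    RowOn (fun i j t => e i j t ω) p J I (c * (I.card * J.card) + √(rowFl μ e p J I ω)) := by
  intro v
  have := quad_le (range p) (I ×ˢ J) (fun i s => e i s.2 s.1 ω)
    (fun i l => ∑ s ∈ I ×ˢ J, ∫ ω', e i s.2 s.1 ω' * e l s.2 s.1 ω' ∂μ)
    (ρ := c * (I.card * J.card)) (Φ := rowFl μ e p J I ω) (fun i _ => ?_)
    (fun i l => by simp only [mul_comm]) le_rfl v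
  · rwa [Finset.sum_product] at this
  · calc _ ≤ ∑ l ∈ range p, ∑ s ∈ I ×ˢ J, |∫ ω', e i s.2 s.1 ω' * e l s.2 s.1 ω' ∂μ| :=
          Finset.sum_le_sum fun l _ => Finset.abs_sum_le_sum_abs _ _
      _ = ∑ s ∈ I ×ˢ J, ∑ l ∈ range p, |∫ ω', e i s.2 s.1 ω' * e l s.2 s.1 ω' ∂μ| :=
          Finset.sum_comm
      _ ≤ _ := by
          refine (Finset.sum_le_card_nsmul _ _ c fun _ _ => h.row p i _ _).trans (le_of_eq ?_)
          simp [mul_comm]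

/-- The spectral norm of `∑_t E_t E_t'`, at every size. -/
lemma WeakDep.ae_rowOn (h : WeakDep μ e c) {θ : ℝ} (hθ : 0 < θ) :
    ∀ᵐ ω ∂μ, ∃ K, 0 ≤ K ∧ ∀ p₁ p₂ T : ℕ, 0 < p₁ → 0 < p₂ → 0 < T →
      RowOn (fun i j t => e i j t ω) p₁ (range p₂) (range T)
        (K * (T * p₂ + p₁ * √(T * p₂) * √(dwt θ p₁ p₂ T))) := by
  have h1 := ae_le_wt (μ := μ) hθ
    (Φ := fun d => rowFl μ e (2 ^ d.1) (range (2 ^ d.2.1)) (range (2 ^ d.2.2)))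
    (fun d ω => rowFl_nonneg _ _ _ _) (fun d => h.integrable_rowFl _ _ _)
    (B := fun d => ((2 : ℝ) ^ d.1) ^ 2 * (2 ^ d.2.1 * 2 ^ d.2.2)) (fun d => by positivity)
    (c := c) (fun d => by
      simpa using h.integral_rowFl_le (2 ^ d.1) (range (2 ^ d.2.1)) (range (2 ^ d.2.2)))
  filter_upwards [h1] with ω ⟨K, hK, hω⟩
  have hc := h.nonneg
  -- Rounding up at most doubles each size, so T p₂ gains a factor 4, and so does the square root of
  -- p₁² p₂ T.
  refine ⟨4 * (c + √K), by positivity, fun p₁ p₂ T hp₁ hp₂ hT => ?_⟩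
  refine (h.rowOn (2 ^ dy p₁) (range (2 ^ dy p₂)) (range (2 ^ dy T)) ω).mono
    (lt_two_pow_dy _).le (range_subset_range.2 (lt_two_pow_dy _).le)
    (range_subset_range.2 (lt_two_pow_dy _).le) ?_
  have h2 := hω (dy p₁, dy p₂, dy T)
  simp only at h2
  simp only [card_range, Nat.cast_pow, Nat.cast_ofNat]
  have hW : 0 ≤ dwt θ p₁ p₂ T := (wt_pos _ _).le
  have h3 : √(rowFl μ e (2 ^ dy p₁) (range (2 ^ dy p₂)) (range (2 ^ dy T)) ω) ≤
      4 * √K * (p₁ * √(T * p₂) * √(dwt θ p₁ p₂ T)) := by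
    refine Real.sqrt_le_iff.2 ⟨by positivity, h2.trans ?_⟩
    have e1 : (4 * √K * (p₁ * √(T * p₂) * √(dwt θ p₁ p₂ T))) ^ 2 =
        K * (((2 * p₁ : ℝ)) ^ 2 * ((2 * p₂) * (2 * T)) * dwt θ p₁ p₂ T) := by
      simp only [mul_pow]
      rw [Real.sq_sqrt hK, Real.sq_sqrt hW, Real.sq_sqrt (by positivity)]
      ring
    rw [e1]
    have := two_pow_dy_le_cast hp₁
    have := two_pow_dy_le_cast hp₂
    have := two_pow_dy_le_cast hT
    change K * (_ * dwt θ p₁ p₂ T) ≤ _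
    gcongr
  have h4 : c * ((2 : ℝ) ^ dy T * 2 ^ dy p₂) ≤ c * ((2 * T) * (2 * p₂)) := by
    have := two_pow_dy_le_cast hp₂
    have := two_pow_dy_le_cast hT
    gcongr
  have h5 : 0 ≤ p₁ * √((T : ℝ) * p₂) * √(dwt θ p₁ p₂ T) := by positivity
  have h6 : 0 ≤ √K * (T * p₂) := by positivity
  nlinarith [mul_nonneg hc h5]

end FrobeniusFluctuation

/-! ### The noise is negligible against T p₁ p₂, whatever the relative rates. -/

section Vanishing

variable {Ω : Type*} [MeasurableSpace Ω] {μ : Measure Ω} {e : ℕ → ℕ → ℕ → Ω → ℝ} {c : ℝ}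

lemma rowBd_of_colBd_single {m n : ℕ} {E : ℕ → Matrix (Fin m) (Fin n) ℝ} {T : ℕ} {K : ℕ → ℝ}
    (hK : ∀ t, 0 ≤ K t) (h : ∀ t w, nsq (E t *ᵥ w) ≤ K t * nsq w) :
    RowBd E T (∑ t ∈ range T, K t) := fun v => by
  rw [Finset.sum_mul]
  exact Finset.sum_le_sum fun t _ => nsq_transpose_mulVec_le (hK t) (h t) v

/-- For p large against n T it is better to bound each E_t alone through its n × n Gram matrix E_t'
E_t and add the T bounds: the fluctuation then scales with n instead of p. -/
lemma WeakDep.rowOn_slices (h : WeakDep μ e c) (p n T : ℕ) (ω : Ω) :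
    RowOn (fun i j t => e i j t ω) p (range n) (range T)
      (c * (T * p) + √(T * ∑ t ∈ range T, rowFl μ (fun i j t => e j i t) n (range p) {t} ω)) := by
  have hc := h.nonneg
  set f : ℕ → ℝ := fun t => rowFl μ (fun i j t => e j i t) n (range p) {t} ω with hf
  have hf0 : ∀ t, 0 ≤ f t := fun t => rowFl_nonneg _ _ _ _
  have h1 : ∀ t (w : Fin n → ℝ), nsq (errMat e p n t ω *ᵥ w) ≤ (c * p + √(f t)) * nsq w := by
    intro t w
    obtain ⟨w, rfl⟩ := exists_extension w
    have := h.swap.rowOn n (range p) {t} ω w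
    rw [Finset.sum_singleton] at this
    rw [nsq_eq_sum_range]
    have h2 := nsq_errMat_transpose_mulVec (e := fun i j t => e j i t) (p₁ := n) (p₂ := p)
      (ω := ω) t w
    have h3 : (errMat (fun i j t => e j i t) n p t ω)ᵀ = errMat e p n t ω := rfl
    rw [h3] at h2
    rw [h2]
    simpa using this
  have h2 := rowBd_of_colBd_single (T := T) (fun t => by positivity) h1
  rw [rowBd_iff] at h2
  refine h2.mono le_rfl subset_rfl subset_rfl ?_
  rw [Finset.sum_add_distrib]
  refine add_le_add (by simp; linarith) (Real.le_sqrt_of_sq_le ?_)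
  have := Finset.sum_mul_sq_le_sq_mul_sq (range T) (fun _ => 1) fun t => √(f t)
  simpa [Real.sq_sqrt (hf0 _)] using this

lemma tendsto_dy : Tendsto dy atTop atTop :=
  tendsto_atTop.2 fun b => by
    filter_upwards [eventually_ge_atTop (2 ^ b)] with n hn
    exact ((Nat.pow_lt_pow_iff_right (by norm_num)).1 (hn.trans_lt (lt_two_pow_dy n))).le

lemma tendsto_fst_triple : Tendsto (fun p : ℕ × ℕ × ℕ => p.1) atTop atTop := by
  rw [← prod_atTop_atTop_eq]; exact tendsto_fst

lemma tendsto_snd_triple : Tendsto (fun p : ℕ × ℕ × ℕ => p.2.1) atTop atTop := by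
  rw [← prod_atTop_atTop_eq, ← prod_atTop_atTop_eq]; exact tendsto_fst.comp tendsto_snd

lemma tendsto_thd_triple : Tendsto (fun p : ℕ × ℕ × ℕ => p.2.2) atTop atTop := by
  rw [← prod_atTop_atTop_eq, ← prod_atTop_atTop_eq]; exact tendsto_snd.comp tendsto_snd

lemma tendsto_dy_triple :
    Tendsto (fun p : ℕ × ℕ × ℕ => (dy p.1, dy p.2.1, dy p.2.2)) atTop cofinite := by
  refine Tendsto.mono_right ?_ atTop_le_cofinite
  rw [← prod_atTop_atTop_eq (α := ℕ) (β := ℕ × ℕ), ← prod_atTop_atTop_eq (α := ℕ) (β := ℕ)]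
  refine Tendsto.prodMk (tendsto_dy.comp tendsto_fst) (Tendsto.prodMk ?_ ?_)
  · exact tendsto_dy.comp (tendsto_fst.comp tendsto_snd)
  · exact tendsto_dy.comp (tendsto_snd.comp tendsto_snd)

variable [IsProbabilityMeasure μ]

/-- `WeakDep.ae_rowOn` does not suffice: divided by T p₁ p₂ it leaves √(`dwt` / (T p₂)), where the
weight contains ln p₁, and this need not vanish when p₁ is huge. Choosing the better of the joint
and the slicewise bound makes the normalised moments summable over all dyadic triples without any
weight. -/
lemma WeakDep.ae_eventually_rowOn (h : WeakDep μ e c) :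
    ∀ᵐ ω ∂μ, ∀ x > 0, ∀ᶠ p : ℕ × ℕ × ℕ in atTop,
      RowOn (fun i j t => e i j t ω) p.1 (range p.2.1) (range p.2.2)
        (x * (p.2.2 * p.1 * p.2.1)) := by
  have hc := h.nonneg
  -- With P, M, N the three powers of two, the joint bound has normalised moment of order 1 / (M N)
  -- and the slicewise one 1 / P; the case distinction picks the smaller.
  set Y : ℕ × ℕ × ℕ → Ω → ℝ := fun d ω =>
    (if d.1 ≤ d.2.1 + d.2.2 then
      rowFl μ e (2 ^ d.1) (range (2 ^ d.2.1)) (range (2 ^ d.2.2)) ω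
    else 2 ^ d.2.2 * ∑ t ∈ range (2 ^ d.2.2),
      rowFl μ (fun i j t => e j i t) (2 ^ d.2.1) (range (2 ^ d.1)) {t} ω) /
    (2 ^ d.1 * 2 ^ d.2.1 * 2 ^ d.2.2) ^ 2 with hY
  set r : ℝ := √(1 / 2) with hr
  have hr2 : r ^ 2 = 1 / 2 := Real.sq_sqrt (by norm_num)
  have hr0 : 0 < r := Real.sqrt_pos.2 (by norm_num)
  have hr1 : r < 1 := by nlinarith
  -- The smaller of 1 / (M N) and 1 / P is at most (P M N)^(-1/2), a product of three geometric
  -- terms with ratio r.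
  have hrp : ∀ a b : ℕ, b ≤ a → ((2 : ℝ) ^ a)⁻¹ ≤ r ^ (a + b) := fun a b hab => by
    have : ((2 : ℝ) ^ a)⁻¹ = r ^ (2 * a) := by rw [pow_mul, hr2]; simp
    rw [this]
    exact pow_le_pow_of_le_one hr0.le hr1.le (by omega)
  have hY0 : ∀ d ω, 0 ≤ Y d ω := fun d ω => by
    simp only [hY]
    split_ifs
    · have := rowFl_nonneg (μ := μ) (e := e) (2 ^ d.1) (range (2 ^ d.2.1)) (range (2 ^ d.2.2)) ω
      positivity
    · have := fun t => rowFl_nonneg (μ := μ) (e := fun i j t => e j i t) (2 ^ d.2.1)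
        (range (2 ^ d.1)) {t} ω
      have := Finset.sum_nonneg fun t (_ : t ∈ range (2 ^ d.2.2)) => this t
      positivity
  have hsum := ae_summable_of_integral_le (μ := μ) (Φ := Y) hY0 (fun d => by
      simp only [hY]
      split_ifs
      · exact (h.integrable_rowFl _ _ _).div_const _
      · exact ((integrable_finsetSum _ fun t _ =>
          h.swap.integrable_rowFl _ _ _).const_mul _).div_const _)
    (b := fun d => c * (r ^ d.1 * (r ^ d.2.1 * r ^ d.2.2))) (fun d => by
      have hP : (0 : ℝ) < 2 ^ d.1 := by positivity
      have hM : (0 : ℝ) < 2 ^ d.2.1 := by positivity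
      have hN : (0 : ℝ) < 2 ^ d.2.2 := by positivity
      rw [← pow_add, ← pow_add]
      simp only [hY]
      split_ifs with hd
      · rw [integral_div, div_le_iff₀ (by positivity)]
        have h1 := h.integral_rowFl_le (2 ^ d.1) (range (2 ^ d.2.1)) (range (2 ^ d.2.2))
        simp only [card_range, Nat.cast_pow, Nat.cast_ofNat] at h1
        have h2 := hrp (d.2.1 + d.2.2) d.1 hd
        rw [add_comm (d.2.1 + d.2.2), pow_add 2] at h2
        refine h1.trans ?_
        have h3 : c * ((2 ^ d.1) ^ 2 * (2 ^ d.2.1 * 2 ^ d.2.2)) =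
            c * (2 ^ d.2.1 * 2 ^ d.2.2)⁻¹ * (2 ^ d.1 * 2 ^ d.2.1 * 2 ^ d.2.2) ^ 2 := by
          field_simp
        rw [h3]
        gcongr
      · rw [integral_div, div_le_iff₀ (by positivity), integral_const_mul,
          integral_finsetSum _ fun t _ => h.swap.integrable_rowFl _ _ _]
        have h1 : ∑ t ∈ range (2 ^ d.2.2), ∫ ω, rowFl μ (fun i j t => e j i t) (2 ^ d.2.1)
            (range (2 ^ d.1)) {t} ω ∂μ ≤ 2 ^ d.2.2 * (c * ((2 ^ d.2.1) ^ 2 * 2 ^ d.1)) := by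
          refine (Finset.sum_le_card_nsmul _ _ (c * ((2 ^ d.2.1) ^ 2 * 2 ^ d.1))
            fun t _ => ?_).trans (le_of_eq (by simp))
          simpa using h.swap.integral_rowFl_le (2 ^ d.2.1) (range (2 ^ d.1)) {t}
        have h2 := hrp d.1 (d.2.1 + d.2.2) (by omega)
        refine (mul_le_mul_of_nonneg_left h1 hN.le).trans ?_
        have h3 : (2 : ℝ) ^ d.2.2 * (2 ^ d.2.2 * (c * ((2 ^ d.2.1) ^ 2 * 2 ^ d.1))) =
            c * (2 ^ d.1)⁻¹ * (2 ^ d.1 * 2 ^ d.2.1 * 2 ^ d.2.2) ^ 2 := by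
          field_simp
        rw [h3]
        gcongr)
    ((summable_triple (fun n => by positivity)
      (summable_geometric_of_lt_one hr0.le hr1)).mul_left c)
  filter_upwards [hsum] with ω hω x hx
  have ht : Tendsto (fun p : ℕ × ℕ × ℕ => Y (dy p.1, dy p.2.1, dy p.2.2) ω) atTop (𝓝 0) :=
    hω.tendsto_cofinite_zero.comp tendsto_dy_triple
  have h1 : Tendsto (fun p : ℕ × ℕ × ℕ => (p.1 : ℝ)) atTop atTop :=
    tendsto_natCast_atTop_atTop.comp tendsto_fst_triple
  have h2 : Tendsto (fun p : ℕ × ℕ × ℕ => (p.2.1 : ℝ)) atTop atTop :=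
    tendsto_natCast_atTop_atTop.comp tendsto_snd_triple
  have h3 : Tendsto (fun p : ℕ × ℕ × ℕ => c / p.1 + c / p.2.1 +
      √(Y (dy p.1, dy p.2.1, dy p.2.2) ω)) atTop (𝓝 (0 + 0 + √0)) :=
    ((h1.const_div_atTop c).add (h2.const_div_atTop c)).add
      ((Real.continuous_sqrt.tendsto 0).comp ht)
  rw [Real.sqrt_zero, add_zero, add_zero] at h3
  filter_upwards [h3.eventually_lt_const (show 0 < x / 8 by positivity),
    h1.eventually_gt_atTop 0, h2.eventually_gt_atTop 0,
    (tendsto_natCast_atTop_atTop.comp tendsto_thd_triple).eventually_gt_atTop (0 : ℝ)]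
    with p hp hp1 hp2 hp3
  obtain ⟨p₁, p₂, T⟩ := p
  simp only [Function.comp_apply, Nat.cast_pos] at hp hp1 hp2 hp3 ⊢
  have hb1 := two_pow_dy_le_cast hp1
  have hb2 := two_pow_dy_le_cast hp2
  have hb3 := two_pow_dy_le_cast hp3
  have hc1 := le_two_pow_dy_cast p₁
  have hc2 := le_two_pow_dy_cast p₂
  have hpc1 : (0 : ℝ) < p₁ := by exact_mod_cast hp1
  have hpc2 : (0 : ℝ) < p₂ := by exact_mod_cast hp2
  set P : ℝ := 2 ^ dy p₁ with hP
  set M : ℝ := 2 ^ dy p₂ with hM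
  set N : ℝ := 2 ^ dy T with hN
  have hP0 : 0 < P := by positivity
  have hM0 : 0 < M := by positivity
  have hN0 : 0 < N := by positivity
  set y := Y (dy p₁, dy p₂, dy T) ω with hy
  have hy0 : 0 ≤ y := hY0 _ _
  have key : RowOn (fun i j t => e i j t ω) (2 ^ dy p₁) (range (2 ^ dy p₂)) (range (2 ^ dy T))
      (P * M * N * (c / P + c / M + √y)) := by
    by_cases hd : dy p₁ ≤ dy p₂ + dy T
    · refine (h.rowOn (2 ^ dy p₁) (range (2 ^ dy p₂)) (range (2 ^ dy T)) ω).mono le_rfl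
        subset_rfl subset_rfl ?_
      have e1 : rowFl μ e (2 ^ dy p₁) (range (2 ^ dy p₂)) (range (2 ^ dy T)) ω =
          (P * M * N) ^ 2 * y := by
        simp only [hy, hY, if_pos hd, hP, hM, hN]
        field_simp
      rw [e1, Real.sqrt_mul (by positivity), Real.sqrt_sq (by positivity)]
      simp only [card_range, Nat.cast_pow, Nat.cast_ofNat]
      have e2 : P * M * N * (c / P + c / M + √y) =
          c * (N * M) + P * M * N * √y + P * N * c := by field_simp; ring
      rw [e2]
      have : 0 ≤ P * N * c := by positivity
      linarith
    · refine (h.rowOn_slices (2 ^ dy p₁) (2 ^ dy p₂) (2 ^ dy T) ω).mono le_rfl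
        subset_rfl subset_rfl ?_
      simp only [Nat.cast_pow, Nat.cast_ofNat]
      have e1 : 2 ^ dy T * ∑ t ∈ range (2 ^ dy T),
          rowFl μ (fun i j t => e j i t) (2 ^ dy p₂) (range (2 ^ dy p₁)) {t} ω =
          (P * M * N) ^ 2 * y := by
        simp only [hy, hY, if_neg hd, hP, hM, hN]
        field_simp
      rw [e1, Real.sqrt_mul (by positivity), Real.sqrt_sq (by positivity)]
      have e2 : P * M * N * (c / P + c / M + √y) =
          c * (N * P) + P * M * N * √y + M * N * c := by field_simp; ring
      rw [e2]
      have : 0 ≤ M * N * c := by positivity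
      linarith
  refine key.mono (lt_two_pow_dy _).le (range_subset_range.2 (lt_two_pow_dy _).le)
    (range_subset_range.2 (lt_two_pow_dy _).le) ?_
  calc P * M * N * (c / P + c / M + √y) ≤ (2 * p₁) * (2 * p₂) * (2 * T) *
        (c / p₁ + c / p₂ + √y) := by gcongr
    _ ≤ (2 * p₁) * (2 * p₂) * (2 * T) * (x / 8) := by gcongr
    _ = _ := by ring

end Vanishing

/-! ### Quadratic forms of the error array projected on the loadings -/

/-- Clearing the last k binary digits of n leaves 2^k (n / 2^k). Consecutive truncations enclose one
block per digit, and these blocks tile the range. -/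
lemma sum_range_eq_sum_dyadic {M : Type*} [AddCommMonoid M] (f : ℕ → M) {m n : ℕ} (h : n < 2 ^ m) :
    ∑ j ∈ range n, f j =
      ∑ k ∈ range m, ∑ j ∈ Ico (2 ^ (k + 1) * (n / 2 ^ (k + 1))) (2 ^ k * (n / 2 ^ k)), f j := by
  have h1 : ∀ m, ∑ k ∈ range m,
      ∑ j ∈ Ico (2 ^ (k + 1) * (n / 2 ^ (k + 1))) (2 ^ k * (n / 2 ^ k)), f j =
      ∑ j ∈ Ico (2 ^ m * (n / 2 ^ m)) n, f j := by
    intro m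
    induction m with
    | zero => simp
    | succ m ih =>
      rw [Finset.sum_range_succ, ih, add_comm]
      refine Finset.sum_Ico_consecutive _ ?_ (Nat.mul_div_le _ _)
      rw [pow_succ, ← Nat.div_div_eq_div_mul, mul_assoc]
      exact Nat.mul_le_mul_left _ (Nat.mul_div_le _ _)
  rw [h1, Nat.div_eq_of_lt h, mul_zero, Finset.range_eq_Ico]

/-- If the k-th binary digit of n is 0 the two truncations agree, otherwise they differ by 2^k.
Indexing a block by its right end q 2^k leaves fewer than 2^(m - k) candidates at level k for all n
< 2^m together. -/
lemma dyadic_Ico_eq (n k : ℕ) :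
    Ico (2 ^ (k + 1) * (n / 2 ^ (k + 1))) (2 ^ k * (n / 2 ^ k)) = ∅ ∨
    Ico (2 ^ (k + 1) * (n / 2 ^ (k + 1))) (2 ^ k * (n / 2 ^ k)) =
      Ico (n / 2 ^ k * 2 ^ k - 2 ^ k) (n / 2 ^ k * 2 ^ k) ∧ 1 ≤ n / 2 ^ k := by
  have h1 : 2 ^ (k + 1) * (n / 2 ^ (k + 1)) = 2 ^ k * (2 * (n / 2 ^ k / 2)) := by
    rw [pow_succ, ← Nat.div_div_eq_div_mul, mul_assoc]
  rw [h1]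
  set q := n / 2 ^ k
  rcases Nat.mod_two_eq_zero_or_one q with hq | hq
  · left
    have : 2 * (q / 2) = q := by omega
    rw [this]; simp
  · right
    have h2 : 2 * (q / 2) = q - 1 := by omega
    rw [h2, Nat.mul_sub, mul_comm _ q, mul_one]
    exact ⟨rfl, by omega⟩

lemma sum_geometric_le {r : ℝ} (h0 : 0 ≤ r) (h1 : r < 1) (m : ℕ) :
    ∑ k ∈ range m, r ^ (m - k) ≤ r / (1 - r) := by
  have h2 : ∑ k ∈ range m, r ^ (m - k) = r * ∑ k ∈ range m, r ^ k := by
    rw [Finset.mul_sum, ← Finset.sum_range_reflect]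
    refine Finset.sum_congr rfl fun k hk => ?_
    rw [← pow_succ']
    congr 1
    have := mem_range.1 hk
    omega
  rw [h2, div_eq_mul_inv]
  exact mul_le_mul_of_nonneg_left
    ((Summable.sum_le_tsum _ (fun _ _ => by positivity) (summable_geometric_of_lt_one h0 h1)).trans
      (le_of_eq (tsum_geometric_of_lt_one h0 h1))) h0

/-- Cauchy–Schwarz with geometric weights: no factor for the number m of levels is lost, only some
of the decay in m - k. -/
lemma sq_sum_le_geometric (z : ℕ → ℝ) {r : ℝ} (h0 : 0 < r) (h1 : r < 1) (m : ℕ) :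
    (∑ k ∈ range m, z k) ^ 2 ≤ r / (1 - r) * ∑ k ∈ range m, (r ^ (m - k))⁻¹ * z k ^ 2 := by
  refine (sum_sq_le_of_sq_le (range m) (g := fun k => r ^ (m - k))
    (h := fun k => (r ^ (m - k))⁻¹ * z k ^ 2) (fun k => by positivity) (fun k => by positivity)
    fun k => le_of_eq ?_).trans ?_
  · rw [← mul_assoc, mul_inv_cancel₀ (by positivity), one_mul]
  · exact mul_le_mul_of_nonneg_right (sum_geometric_le h0.le h1 m)
      (Finset.sum_nonneg fun k _ => by positivity)

/-! ### Moments and almost sure bounds for projections on blocks of columns. -/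

section Blocks

variable {Ω : Type*} [MeasurableSpace Ω] {μ : Measure Ω} {e : ℕ → ℕ → ℕ → Ω → ℝ} {c B : ℝ}
  {a : ℕ → ℝ}

/-- The weak dependence used for linear combinations of columns. -/
structure BlockDep (μ : Measure Ω) (e : ℕ → ℕ → ℕ → Ω → ℝ) (c : ℝ) : Prop where
  memLp : ∀ i j t, MemLp (e i j t) 4 μ
  corr : ∀ n (J : Finset ℕ) i j t, ∑ l ∈ range n, ∑ h ∈ J, |∫ ω, e i j t ω * e l h t ω ∂μ| ≤ c
  cov : ∀ (I J : Finset ℕ) (i l j h t : ℕ), ∑ s ∈ I ×ˢ J,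
    |ProbabilityTheory.covariance (fun ω => e i j t ω * e l h t ω)
        (fun ω => e i j s.1 ω * e l s.2 s.1 ω) μ +
      ProbabilityTheory.covariance (fun ω => e l j t ω * e i h t ω)
        (fun ω => e l j s.1 ω * e i s.2 s.1 ω) μ| ≤ c

lemma ErrorAssumption.exists_blockDep [IsProbabilityMeasure μ] (he : ErrorAssumption μ e) :
    ∃ c, BlockDep μ e c := by
  obtain ⟨c₁, h₁⟩ := he.corr_a
  obtain ⟨c₂, h₂⟩ := he.cov_b
  refine ⟨max c₁ c₂, he.memLp_four, ?_, ?_⟩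
  · intro n J i j t
    obtain ⟨N, hN, hs, hJ⟩ := exists_range_superset (range n) J (i + j + t)
    refine le_trans ?_ ((h₁ N N N i j t (by omega) (by omega) (by omega)).trans (le_max_left _ _))
    refine le_trans ?_ (Finset.single_le_sum (f := fun s => ∑ l ∈ range N, ∑ h ∈ range N,
      |∫ ω, e i j t ω * e l h s ω ∂μ|) (fun _ _ => by positivity)
      (mem_range.2 (by omega : t < N)))
    refine (Finset.sum_le_sum_of_subset_of_nonneg hs fun _ _ _ => by positivity).trans' ?_
    exact Finset.sum_le_sum fun l _ =>
      Finset.sum_le_sum_of_subset_of_nonneg hJ fun _ _ _ => by positivity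
  · intro I J i l j h t
    obtain ⟨N, hN, hI, hJ⟩ := exists_range_superset I J (i + l + j + h + t)
    refine le_trans ?_ ((h₂ N N N i l j h t (by omega) (by omega) (by omega) (by omega)
      (by omega)).trans (le_max_right _ _))
    rw [Finset.sum_product]
    refine (Finset.sum_le_sum_of_subset_of_nonneg hI fun _ _ _ => by positivity).trans' ?_
    refine Finset.sum_le_sum fun s _ => ?_
    refine (Finset.sum_le_sum_of_subset_of_nonneg hJ fun _ _ _ => by positivity).trans ?_
    exact Finset.single_le_sum (f := fun l₂ => ∑ h₂ ∈ range N,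
      |ProbabilityTheory.covariance (fun ω => e i j t ω * e l h t ω)
          (fun ω => e i j s ω * e l₂ h₂ s ω) μ +
        ProbabilityTheory.covariance (fun ω => e l j t ω * e i h t ω)
          (fun ω => e l₂ j s ω * e i h₂ s ω) μ|) (fun _ _ => by positivity)
      (mem_range.2 (by omega : l < N))

lemma BlockDep.nonneg (h : BlockDep μ e c) : 0 ≤ c := by simpa using h.corr 0 ∅ 0 0 0

/-- The projection of the `i`-th row at time `t` on the weights `a` restricted to `J`. -/
def blockSum (e : ℕ → ℕ → ℕ → Ω → ℝ) (a : ℕ → ℝ) (J : Finset ℕ) (i t : ℕ) (ω : Ω) : ℝ :=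
  ∑ j ∈ J, a j * e i j t ω

/-- The squared Frobenius norm of the centred Gram matrix of the projected rows. -/
def blockFl (μ : Measure Ω) (e : ℕ → ℕ → ℕ → Ω → ℝ) (a : ℕ → ℝ) (p : ℕ) (J I : Finset ℕ)
    (ω : Ω) : ℝ :=
  ∑ i ∈ range p, ∑ l ∈ range p, (∑ t ∈ I, blockSum e a J i t ω * blockSum e a J l t ω -
    ∑ t ∈ I, ∫ ω', blockSum e a J i t ω' * blockSum e a J l t ω' ∂μ) ^ 2

lemma blockFl_nonneg (p : ℕ) (J I : Finset ℕ) (ω : Ω) : 0 ≤ blockFl μ e a p J I ω := by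
  unfold blockFl; positivity

lemma BlockDep.memLp_mul (h : BlockDep μ e c) (i j t i' j' t' : ℕ) :
    MemLp (fun ω => e i j t ω * e i' j' t' ω) 2 μ :=
  memLp_two_mul (h.memLp i j t) (h.memLp i' j' t')

lemma BlockDep.memLp_blockSum (h : BlockDep μ e c) (J : Finset ℕ) (i t : ℕ) :
    MemLp (blockSum e a J i t) 4 μ :=
  memLp_finsetSum _ fun j _ => (h.memLp i j t).const_mul (a j)

lemma BlockDep.memLp_blockSum_mul (h : BlockDep μ e c) (J : Finset ℕ) (i l t : ℕ) :
    MemLp (fun ω => blockSum e a J i t ω * blockSum e a J l t ω) 2 μ :=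
  memLp_two_mul (h.memLp_blockSum J i t) (h.memLp_blockSum J l t)

variable [IsProbabilityMeasure μ]

lemma BlockDep.integrable_blockFl (h : BlockDep μ e c) (p : ℕ) (J I : Finset ℕ) :
    Integrable (blockFl μ e a p J I) μ :=
  integrable_finsetSum _ fun _ _ => integrable_finsetSum _ fun _ _ =>
    integrable_sq_sum_sub I fun _ => h.memLp_blockSum_mul _ _ _ _

lemma BlockDep.integral_mul_blockSum (h : BlockDep μ e c) (J : Finset ℕ) (i l t : ℕ) :
    ∫ ω, blockSum e a J i t ω * blockSum e a J l t ω ∂μ =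
      ∑ j ∈ J, ∑ k ∈ J, a j * a k * ∫ ω, e i j t ω * e l k t ω ∂μ := by
  have hi : ∀ j k, Integrable (fun ω => a j * a k * (e i j t ω * e l k t ω)) μ := fun j k =>
    ((h.memLp_mul _ _ _ _ _ _).integrable (by norm_num)).const_mul _
  have h1 : ∀ ω, blockSum e a J i t ω * blockSum e a J l t ω =
      ∑ j ∈ J, ∑ k ∈ J, a j * a k * (e i j t ω * e l k t ω) := fun ω => by
    rw [blockSum, blockSum, Finset.sum_mul_sum]
    exact Finset.sum_congr rfl fun j _ => Finset.sum_congr rfl fun k _ => by ring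
  simp only [h1]
  rw [integral_finsetSum _ fun j _ => integrable_finsetSum _ fun k _ => hi j k]
  refine Finset.sum_congr rfl fun j _ => ?_
  rw [integral_finsetSum _ fun k _ => hi j k]
  simp only [integral_const_mul]

/-- The hypothesis only bounds the sum of two covariances, the second with the roles of i and l
exchanged. So the same second moment with i and l exchanged, which is nonnegative, is added before
the covariances are summed. -/
lemma BlockDep.integral_sq_le (h : BlockDep μ e c) (ha : ∀ j, |a j| ≤ B) (J I : Finset ℕ)
    (i l j : ℕ) :
    ∫ ω, (∑ s ∈ I ×ˢ J, a s.2 * (e i j s.1 ω * e l s.2 s.1 ω -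
      ∫ ω', e i j s.1 ω' * e l s.2 s.1 ω' ∂μ)) ^ 2 ∂μ ≤ B ^ 2 * c * (I.card * J.card) := by
  have h1 := integral_sq_sum_eq (μ := μ) (I ×ˢ J)
    (Z := fun s ω => e i j s.1 ω * e l s.2 s.1 ω) (fun s => h.memLp_mul _ _ _ _ _ _) fun s => a s.2
  have h2 := integral_sq_sum_eq (μ := μ) (I ×ˢ J)
    (Z := fun s ω => e l j s.1 ω * e i s.2 s.1 ω) (fun s => h.memLp_mul _ _ _ _ _ _) fun s => a s.2
  have h3 : 0 ≤ ∫ ω, (∑ s ∈ I ×ˢ J, a s.2 * (e l j s.1 ω * e i s.2 s.1 ω -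
      ∫ ω', e l j s.1 ω' * e i s.2 s.1 ω' ∂μ)) ^ 2 ∂μ := integral_nonneg fun _ => sq_nonneg _
  refine (le_add_of_nonneg_right h3).trans ?_
  rw [h1, h2, ← Finset.sum_add_distrib]
  refine (Finset.sum_le_card_nsmul _ _ (B ^ 2 * c) fun s _ => ?_).trans (le_of_eq ?_)
  · rw [← Finset.sum_add_distrib]
    refine le_trans ?_ (mul_le_mul_of_nonneg_left (h.cov I J i l j s.2 s.1) (sq_nonneg B))
    rw [Finset.mul_sum]
    refine Finset.sum_le_sum fun s' _ => ?_
    rw [← mul_add]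
    refine (le_abs_self _).trans ?_
    rw [abs_mul, abs_mul, sq]
    gcongr
    · exact (abs_nonneg _).trans (ha 0)
    · exact ha _
    · exact ha _
  · simp only [card_product, nsmul_eq_mul, Nat.cast_mul]; ring

/-- Covariances are only controlled for a common column j. The centred entry is therefore written as
Σ_j a_j Y_j, and Cauchy–Schwarz over j costs one factor |J|: hence |J|³ and not |J|². -/
lemma BlockDep.integral_blockFl_le (h : BlockDep μ e c) (ha : ∀ j, |a j| ≤ B) (p : ℕ)
    (J I : Finset ℕ) :
    ∫ ω, blockFl μ e a p J I ω ∂μ ≤ B ^ 4 * c * ((p : ℝ) ^ 2 * (I.card * (J.card : ℝ) ^ 3)) := by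
  have hi : ∀ i l, Integrable (fun ω => (∑ t ∈ I, blockSum e a J i t ω * blockSum e a J l t ω -
      ∑ t ∈ I, ∫ ω', blockSum e a J i t ω' * blockSum e a J l t ω' ∂μ) ^ 2) μ := fun i l =>
    integrable_sq_sum_sub I fun _ => h.memLp_blockSum_mul _ _ _ _
  have hB : 0 ≤ B := (abs_nonneg _).trans (ha 0)
  have hentry : ∀ i l, ∫ ω, (∑ t ∈ I, blockSum e a J i t ω * blockSum e a J l t ω -
      ∑ t ∈ I, ∫ ω', blockSum e a J i t ω' * blockSum e a J l t ω' ∂μ) ^ 2 ∂μ ≤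
      B ^ 4 * c * (I.card * (J.card : ℝ) ^ 3) := fun i l => by
    set Y : ℕ → Ω → ℝ := fun j ω => ∑ s ∈ I ×ˢ J, a s.2 * (e i j s.1 ω * e l s.2 s.1 ω -
      ∫ ω', e i j s.1 ω' * e l s.2 s.1 ω' ∂μ) with hY
    have hYi : ∀ j, Integrable (fun ω => Y j ω ^ 2) μ := fun j =>
      (memLp_sum_sub (μ := μ) (I ×ˢ J) (Z := fun s ω => e i j s.1 ω * e l s.2 s.1 ω)
        (fun s => h.memLp_mul _ _ _ _ _ _) fun s => a s.2).integrable_sq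
    have h1 : ∀ ω, ∑ t ∈ I, blockSum e a J i t ω * blockSum e a J l t ω -
        ∑ t ∈ I, ∫ ω', blockSum e a J i t ω' * blockSum e a J l t ω' ∂μ =
        ∑ j ∈ J, a j * Y j ω := fun ω => by
      simp only [h.integral_mul_blockSum, hY, Finset.sum_product, ← Finset.sum_sub_distrib,
        Finset.mul_sum]
      rw [Finset.sum_comm (s := J)]
      refine Finset.sum_congr rfl fun t _ => ?_
      rw [blockSum, blockSum, Finset.sum_mul_sum, ← Finset.sum_sub_distrib]
      refine Finset.sum_congr rfl fun j _ => ?_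
      rw [← Finset.sum_sub_distrib]
      exact Finset.sum_congr rfl fun k _ => by ring
    have h2 : ∀ ω, (∑ j ∈ J, a j * Y j ω) ^ 2 ≤ (J.card * B ^ 2) * ∑ j ∈ J, Y j ω ^ 2 := fun ω => by
      refine (Finset.sum_mul_sq_le_sq_mul_sq _ _ _).trans ?_
      refine mul_le_mul_of_nonneg_right ?_ (Finset.sum_nonneg fun _ _ => sq_nonneg _)
      rw [← nsmul_eq_mul]
      exact Finset.sum_le_card_nsmul _ _ _ fun j _ => by
        rw [← sq_abs]; gcongr; exact ha j
    simp only [h1]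
    calc ∫ ω, (∑ j ∈ J, a j * Y j ω) ^ 2 ∂μ ≤ ∫ ω, (J.card * B ^ 2) * ∑ j ∈ J, Y j ω ^ 2 ∂μ := by
          refine integral_mono ((hi i l).congr (ae_of_all _ fun ω => by simp only [h1]))
            ((integrable_finsetSum _ fun j _ => hYi j).const_mul _) h2
      _ = (J.card * B ^ 2) * ∑ j ∈ J, ∫ ω, Y j ω ^ 2 ∂μ := by
          rw [integral_const_mul, integral_finsetSum _ fun j _ => hYi j]
      _ ≤ (J.card * B ^ 2) * (J.card * (B ^ 2 * c * (I.card * J.card))) := by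
          gcongr
          rw [← nsmul_eq_mul]
          exact Finset.sum_le_card_nsmul _ _ _ fun j _ => h.integral_sq_le ha J I i l j
      _ = _ := by ring
  unfold blockFl
  rw [integral_finsetSum _ fun i _ => integrable_finsetSum _ fun l _ => hi i l]
  have h1 : ∀ i ∈ range p, ∫ ω, ∑ l ∈ range p,
      (∑ t ∈ I, blockSum e a J i t ω * blockSum e a J l t ω -
        ∑ t ∈ I, ∫ ω', blockSum e a J i t ω' * blockSum e a J l t ω' ∂μ) ^ 2 ∂μ ≤
      p * (B ^ 4 * c * (I.card * (J.card : ℝ) ^ 3)) := fun i _ => by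
    rw [integral_finsetSum _ fun l _ => hi i l]
    refine (Finset.sum_le_card_nsmul _ _ _ fun l _ => hentry i l).trans (le_of_eq (by simp))
  refine (Finset.sum_le_card_nsmul _ _ _ h1).trans (le_of_eq ?_)
  simp only [card_range, nsmul_eq_mul]
  ring

lemma BlockDep.rowOn (h : BlockDep μ e c) (ha : ∀ j, |a j| ≤ B) (p : ℕ) (J I : Finset ℕ) (ω : Ω) :
    RowOn (fun i _ t => blockSum e a J i t ω) p {0} I
      (B ^ 2 * c * (I.card * J.card) + √(blockFl μ e a p J I ω)) := by
  intro v
  have hB : 0 ≤ B := (abs_nonneg _).trans (ha 0)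
  simp only [Finset.sum_singleton]
  refine quad_le (range p) I (fun i t => blockSum e a J i t ω)
    (fun i l => ∑ t ∈ I, ∫ ω', blockSum e a J i t ω' * blockSum e a J l t ω' ∂μ) (fun i _ => ?_)
    (fun i l => by simp only [mul_comm]) le_rfl v
  have h1 : ∀ t l, |∫ ω', blockSum e a J i t ω' * blockSum e a J l t ω' ∂μ| ≤
      ∑ j ∈ J, ∑ k ∈ J, B ^ 2 * |∫ ω, e i j t ω * e l k t ω ∂μ| := fun t l => by
    rw [h.integral_mul_blockSum]
    refine (Finset.abs_sum_le_sum_abs _ _).trans (Finset.sum_le_sum fun j _ => ?_)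
    refine (Finset.abs_sum_le_sum_abs _ _).trans (Finset.sum_le_sum fun k _ => ?_)
    rw [abs_mul, abs_mul, sq]
    gcongr
    · exact ha _
    · exact ha _
  calc _ ≤ ∑ l ∈ range p, ∑ t ∈ I, ∑ j ∈ J, ∑ k ∈ J, B ^ 2 * |∫ ω, e i j t ω * e l k t ω ∂μ| :=
        Finset.sum_le_sum fun l _ => (Finset.abs_sum_le_sum_abs _ _).trans
          (Finset.sum_le_sum fun t _ => h1 t l)
    _ = ∑ t ∈ I, ∑ j ∈ J, B ^ 2 * ∑ l ∈ range p, ∑ k ∈ J, |∫ ω, e i j t ω * e l k t ω ∂μ| := by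
        rw [Finset.sum_comm]
        refine Finset.sum_congr rfl fun t _ => ?_
        rw [Finset.sum_comm]
        simp only [Finset.mul_sum]
    _ ≤ ∑ _t ∈ I, ∑ _j ∈ J, B ^ 2 * c := by
        gcongr with t _ j _
        exact h.corr p J i j t
    _ = _ := by simp; ring

/-- The total fluctuation over all dyadic blocks of `[0, 2 ^ m)`. -/
def dyadicFl (μ : Measure Ω) (e : ℕ → ℕ → ℕ → Ω → ℝ) (a : ℕ → ℝ) (d : ℕ × ℕ × ℕ) (ω : Ω) : ℝ :=
  ∑ k ∈ range d.2.1, (16 / 9 : ℝ) ^ (d.2.1 - k) * ∑ q ∈ range (2 ^ (d.2.1 - k)),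
    blockFl μ e a (2 ^ d.1) (Ico (q * 2 ^ k - 2 ^ k) (q * 2 ^ k)) (range (2 ^ d.2.2)) ω

/-- Level k has 2^(m - k) blocks with moments of order 2^(3k), in total 2^(3m) 4^(-(m - k)). Even
with the extra weight (16/9)^(m - k) the terms decay like (4/9)^(m - k), and this series sums to
less than 1. -/
lemma BlockDep.integral_dyadicFl_le (h : BlockDep μ e c) (ha : ∀ j, |a j| ≤ B) (d : ℕ × ℕ × ℕ) :
    ∫ ω, dyadicFl μ e a d ω ∂μ ≤
      B ^ 4 * c * (((2 : ℝ) ^ d.1) ^ 2 * (2 ^ d.2.2 * ((2 : ℝ) ^ d.2.1) ^ 3)) := by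
  have hc := h.nonneg
  have hB : 0 ≤ B := (abs_nonneg _).trans (ha 0)
  obtain ⟨p, m, n⟩ := d
  simp only [dyadicFl]
  rw [integral_finsetSum _ fun k _ => (integrable_finsetSum _ fun q _ =>
    h.integrable_blockFl _ _ _).const_mul _]
  have h1 : ∀ k ∈ range m, ∫ ω, (16 / 9 : ℝ) ^ (m - k) * ∑ q ∈ range (2 ^ (m - k)),
      blockFl μ e a (2 ^ p) (Ico (q * 2 ^ k - 2 ^ k) (q * 2 ^ k)) (range (2 ^ n)) ω ∂μ ≤
      B ^ 4 * c * (((2 : ℝ) ^ p) ^ 2 * (2 ^ n * ((2 : ℝ) ^ m) ^ 3)) * (4 / 9) ^ (m - k) := by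
    intro k hk
    rw [integral_const_mul, integral_finsetSum _ fun q _ => h.integrable_blockFl _ _ _]
    have h2 : ∀ q ∈ range (2 ^ (m - k)),
        ∫ ω, blockFl μ e a (2 ^ p) (Ico (q * 2 ^ k - 2 ^ k) (q * 2 ^ k)) (range (2 ^ n)) ω ∂μ ≤
        B ^ 4 * c * (((2 : ℝ) ^ p) ^ 2 * (2 ^ n * (2 ^ k) ^ 3)) := fun q _ => by
      refine (h.integral_blockFl_le ha _ _ _).trans ?_
      simp only [card_range, Nat.cast_pow, Nat.cast_ofNat, Nat.card_Ico]
      have : ((q * 2 ^ k - (q * 2 ^ k - 2 ^ k) : ℕ) : ℝ) ≤ 2 ^ k := by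
        exact_mod_cast (tsub_tsub_le : q * 2 ^ k - (q * 2 ^ k - 2 ^ k) ≤ 2 ^ k)
      gcongr
    refine (mul_le_mul_of_nonneg_left (Finset.sum_le_card_nsmul _ _ _ h2)
      (by positivity)).trans (le_of_eq ?_)
    obtain ⟨r, rfl⟩ := Nat.exists_eq_add_of_lt (mem_range.1 hk)
    rw [show k + r + 1 - k = r + 1 by omega, show k + r + 1 = k + (r + 1) by ring]
    simp only [card_range, nsmul_eq_mul, Nat.cast_pow, Nat.cast_ofNat]
    have e1 : (16 / 9 : ℝ) ^ (r + 1) * 2 ^ (r + 1) =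
        ((2 : ℝ) ^ (r + 1)) ^ 3 * (4 / 9) ^ (r + 1) := by
      rw [← pow_mul, mul_comm (r + 1) 3, pow_mul, ← mul_pow, ← mul_pow]; norm_num
    rw [pow_add 2 k, mul_pow (2 ^ k : ℝ), ← mul_assoc, e1]
    ring
  refine (Finset.sum_le_sum h1).trans ?_
  rw [← Finset.mul_sum]
  refine mul_le_of_le_one_right (by positivity) ?_
  exact (sum_geometric_le (by norm_num) (by norm_num) m).trans (by norm_num)

/-- The spectral norm of the projected rows, at every size. -/
lemma BlockDep.ae_rowOn (h : BlockDep μ e c) (ha : ∀ j, |a j| ≤ B) {θ : ℝ} (hθ : 0 < θ) :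
    ∀ᵐ ω ∂μ, ∃ K, 0 ≤ K ∧ ∀ p₁ p₂ T : ℕ, 0 < p₁ → 0 < p₂ → 0 < T →
      RowOn (fun i _ t => blockSum e a (range p₂) i t ω) p₁ {0} (range T)
        (K * (T * p₂ + p₁ * √T * (p₂ * √p₂) * √(dwt θ p₁ p₂ T))) := by
  have hc := h.nonneg
  have hB : 0 ≤ B := (abs_nonneg _).trans (ha 0)
  have hfl0 : ∀ d ω, 0 ≤ dyadicFl μ e a d ω := fun d ω =>
    Finset.sum_nonneg fun k _ => mul_nonneg (by positivity)
      (Finset.sum_nonneg fun q _ => blockFl_nonneg _ _ _ _)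
  have h1 := ae_le_wt (μ := μ) hθ (Φ := dyadicFl μ e a) hfl0
    (fun d => integrable_finsetSum _ fun k _ => (integrable_finsetSum _ fun q _ =>
      h.integrable_blockFl _ _ _).const_mul _)
    (B := fun d => ((2 : ℝ) ^ d.1) ^ 2 * (2 ^ d.2.2 * ((2 : ℝ) ^ d.2.1) ^ 3))
    (fun d => by positivity) (h.integral_dyadicFl_le ha)
  filter_upwards [h1] with ω ⟨K, hK, hω⟩
  -- The factor 42 = 7 · 6 comes from putting the blocks together; 4 and 8 come from rounding the
  -- sizes up.
  refine ⟨42 * (4 * (B ^ 2 * c) + 8 * √K), by positivity, fun p₁ p₂ T hp₁ hp₂ hT => ?_⟩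
  set m := dy p₂ with hm
  set P : ℝ := 2 ^ dy p₁ with hP
  set M : ℝ := 2 ^ m with hM
  set N : ℝ := 2 ^ dy T with hN
  have hW : 0 ≤ dwt θ p₁ p₂ T := (wt_pos _ _).le
  set Y : ℝ := B ^ 2 * c * (N * M) + √K * (P * √N * (M * √M) * √(dwt θ p₁ p₂ T)) with hYdef
  have hY : 0 ≤ Y := by positivity
  set J : ℕ → Finset ℕ := fun k => Ico (2 ^ (k + 1) * (p₂ / 2 ^ (k + 1))) (2 ^ k * (p₂ / 2 ^ k))
    with hJ
  -- A block at level k carries the share (3/4)^(m - k) of the full bound: for the fluctuation this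
  -- is the square root of the inverse weight (16/9)^(m - k) in `dyadicFl`, and the mean even has
  -- the share (1/2)^(m - k).
  have hblock : ∀ k ∈ range m,
      RowOn (fun i _ t => blockSum e a (J k) i t ω) p₁ {0} (range T) ((3 / 4) ^ (m - k) * Y) := by
    intro k hk
    rcases dyadic_Ico_eq p₂ k with h2 | ⟨h2, h3⟩
    · intro v
      simp only [hJ, h2, blockSum, Finset.sum_empty, mul_zero, ne_eq,
        OfNat.ofNat_ne_zero, not_false_eq_true, zero_pow, Finset.sum_const_zero]
      positivity
    · simp only [hJ, h2]
      set q := p₂ / 2 ^ k with hq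
      refine (h.rowOn ha (2 ^ dy p₁) (Ico (q * 2 ^ k - 2 ^ k) (q * 2 ^ k))
        (range (2 ^ dy T)) ω).mono
        (lt_two_pow_dy _).le subset_rfl (range_subset_range.2 (lt_two_pow_dy _).le) ?_
      have hkm := mem_range.1 hk
      have hqm : q < 2 ^ (m - k) := by
        rw [hq, Nat.div_lt_iff_lt_mul (by positivity), ← pow_add, Nat.sub_add_cancel hkm.le]
        exact lt_two_pow_dy p₂
      have h4 : (16 / 9 : ℝ) ^ (m - k) * blockFl μ e a (2 ^ dy p₁)
          (Ico (q * 2 ^ k - 2 ^ k) (q * 2 ^ k)) (range (2 ^ dy T)) ω ≤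
          K * (P ^ 2 * (N * M ^ 3) * dwt θ p₁ p₂ T) := by
        refine le_trans ?_ (hω (dy p₁, dy p₂, dy T))
        refine le_trans ?_ (Finset.single_le_sum (f := fun k => (16 / 9 : ℝ) ^ (m - k) *
          ∑ q ∈ range (2 ^ (m - k)), blockFl μ e a (2 ^ dy p₁)
          (Ico (q * 2 ^ k - 2 ^ k) (q * 2 ^ k)) (range (2 ^ dy T)) ω) (fun k _ => mul_nonneg
            (by positivity) (Finset.sum_nonneg fun q _ => blockFl_nonneg _ _ _ _)) hk)
        refine mul_le_mul_of_nonneg_left ?_ (by positivity)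
        exact Finset.single_le_sum (f := fun q => blockFl μ e a (2 ^ dy p₁)
          (Ico (q * 2 ^ k - 2 ^ k) (q * 2 ^ k)) (range (2 ^ dy T)) ω)
          (fun q _ => blockFl_nonneg _ _ _ _) (mem_range.2 hqm)
      have h5 : √(blockFl μ e a (2 ^ dy p₁) (Ico (q * 2 ^ k - 2 ^ k) (q * 2 ^ k))
          (range (2 ^ dy T)) ω) ≤
          (3 / 4) ^ (m - k) * (√K * (P * √N * (M * √M) * √(dwt θ p₁ p₂ T))) := by
        refine Real.sqrt_le_iff.2 ⟨by positivity, ?_⟩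
        simp only [mul_pow]
        rw [Real.sq_sqrt hK, Real.sq_sqrt hW, Real.sq_sqrt (by positivity : 0 ≤ N),
          Real.sq_sqrt (by positivity : 0 ≤ M), ← pow_mul, mul_comm (m - k) 2, pow_mul]
        have e1 : (16 / 9 : ℝ) ^ (m - k) * ((3 / 4) ^ 2) ^ (m - k) = 1 := by
          rw [← mul_pow]; norm_num
        have h6 := mul_le_mul_of_nonneg_right h4
          (by positivity : (0 : ℝ) ≤ ((3 / 4) ^ 2) ^ (m - k))
        rw [mul_right_comm, e1, one_mul] at h6
        refine h6.trans (le_of_eq ?_)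
        ring
      have h6 : ((Ico (q * 2 ^ k - 2 ^ k) (q * 2 ^ k)).card : ℝ) ≤ (3 / 4) ^ (m - k) * M := by
        have e1 : (Ico (q * 2 ^ k - 2 ^ k) (q * 2 ^ k)).card ≤ 2 ^ k := by
          rw [Nat.card_Ico]; exact tsub_tsub_le
        have e2 : (2 : ℝ) ^ k = (1 / 2) ^ (m - k) * M := by
          rw [hM, ← Nat.sub_add_cancel hkm.le, pow_add, Nat.add_sub_cancel, ← mul_assoc, ← mul_pow]
          norm_num
        calc _ ≤ (2 : ℝ) ^ k := by exact_mod_cast e1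
          _ = (1 / 2) ^ (m - k) * M := e2
          _ ≤ _ := by
            refine mul_le_mul_of_nonneg_right ?_ (by positivity)
            exact pow_le_pow_left₀ (by norm_num) (by norm_num) _
      rw [hYdef, mul_add]
      refine add_le_add ?_ h5
      simp only [card_range, Nat.cast_pow, Nat.cast_ofNat]
      calc B ^ 2 * c * (N * ((Ico (q * 2 ^ k - 2 ^ k) (q * 2 ^ k)).card : ℝ)) ≤
            B ^ 2 * c * (N * ((3 / 4) ^ (m - k) * M)) := by gcongr
        _ = _ := by ring
  intro v
  simp only [Finset.sum_singleton]
  set V := ∑ i ∈ range p₁, v i ^ 2 with hV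
  have hV0 : 0 ≤ V := Finset.sum_nonneg fun _ _ => sq_nonneg _
  set z : ℕ → ℕ → ℝ := fun k t => ∑ i ∈ range p₁, v i * blockSum e a (J k) i t ω with hz
  have hzk : ∀ k ∈ range m, ∑ t ∈ range T, z k t ^ 2 ≤ (3 / 4) ^ (m - k) * Y * V := fun k hk => by
    have := hblock k hk v
    simpa only [Finset.sum_singleton] using this
  have hsplit : ∀ t, ∑ i ∈ range p₁, v i * blockSum e a (range p₂) i t ω =
      ∑ k ∈ range m, z k t := fun t => by
    simp only [hz, blockSum]
    rw [Finset.sum_comm]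
    refine Finset.sum_congr rfl fun i _ => ?_
    rw [← Finset.mul_sum, sum_range_eq_sum_dyadic _ (lt_two_pow_dy p₂)]
  -- With r = 7/8 the prefactor r / (1 - r) is 7, and the remaining ratio (3/4) / (7/8) = 6/7 sums
  -- to at most 6.
  calc ∑ t ∈ range T, (∑ i ∈ range p₁, v i * blockSum e a (range p₂) i t ω) ^ 2
      ≤ ∑ t ∈ range T, (7 / 8 : ℝ) / (1 - 7 / 8) *
          ∑ k ∈ range m, ((7 / 8 : ℝ) ^ (m - k))⁻¹ * z k t ^ 2 := by
        refine Finset.sum_le_sum fun t _ => ?_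
        rw [hsplit]
        exact sq_sum_le_geometric (fun k => z k t) (by norm_num) (by norm_num) m
    _ = 7 * ∑ k ∈ range m, ((7 / 8 : ℝ) ^ (m - k))⁻¹ * ∑ t ∈ range T, z k t ^ 2 := by
        rw [← Finset.mul_sum, Finset.sum_comm]
        simp only [Finset.mul_sum]
        norm_num
    _ ≤ 7 * ∑ k ∈ range m, (6 / 7 : ℝ) ^ (m - k) * (Y * V) := by
        refine mul_le_mul_of_nonneg_left (Finset.sum_le_sum fun k hk => ?_) (by norm_num)
        refine (mul_le_mul_of_nonneg_left (hzk k hk) (by positivity)).trans (le_of_eq ?_)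
        rw [← inv_pow, mul_assoc, ← mul_assoc, ← mul_pow]
        norm_num
    _ ≤ 7 * (6 * (Y * V)) := by
        rw [← Finset.sum_mul]
        have := sum_geometric_le (r := 6 / 7) (by norm_num) (by norm_num) m
        norm_num at this
        gcongr
    _ = 42 * Y * V := by ring
    _ ≤ _ := by
        refine mul_le_mul_of_nonneg_right ?_ hV0
        rw [mul_assoc 42]
        refine mul_le_mul_of_nonneg_left ?_ (by norm_num)
        have hb1 : P ≤ 2 * p₁ := two_pow_dy_le_cast hp₁
        have hb2 : M ≤ 2 * p₂ := two_pow_dy_le_cast hp₂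
        have hb3 : N ≤ 2 * T := two_pow_dy_le_cast hT
        have hs2 : √M ≤ √2 * √p₂ := by
          rw [← Real.sqrt_mul (by norm_num)]; exact Real.sqrt_le_sqrt hb2
        have hs3 : √N ≤ √2 * √T := by
          rw [← Real.sqrt_mul (by norm_num)]; exact Real.sqrt_le_sqrt hb3
        have h7 : Y ≤ B ^ 2 * c * ((2 * T) * (2 * p₂)) + √K * ((2 * p₁) * (√2 * √T) *
            ((2 * p₂) * (√2 * √p₂)) * √(dwt θ p₁ p₂ T)) := by
          rw [hYdef]; gcongr
        have h8 : √K * ((2 * p₁) * (√2 * √T) *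
            ((2 * p₂) * (√2 * √p₂)) * √(dwt θ p₁ p₂ T)) =
            8 * √K * (p₁ * √T * (p₂ * √p₂) * √(dwt θ p₁ p₂ T)) := by
          have : √2 * √2 = (2 : ℝ) := Real.mul_self_sqrt (by norm_num)
          linear_combination (4 * √K * p₁ * √T * p₂ * √p₂ * √(dwt θ p₁ p₂ T)) * this
        rw [h8] at h7
        have h9 : 0 ≤ 4 * (B ^ 2 * c) * (p₁ * √T * (p₂ * √p₂) * √(dwt θ p₁ p₂ T)) := by positivity
        have h10 : 0 ≤ 8 * √K * (T * p₂) := by positivity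
        linarith

end Blocks

/-! ### The spectral norm of a random matrix -/

section SpecNorm

variable {m n : ℕ}

lemma nsq_eq_norm_sq {ι : Type*} [Fintype ι] (v : ι → ℝ) : nsq v = ‖WithLp.toLp 2 v‖ ^ 2 := by
  rw [EuclideanSpace.norm_sq_eq, nsq_eq_sum]; simp

lemma nsq_mulVec_le_specNorm (A : Matrix (Fin m) (Fin n) ℝ) (v : Fin n → ℝ) :
    nsq (A *ᵥ v) ≤ specNorm A ^ 2 * nsq v := by
  have h := (Matrix.toEuclideanLin A).toContinuousLinearMap.le_opNorm (WithLp.toLp 2 v)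
  have h2 : (Matrix.toEuclideanLin A).toContinuousLinearMap (WithLp.toLp 2 v) =
      WithLp.toLp 2 (A *ᵥ v) := by
    rw [LinearMap.coe_toContinuousLinearMap', Matrix.toEuclideanLin, Matrix.toLpLin_apply]
  rw [h2] at h
  rw [nsq_eq_norm_sq, nsq_eq_norm_sq, ← mul_pow]
  exact pow_le_pow_left₀ (norm_nonneg _) h 2

lemma specNorm_nonneg (A : Matrix (Fin m) (Fin n) ℝ) : 0 ≤ specNorm A := norm_nonneg _

lemma sq_entry_le_specNorm (A : Matrix (Fin m) (Fin n) ℝ) (i : Fin m) (j : Fin n) :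
    A i j ^ 2 ≤ specNorm A ^ 2 := by
  have h := nsq_mulVec_le_specNorm A (Pi.single j 1)
  have h1 : nsq (Pi.single j (1 : ℝ) : Fin n → ℝ) = 1 := by simp [nsq]
  rw [h1, mul_one, nsq_eq_sum, Matrix.mulVec_single_one] at h
  exact (Finset.single_le_sum (f := fun i => A.col j i ^ 2) (fun _ _ => sq_nonneg _)
    (mem_univ i)).trans h

lemma specNorm_sq_le (A : Matrix (Fin m) (Fin n) ℝ) : specNorm A ^ 2 ≤ ∑ i, ∑ j, A i j ^ 2 := by
  have h0 : 0 ≤ ∑ i, ∑ j, A i j ^ 2 := by positivity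
  refine (Real.le_sqrt (specNorm_nonneg A) h0).1 ?_
  refine ContinuousLinearMap.opNorm_le_bound _ (Real.sqrt_nonneg _) fun x => ?_
  have h1 := nsq_mulVec_le_frobenius A x.ofLp
  rw [nsq_eq_norm_sq, nsq_eq_norm_sq] at h1
  refine le_of_sq_le_sq ?_ (by positivity)
  rw [mul_pow, Real.sq_sqrt h0]
  exact h1

/-- A norm composed with a linear map in finite dimension; this provides the measurability needed
for integrals of spectral norms. -/
lemma continuous_specNorm :
    Continuous fun A : Fin m → Fin n → ℝ => specNorm (Matrix.of A) := by
  let L : (Fin m → Fin n → ℝ) →ₗ[ℝ] (EuclideanSpace ℝ (Fin n) →L[ℝ] EuclideanSpace ℝ (Fin m)) :=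
    { toFun := fun A => (Matrix.toEuclideanLin (Matrix.of A)).toContinuousLinearMap
      map_add' := fun A B => by rw [← map_add, ← map_add]; rfl
      map_smul' := fun c A => by rw [RingHom.id_apply, ← map_smul, ← map_smul]; rfl }
  exact L.continuous_of_finiteDimensional.norm

variable {Ω : Type*} [MeasurableSpace Ω] {μ : Measure Ω}

lemma integrable_specNorm_sq {A : Ω → Matrix (Fin m) (Fin n) ℝ}
    (hA : ∀ i j, MemLp (fun ω => A ω i j) 2 μ) (hm : ∀ i j, Measurable fun ω => A ω i j) :
    Integrable (fun ω => specNorm (A ω) ^ 2) μ := by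
  have h1 : Measurable fun ω => (fun i j => A ω i j : Fin m → Fin n → ℝ) :=
    measurable_pi_lambda _ fun i => measurable_pi_lambda _ fun j => hm i j
  have h2 : Measurable fun ω => specNorm (A ω) := continuous_specNorm.measurable.comp h1
  refine Integrable.mono' (g := fun ω => ∑ i, ∑ j, A ω i j ^ 2)
    (integrable_finsetSum _ fun i _ => integrable_finsetSum _ fun j _ => (hA i j).integrable_sq)
    (h2.pow_const 2).aestronglyMeasurable (ae_of_all _ fun ω => ?_)
  rw [Real.norm_of_nonneg (sq_nonneg _)]
  exact specNorm_sq_le _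

end SpecNorm

/-! ### The factors -/

section Factors

variable {Ω : Type*} [MeasurableSpace Ω] {μ : Measure Ω} [IsProbabilityMeasure μ] {k₁ k₂ : ℕ}
  {F : ℕ → Ω → Matrix (Fin k₁) (Fin k₂) ℝ}

/-- Entries are dominated by the spectral norm, and x^k ≤ 1 + x^(4 + ε) for x ≥ 0 and k ≤ 4. -/
lemma FactorAssumption.exists_moment (hF : FactorAssumption μ F) :
    ∃ c, ∀ t a b, MemLp (fun ω => F t ω a b) 4 μ ∧ ∫ ω, F t ω a b ^ 2 ∂μ ≤ c := by
  obtain ⟨ε, hε, c₀, hc⟩ := hF.moment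
  refine ⟨1 + c₀, fun t a b => ?_⟩
  set g : Ω → ℝ := fun ω => 1 + specNorm (F t ω) ^ (4 + ε : ℝ) with hg
  have hgi : Integrable g μ := (integrable_const 1).add (hc t).1
  have hpow : ∀ (k : ℕ) (_ : k ≤ 4) (ω : Ω), specNorm (F t ω) ^ k ≤ g ω := fun k hk ω => by
    have h0 := specNorm_nonneg (F t ω)
    rcases le_total (specNorm (F t ω)) 1 with h1 | h1
    · have : specNorm (F t ω) ^ k ≤ 1 := pow_le_one₀ h0 h1
      have : 0 ≤ specNorm (F t ω) ^ (4 + ε : ℝ) := Real.rpow_nonneg h0 _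
      simp only [hg]; linarith
    · have : specNorm (F t ω) ^ k ≤ specNorm (F t ω) ^ (4 + ε : ℝ) := by
        rw [← Real.rpow_natCast]
        refine Real.rpow_le_rpow_of_exponent_le h1 ?_
        have : (k : ℝ) ≤ 4 := by exact_mod_cast hk
        linarith
      simp only [hg]; linarith
  have habs : ∀ ω, |F t ω a b| ≤ specNorm (F t ω) := fun ω =>
    abs_le_of_sq_le_sq (sq_entry_le_specNorm (F t ω) a b) (specNorm_nonneg _)
  have hm := (hF.measurable t a b).aestronglyMeasurable (μ := μ)
  constructor
  · rw [← integrable_norm_rpow_iff hm (by norm_num) (by norm_num)]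
    refine hgi.mono' (hm.norm.aemeasurable.pow_const _).aestronglyMeasurable
      (ae_of_all _ fun ω => ?_)
    rw [Real.norm_of_nonneg (by positivity)]
    simp only [ENNReal.toReal_ofNat, Real.norm_eq_abs]
    rw [show (4 : ℝ) = ((4 : ℕ) : ℝ) by norm_num, Real.rpow_natCast]
    exact (pow_le_pow_left₀ (abs_nonneg _) (habs ω) 4).trans (hpow 4 le_rfl ω)
  · have h1 : ∫ ω, g ω ∂μ ≤ 1 + c₀ := by
      rw [hg, integral_add (integrable_const 1) (hc t).1]
      simpa using (hc t).2
    refine le_trans (integral_mono_of_nonneg (ae_of_all _ fun ω => sq_nonneg _) hgi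
      (ae_of_all _ fun ω => ?_)) h1
    exact (sq_entry_le_specNorm (F t ω) a b).trans (hpow 2 (by norm_num) ω)

/-- The centred partial sums of the squared factors, uniformly over dyadic ranges. -/
lemma FactorAssumption.ae_sum_sq (hF : FactorAssumption μ F) {θ : ℝ} (hθ : 0 < θ) (a : Fin k₁)
    (b : Fin k₂) : ∀ᵐ ω ∂μ, ∃ K, 0 ≤ K ∧ ∀ (d : ℕ × ℕ × ℕ) (τ : ℕ), τ ≤ 2 ^ d.2.2 →
      (∑ t ∈ range τ, (F t ω a b ^ 2 - ∫ ω', F t ω' a b ^ 2 ∂μ)) ^ 2 ≤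
        K * (2 ^ d.2.2 * wt θ d) := by
  obtain ⟨c₁, hc₁⟩ := hF.exists_moment
  obtain ⟨c₀, hc₀⟩ := hF.maximal
  set D : ℕ → Ω → ℝ := fun τ ω =>
    (∑ t ∈ range τ, (F t ω a b * F t ω a b - ∫ ω', F t ω' a b * F t ω' a b ∂μ)) ^ 2 with hD
  have hD0 : ∀ τ ω, 0 ≤ D τ ω := fun _ _ => sq_nonneg _
  have hDi : ∀ τ, Integrable (D τ) μ := fun τ => by
    have := integrable_sq_sum_sub (μ := μ) (range τ) (Z := fun t ω => F t ω a b * F t ω a b)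
      fun t => memLp_two_mul (hc₁ t a b).1 (hc₁ t a b).1
    simpa only [hD, Finset.sum_sub_distrib] using this
  have hDm : ∀ τ, Measurable (D τ) := fun τ => by
    have := fun t => hF.measurable t a b
    simp only [hD]; fun_prop
  set S : ℕ → Ω → ℝ := fun T ω => ⨆ τ : Fin T, D (τ + 1) ω with hS
  have hle : ∀ T ω (τ : Fin T), D (τ + 1) ω ≤ S T ω := fun T ω τ =>
    le_ciSup (f := fun τ : Fin T => D (τ + 1) ω) (Set.finite_range _).bddAbove τ
  have hS0 : ∀ T ω, 0 ≤ S T ω := fun T ω => Real.iSup_nonneg fun _ => hD0 _ _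
  have hSi : ∀ T, Integrable (S T) μ := fun T => by
    refine Integrable.mono' (g := fun ω => ∑ τ : Fin T, D (τ + 1) ω)
      (integrable_finsetSum _ fun τ _ => hDi _)
      (Measurable.iSup fun τ : Fin T => hDm _).aestronglyMeasurable (ae_of_all _ fun ω => ?_)
    rw [Real.norm_of_nonneg (hS0 _ _)]
    refine Real.iSup_le (fun τ => ?_) (Finset.sum_nonneg fun _ _ => hD0 _ _)
    exact Finset.single_le_sum (f := fun τ : Fin T => D (τ + 1) ω) (fun _ _ => hD0 _ _) (mem_univ τ)
  have h := ae_le_wt (μ := μ) hθ (Φ := fun d => S (2 ^ d.2.2)) (fun d => hS0 _) (fun d => hSi _)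
    (B := fun d => (2 : ℝ) ^ d.2.2) (fun d => by positivity) (c := c₀)
    (fun d => by
      have := hc₀ a a b b (2 ^ d.2.2)
      push_cast at this
      exact this)
  filter_upwards [h] with ω ⟨K, hK, hω⟩
  refine ⟨K, hK, fun d τ hτ => ?_⟩
  -- The maximum in the assumption runs over partial sums with at least one term, so the empty sum
  -- is separate.
  rcases τ with _ | τ
  · have := wt_pos θ d
    simp only [Finset.range_zero, Finset.sum_empty, ne_eq, OfNat.ofNat_ne_zero,
      not_false_eq_true, zero_pow]
    positivity
  · refine le_trans ?_ (hω d)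
    refine le_trans (le_of_eq ?_) (hle (2 ^ d.2.2) ω ⟨τ, by omega⟩)
    simp only [hD, sq]

end Factors

/-! ### Interactions of factors and errors -/

section Interaction

variable {Ω : Type*} [MeasurableSpace Ω] {μ : Measure Ω} [IsProbabilityMeasure μ] {k₁ k₂ : ℕ}
  {F : ℕ → Ω → Matrix (Fin k₁) (Fin k₂) ℝ} {e : ℕ → ℕ → ℕ → Ω → ℝ}

/-- Testing the weak dependence condition with the last coordinate vectors of an (i + 1) × (j + 1)
matrix isolates e_{ij,t}. -/
lemma DependenceAssumption.exists_second_moment (hFe : DependenceAssumption μ F e)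
    (hF : FactorAssumption μ F) (he : ErrorAssumption μ e) :
    ∃ c, ∀ T i j q, ∫ ω, zetaBar F e T i j q ω ^ 2 ∂μ ≤ c := by
  obtain ⟨c, hc⟩ := hFe.weak
  refine ⟨c, fun T i j q => ?_⟩
  refine le_trans ?_ (hc (i + 1) (j + 1) T (Pi.single (Fin.last i) 1) (Pi.single (Fin.last j) 1)
    (by simp [← nsq_eq_sum, nsq]) (by simp [← nsq_eq_sum, nsq]))
  have hentry : ∀ ω a b, ((√T)⁻¹ • ∑ t ∈ range T,
      ((Pi.single (Fin.last i) 1 : Fin (i + 1) → ℝ) ⬝ᵥ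
        (errMat e (i + 1) (j + 1) t ω).mulVec (Pi.single (Fin.last j) 1)) • F t ω) a b =
      zetaBar F e T i j (a, b) ω := fun ω a b => by
    rw [Matrix.smul_apply, Matrix.sum_apply, zetaBar, div_eq_inv_mul, smul_eq_mul]
    congr 1
    refine Finset.sum_congr rfl fun t _ => ?_
    simp [errMat, mul_comm]
  refine integral_mono (((hFe.memLp T i j q).mono_exponent (by norm_num)).integrable_sq) ?_
    fun ω => ?_
  · refine integrable_specNorm_sq (fun a b => ?_) fun a b => ?_
    · simp only [hentry]
      exact (hFe.memLp T i j (a, b)).mono_exponent (by norm_num)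
    · simp only [hentry, zetaBar]
      have h1 := fun t => hF.measurable t a b
      have h2 := fun t => he.measurable i j t
      fun_prop
  · simp only
    refine le_trans (le_of_eq ?_) (sq_entry_le_specNorm _ q.1 q.2)
    rw [hentry]

/-- The covariance conditions on the interactions bound signed sums over a whole range of rows, so a
diagonal term cannot be singled out there. It is recovered from row sums: twice the lower triangle
minus the full square. -/
lemma sum_diag_eq (A : ℕ → ℕ → ℝ) (hA : ∀ i l, A i l = A l i) (p : ℕ) :
    ∑ i ∈ range p, A i i =
      2 * ∑ i ∈ range p, ∑ l ∈ range (i + 1), A i l - ∑ i ∈ range p, ∑ l ∈ range p, A i l := by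
  induction p with
  | zero => simp
  | succ p ih =>
    have h1 : ∑ i ∈ range (p + 1), ∑ l ∈ range (p + 1), A i l =
        ∑ i ∈ range p, ∑ l ∈ range p, A i l + 2 * ∑ l ∈ range p, A p l + A p p := by
      rw [Finset.sum_range_succ]
      simp only [Finset.sum_range_succ, Finset.sum_add_distrib]
      have : ∑ i ∈ range p, A i p = ∑ l ∈ range p, A p l := Finset.sum_congr rfl fun i _ => hA i p
      rw [this]; ring
    rw [Finset.sum_range_succ, ih, h1, Finset.sum_range_succ (fun i => ∑ l ∈ range (i + 1), A i l),
      Finset.sum_range_succ (fun l => A p l)]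
    ring

/-- The centred sum of squares of `ζ̄_{ij}` over a rectangle. -/
def zetaDev (μ : Measure Ω) (F : ℕ → Ω → Matrix (Fin k₁) (Fin k₂) ℝ) (e : ℕ → ℕ → ℕ → Ω → ℝ)
    (q : Fin k₁ × Fin k₂) (p n T : ℕ) (ω : Ω) : ℝ :=
  ∑ i ∈ range p, ∑ j ∈ range n,
    (zetaBar F e T i j q ω ^ 2 - ∫ ω', zetaBar F e T i j q ω' ^ 2 ∂μ)

omit [IsProbabilityMeasure μ] in
lemma DependenceAssumption.memLp_mul (hFe : DependenceAssumption μ F e) (T i j l h : ℕ)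
    (q q' : Fin k₁ × Fin k₂) :
    MemLp (fun ω => zetaBar F e T i j q ω * zetaBar F e T l h q' ω) 2 μ :=
  memLp_two_mul (hFe.memLp _ _ _ _) (hFe.memLp _ _ _ _)

lemma DependenceAssumption.integrable_zetaDev_sq (hFe : DependenceAssumption μ F e)
    (q : Fin k₁ × Fin k₂) (p n T : ℕ) : Integrable (fun ω => zetaDev μ F e q p n T ω ^ 2) μ := by
  refine MemLp.integrable_sq ?_
  refine memLp_finsetSum _ fun i _ => memLp_finsetSum _ fun j _ => ?_
  simp only [sq]
  exact (hFe.memLp_mul T i j i j q q).sub (memLp_const _)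

/-- For i < r the row sum Σ_{l < r} A_{il} has second moment at most |c₀| r n, since its expansion
contains exactly the sums bounded by the hypothesis at size r. The sizes r = i + 1 and r = p enter
`sum_diag_eq`, and Cauchy–Schwarz over i costs one more factor p. -/
lemma DependenceAssumption.exists_zetaDev_le (hFe : DependenceAssumption μ F e) :
    ∃ c, 0 ≤ c ∧ ∀ q p n T, ∫ ω, zetaDev μ F e q p n T ω ^ 2 ∂μ ≤ c * ((p : ℝ) ^ 3 * n) := by
  obtain ⟨c₀, hc⟩ := hFe.cov_cols
  refine ⟨10 * |c₀|, by positivity, fun q p n T => ?_⟩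
  set ζ : ℕ → ℕ → Ω → ℝ := fun i j => zetaBar F e T i j q with hζ
  set A : Ω → ℕ → ℕ → ℝ := fun ω i l =>
    ∑ j ∈ range n, (ζ i j ω * ζ l j ω - ∫ ω', ζ i j ω' * ζ l j ω' ∂μ) with hA
  have hL2 : ∀ i l, MemLp (fun ω => A ω i l) 2 μ := fun i l =>
    memLp_finsetSum _ fun j _ => (hFe.memLp_mul T i j l j q q).sub (memLp_const _)
  have hrow : ∀ r i, i < r → ∫ ω, (∑ l ∈ range r, A ω i l) ^ 2 ∂μ ≤ |c₀| * (r * n) := by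
    intro r i hi
    have h1 := integral_sq_sum_eq (μ := μ) (range r ×ˢ range n)
      (Z := fun s ω => ζ i s.2 ω * ζ s.1 s.2 ω) (fun s => hFe.memLp_mul _ _ _ _ _ _ _) fun _ => 1
    simp only [one_mul, Finset.sum_product] at h1
    simp only [hA]
    rw [h1]
    refine (Finset.sum_le_card_nsmul _ _ (n * |c₀|) fun l₁ hl₁ => ?_).trans (le_of_eq ?_)
    · refine (Finset.sum_le_card_nsmul _ _ |c₀| fun j hj => ?_).trans (le_of_eq (by simp))
      refine (le_abs_self _).trans ((hc r n T i l₁ j q q q q hi (mem_range.1 hl₁)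
        (mem_range.1 hj)).trans (le_abs_self _))
    · simp; ring
  have hdiag : ∀ ω, zetaDev μ F e q p n T ω =
      2 * ∑ i ∈ range p, ∑ l ∈ range (i + 1), A ω i l - ∑ i ∈ range p, ∑ l ∈ range p, A ω i l :=
    fun ω => by
    rw [← sum_diag_eq (A ω) (fun i l => by simp only [hA, mul_comm])]
    simp only [zetaDev, hA, hζ, sq]
  have hint : ∀ r i, Integrable (fun ω => (∑ l ∈ range r, A ω i l) ^ 2) μ := fun r i =>
    (memLp_finsetSum _ fun l _ => hL2 i l).integrable_sq
  have hpt : ∀ ω, zetaDev μ F e q p n T ω ^ 2 ≤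
      p * (8 * ∑ i ∈ range p, (∑ l ∈ range (i + 1), A ω i l) ^ 2 +
        2 * ∑ i ∈ range p, (∑ l ∈ range p, A ω i l) ^ 2) := fun ω => by
    have h1 := Finset.sum_mul_sq_le_sq_mul_sq (range p) (fun _ => 1)
      fun i => ∑ l ∈ range (i + 1), A ω i l
    have h2 := Finset.sum_mul_sq_le_sq_mul_sq (range p) (fun _ => 1)
      fun i => ∑ l ∈ range p, A ω i l
    simp only [one_mul, one_pow, Finset.sum_const, card_range, nsmul_eq_mul, mul_one] at h1 h2
    rw [hdiag]
    nlinarith [sq_nonneg (2 * ∑ i ∈ range p, ∑ l ∈ range (i + 1), A ω i l +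
      ∑ i ∈ range p, ∑ l ∈ range p, A ω i l)]
  have hi1 : Integrable (fun ω => ∑ i ∈ range p, (∑ l ∈ range (i + 1), A ω i l) ^ 2) μ :=
    integrable_finsetSum _ fun i _ => hint _ _
  have hi2 : Integrable (fun ω => ∑ i ∈ range p, (∑ l ∈ range p, A ω i l) ^ 2) μ :=
    integrable_finsetSum _ fun i _ => hint _ _
  have hs1 : ∑ i ∈ range p, ∫ ω, (∑ l ∈ range (i + 1), A ω i l) ^ 2 ∂μ ≤
      p * (|c₀| * (p * n)) := by
    refine (Finset.sum_le_card_nsmul _ _ (|c₀| * (p * n)) fun i hi => ?_).trans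
      (le_of_eq (by simp))
    refine (hrow (i + 1) i (by omega)).trans ?_
    have : ((i + 1 : ℕ) : ℝ) ≤ p := by exact_mod_cast mem_range.1 hi
    gcongr
  have hs2 : ∑ i ∈ range p, ∫ ω, (∑ l ∈ range p, A ω i l) ^ 2 ∂μ ≤ p * (|c₀| * (p * n)) :=
    (Finset.sum_le_card_nsmul _ _ (|c₀| * (p * n)) fun i hi =>
      hrow p i (mem_range.1 hi)).trans (le_of_eq (by simp))
  calc ∫ ω, zetaDev μ F e q p n T ω ^ 2 ∂μ ≤
        ∫ ω, p * (8 * ∑ i ∈ range p, (∑ l ∈ range (i + 1), A ω i l) ^ 2 +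
          2 * ∑ i ∈ range p, (∑ l ∈ range p, A ω i l) ^ 2) ∂μ :=
        integral_mono (hFe.integrable_zetaDev_sq q p n T)
          (((hi1.const_mul 8).add (hi2.const_mul 2)).const_mul p) hpt
    _ = p * (8 * ∑ i ∈ range p, ∫ ω, (∑ l ∈ range (i + 1), A ω i l) ^ 2 ∂μ +
          2 * ∑ i ∈ range p, ∫ ω, (∑ l ∈ range p, A ω i l) ^ 2 ∂μ) := by
        rw [integral_const_mul, integral_add (hi1.const_mul 8) (hi2.const_mul 2),
          integral_const_mul, integral_const_mul, integral_finsetSum _ fun i _ => hint _ _,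
          integral_finsetSum _ fun i _ => hint _ _]
    _ ≤ p * (8 * (p * (|c₀| * (p * n))) + 2 * (p * (|c₀| * (p * n)))) := by gcongr
    _ = _ := by ring

end Interaction

/-! ### Interactions of one factor with all errors -/

/-- A matrix and its transpose have the same norm, and here the transpose acts on the single vector
f. -/
lemma sum_sq_sum_mul_le {x : ℕ → ℕ → ℝ} {n : ℕ} {I : Finset ℕ} {lam : ℝ} (h0 : 0 ≤ lam)
    (h : ∀ w : ℕ → ℝ, ∑ t ∈ I, (∑ j ∈ range n, w j * x j t) ^ 2 ≤ lam * ∑ j ∈ range n, w j ^ 2)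
    (f : ℕ → ℝ) :
    ∑ j ∈ range n, (∑ t ∈ I, f t * x j t) ^ 2 ≤ (∑ t ∈ I, f t ^ 2) * lam := by
  set y : ℕ → ℝ := fun j => ∑ t ∈ I, f t * x j t with hy
  set Y := ∑ j ∈ range n, y j ^ 2 with hY
  have h1 : Y = ∑ t ∈ I, f t * ∑ j ∈ range n, y j * x j t := by
    simp only [hY, Finset.mul_sum]
    rw [Finset.sum_comm]
    refine Finset.sum_congr rfl fun j _ => ?_
    rw [sq]
    nth_rewrite 2 [hy]
    rw [Finset.mul_sum]
    exact Finset.sum_congr rfl fun t _ => by ring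
  have h2 := Finset.sum_mul_sq_le_sq_mul_sq I f fun t => ∑ j ∈ range n, y j * x j t
  rw [← h1] at h2
  have hS : 0 ≤ ∑ t ∈ I, f t ^ 2 := Finset.sum_nonneg fun _ _ => sq_nonneg _
  have h3 : Y ^ 2 ≤ (∑ t ∈ I, f t ^ 2) * lam * Y := by
    rw [mul_assoc]; exact h2.trans (mul_le_mul_of_nonneg_left (h y) hS)
  have hY0 : 0 ≤ Y := Finset.sum_nonneg fun _ _ => sq_nonneg _
  rcases hY0.eq_or_lt with h4 | h4
  · rw [← h4]; positivity
  · nlinarith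

/-- Here u and x stand for √N and the root of the weight. In the expanded product w ≤ N is used,
except in the term with w M, where only w M ≤ N P gives the right order. -/
lemma window_product_le {P M N u x w : ℝ} (L : ℝ) (hP : 1 ≤ P)
    (hN : u * u = N) (hu : 1 ≤ u) (hx : 1 ≤ x) (hw : 0 ≤ w) (hwN : w ≤ N) (hwM : w * M ≤ N * P) :
    (L * w + L * (u * x)) * (L * (P * w) + L * (P * M * (u * x))) ≤
      L ^ 2 * (x * x) * (2 * (N ^ 2 * P) + N * P * M + u * N * P ^ 2) := by
  have hxx : x ≤ x * x := by nlinarith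
  have hxx1 : 1 ≤ x * x := by nlinarith
  have huN : u ≤ N := by nlinarith
  have hN0 : 0 ≤ N := by linarith
  have a1 : w * w * P ≤ N * N * P * (x * x) := by
    have : w * w * P ≤ N * N * P := by gcongr
    have : N * N * P * 1 ≤ N * N * P * (x * x) := by gcongr
    linarith
  have a2 : (w * M) * P * u * x ≤ (N * P) * P * u * (x * x) := by gcongr
  have a3 : w * u * P * x ≤ N * N * P * (x * x) := by gcongr
  calc _ = L ^ 2 * (w * w * P + (w * M) * P * u * x + w * u * P * x +
        (u * u) * P * M * (x * x)) := by ring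
    _ ≤ L ^ 2 * (N * N * P * (x * x) + (N * P) * P * u * (x * x) +
        N * N * P * (x * x) + (u * u) * P * M * (x * x)) := by gcongr
    _ = _ := by rw [hN]; ring

section

variable {Ω : Type*} [MeasurableSpace Ω] {μ : Measure Ω} [IsProbabilityMeasure μ] {k₁ k₂ : ℕ}
  {F : ℕ → Ω → Matrix (Fin k₁) (Fin k₂) ℝ} {e : ℕ → ℕ → ℕ → Ω → ℝ}

/-- The sum over rows and columns of the squared interactions of one factor with the errors. -/
def interSq (F : ℕ → Ω → Matrix (Fin k₁) (Fin k₂) ℝ) (e : ℕ → ℕ → ℕ → Ω → ℝ)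
    (q : Fin k₁ × Fin k₂) (p n : ℕ) (I : Finset ℕ) (ω : Ω) : ℝ :=
  ∑ i ∈ range p, ∑ j ∈ range n, (∑ t ∈ I, F t ω q.1 q.2 * e i j t ω) ^ 2

omit [MeasurableSpace Ω] in
lemma interSq_mono {q : Fin k₁ × Fin k₂} {p p' n n' : ℕ} (hp : p ≤ p') (hn : n ≤ n')
    (I : Finset ℕ) (ω : Ω) : interSq F e q p n I ω ≤ interSq F e q p' n' I ω := by
  unfold interSq
  refine (Finset.sum_le_sum fun i _ => Finset.sum_le_sum_of_subset_of_nonneg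
    (range_subset_range.2 hn) fun _ _ _ => sq_nonneg _).trans ?_
  exact Finset.sum_le_sum_of_subset_of_nonneg (range_subset_range.2 hp) fun _ _ _ =>
    Finset.sum_nonneg fun _ _ => sq_nonneg _

omit [MeasurableSpace Ω] in
lemma interSq_range_le {q : Fin k₁ × Fin k₂} {p n : ℕ} {s T : ℕ} (h : s ≤ T) (ω : Ω) :
    interSq F e q p n (range T) ω ≤
      2 * interSq F e q p n (range s) ω + 2 * interSq F e q p n (Ico s T) ω := by
  unfold interSq
  simp only [Finset.mul_sum, ← Finset.sum_add_distrib]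
  refine Finset.sum_le_sum fun i _ => Finset.sum_le_sum fun j _ => ?_
  rw [← Finset.sum_range_add_sum_Ico _ h]
  nlinarith [sq_nonneg (∑ t ∈ range s, F t ω q.1 q.2 * e i j t ω -
    ∑ t ∈ Ico s T, F t ω q.1 q.2 * e i j t ω)]

omit [IsProbabilityMeasure μ] in
-- At a fixed time the interactions are T times the sum of the ζ̄², that is, mean plus centred part.
lemma interSq_range_eq {c : ℝ} {q : Fin k₁ × Fin k₂}
    (hc : ∀ T i j, ∫ ω, zetaBar F e T i j q ω ^ 2 ∂μ ≤ c) (p n T : ℕ) (ω : Ω) :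
    interSq F e q p n (range T) ω ≤ T * (zetaDev μ F e q p n T ω + c * (p * n)) := by
  rcases Nat.eq_zero_or_pos T with rfl | hT
  · simp [interSq]
  · have h1 : interSq F e q p n (range T) ω =
        T * ∑ i ∈ range p, ∑ j ∈ range n, zetaBar F e T i j q ω ^ 2 := by
      simp only [interSq, Finset.mul_sum]
      refine Finset.sum_congr rfl fun i _ => Finset.sum_congr rfl fun j _ => ?_
      have : (T : ℝ) ≠ 0 := by positivity
      rw [zetaBar, div_pow, Real.sq_sqrt (Nat.cast_nonneg _)]
      field_simp
    rw [h1]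
    refine mul_le_mul_of_nonneg_left ?_ (Nat.cast_nonneg _)
    rw [← sub_le_iff_le_add, ← sub_nonneg]
    have h2 : ∑ i ∈ range p, ∑ j ∈ range n, ∫ ω, zetaBar F e T i j q ω ^ 2 ∂μ ≤ c * (p * n) := by
      refine (Finset.sum_le_card_nsmul _ _ (n * c) fun i _ =>
        (Finset.sum_le_card_nsmul _ _ c fun j _ => hc T i j).trans (le_of_eq (by simp))).trans
        (le_of_eq ?_)
      simp; ring
    simp only [zetaDev, Finset.sum_sub_distrib]
    linarith

omit [IsProbabilityMeasure μ] in
-- Row by row, Cauchy–Schwarz against the factor on the window leaves the norm of the n × w matrix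
-- (e_{ij,t})_{j,t}; the roots of the fluctuations are then added over i by Cauchy–Schwarz.
lemma interSq_Ico_le {c : ℝ} (h : WeakDep μ e c) (q : Fin k₁ × Fin k₂) (p n s w T : ℕ)
    (hT : T ≤ s + w) (ω : Ω) :
    interSq F e q p n (Ico s T) ω ≤ (∑ t ∈ Ico s T, F t ω q.1 q.2 ^ 2) *
      (c * (p * w) + √(p * ∑ i ∈ range p,
        rowFl μ (fun i j t => e j i t) n {i} (Ico s (s + w)) ω)) := by
  have hc := h.nonneg
  set Φ : ℕ → ℝ := fun i => rowFl μ (fun i j t => e j i t) n {i} (Ico s (s + w)) ω with hΦ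
  have hΦ0 : ∀ i, 0 ≤ Φ i := fun i => rowFl_nonneg _ _ _ _
  have h1 : ∀ i, ∑ j ∈ range n, (∑ t ∈ Ico s T, F t ω q.1 q.2 * e i j t ω) ^ 2 ≤
      (∑ t ∈ Ico s T, F t ω q.1 q.2 ^ 2) * (c * w + √(Φ i)) := fun i => by
    refine sum_sq_sum_mul_le (x := fun j t => e i j t ω) (by positivity) (fun v => ?_)
      fun t => F t ω q.1 q.2
    have := ((h.swap.rowOn n {i} (Ico s (s + w)) ω).mono le_rfl subset_rfl
      (Finset.Ico_subset_Ico_right hT) le_rfl) v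
    simpa [hΦ] using this
  have h2 : ∑ i ∈ range p, √(Φ i) ≤ √(p * ∑ i ∈ range p, Φ i) := by
    refine Real.le_sqrt_of_sq_le ?_
    have := Finset.sum_mul_sq_le_sq_mul_sq (range p) (fun _ => 1) fun i => √(Φ i)
    simpa [Real.sq_sqrt (hΦ0 _)] using this
  unfold interSq
  refine (Finset.sum_le_sum fun i _ => h1 i).trans ?_
  rw [← Finset.mul_sum]
  refine mul_le_mul_of_nonneg_left ?_ (Finset.sum_nonneg fun _ _ => sq_nonneg _)
  rw [Finset.sum_add_distrib]
  refine add_le_add (le_of_eq ?_) h2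
  simp; ring

/-- The exponent of the number of windows into which a dyadic time range is cut. -/
def winExp (d : ℕ × ℕ × ℕ) : ℕ := min d.2.2 (d.2.1 - d.1)

/-- The length of these windows. -/
def winLen (d : ℕ × ℕ × ℕ) : ℕ := 2 ^ (d.2.2 - winExp d)

lemma winExp_mul_winLen (d : ℕ × ℕ × ℕ) : 2 ^ winExp d * winLen d = 2 ^ d.2.2 := by
  rw [winLen, ← pow_add, Nat.add_sub_cancel' (show winExp d ≤ d.2.2 from min_le_left _ _)]

lemma winLen_le (d : ℕ × ℕ × ℕ) : winLen d ≤ 2 ^ d.2.2 :=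
  Nat.pow_le_pow_right (by norm_num) (Nat.sub_le _ _)

/-- Unless the windows are single time points, the number of windows is the larger of 1 and 2^(d.2.1
- d.1), which keeps the windows short against N P / M. -/
lemma winLen_mul_le (d : ℕ × ℕ × ℕ) (h : winLen d ≠ 1) :
    winLen d * 2 ^ d.2.1 ≤ 2 ^ d.2.2 * 2 ^ d.1 := by
  have h1 : winExp d = d.2.1 - d.1 := by
    unfold winExp
    by_contra h2
    refine h ?_
    have : winExp d = d.2.2 := by unfold winExp; omega
    simp [winLen, this]
  rw [winLen, ← pow_add, ← pow_add]
  refine Nat.pow_le_pow_right (by norm_num) ?_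
  have : winExp d ≤ d.2.2 := min_le_left _ _
  omega

/-- Only the interior grid points are counted; there are none when there is a single window, and
this covers the case of more rows than columns. -/
lemma winExp_grid_le (d : ℕ × ℕ × ℕ) :
    ((2 : ℝ) ^ winExp d - 1) * (2 ^ d.1) ≤ 2 ^ d.2.1 := by
  rcases Nat.eq_zero_or_pos (winExp d) with h | h
  · rw [h]; simp
  · have h1 : winExp d ≤ d.2.1 - d.1 := min_le_right _ _
    have : (2 : ℝ) ^ winExp d * 2 ^ d.1 ≤ 2 ^ d.2.1 := by
      rw [← pow_add]
      exact pow_le_pow_right₀ (by norm_num) (by omega)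
    have h2 : (0 : ℝ) < 2 ^ d.1 := by positivity
    linarith

/-- Each grid point costs a moment of order P³ M, and there are at most M / P of them. All of them
together stay at (P M)², the square of the order of the mean. -/
lemma DependenceAssumption.ae_zetaDev (hFe : DependenceAssumption μ F e) {θ : ℝ} (hθ : 0 < θ)
    (q : Fin k₁ × Fin k₂) : ∀ᵐ ω ∂μ, ∃ K, 0 ≤ K ∧ ∀ (d : ℕ × ℕ × ℕ) (k : ℕ), 0 < k →
      k < 2 ^ winExp d → zetaDev μ F e q (2 ^ d.1) (2 ^ d.2.1) (k * winLen d) ω ^ 2 ≤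
        K * (((2 : ℝ) ^ d.1 * 2 ^ d.2.1) ^ 2 * wt θ d) := by
  obtain ⟨c, hc0, hc⟩ := hFe.exists_zetaDev_le
  have h := ae_le_wt (μ := μ) hθ (Φ := fun d ω => ∑ k ∈ Ico 1 (2 ^ winExp d),
      zetaDev μ F e q (2 ^ d.1) (2 ^ d.2.1) (k * winLen d) ω ^ 2)
    (fun d ω => Finset.sum_nonneg fun _ _ => sq_nonneg _)
    (fun d => integrable_finsetSum _ fun k _ => hFe.integrable_zetaDev_sq _ _ _ _)
    (B := fun d => ((2 : ℝ) ^ d.1 * 2 ^ d.2.1) ^ 2) (fun d => by positivity) (c := c) fun d => by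
      rw [integral_finsetSum _ fun k _ => hFe.integrable_zetaDev_sq _ _ _ _]
      refine (Finset.sum_le_card_nsmul _ _ _ fun k _ => hc q _ _ _).trans ?_
      have h1 := winExp_grid_le d
      rw [Nat.card_Ico, nsmul_eq_mul, Nat.cast_sub Nat.one_le_two_pow]
      push_cast
      have h2 : (1 : ℝ) ≤ 2 ^ d.1 := one_le_pow₀ (by norm_num)
      have h4 : ((2 : ℝ) ^ winExp d - 1) * 2 ^ d.1 * (c * ((2 ^ d.1) ^ 2 * 2 ^ d.2.1)) ≤
          2 ^ d.2.1 * (c * ((2 ^ d.1) ^ 2 * 2 ^ d.2.1)) := by gcongr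
      linarith
  filter_upwards [h] with ω ⟨K, hK, hω⟩
  refine ⟨K, hK, fun d k hk hk' => le_trans ?_ (hω d)⟩
  exact Finset.single_le_sum (f := fun k => zetaDev μ F e q (2 ^ d.1) (2 ^ d.2.1)
    (k * winLen d) ω ^ 2) (fun _ _ => sq_nonneg _) (Finset.mem_Ico.2 ⟨hk, hk'⟩)

/-- Moments are linear in the window length, so the sum over all windows and rows does not depend on
their number: P M² times the full length N. -/
lemma WeakDep.ae_window {c : ℝ} (h : WeakDep μ e c) {θ : ℝ} (hθ : 0 < θ) :
    ∀ᵐ ω ∂μ, ∃ K, 0 ≤ K ∧ ∀ (d : ℕ × ℕ × ℕ) (k : ℕ), k < 2 ^ winExp d →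
      ∑ i ∈ range (2 ^ d.1), rowFl μ (fun i j t => e j i t) (2 ^ d.2.1) {i}
        (Ico (k * winLen d) (k * winLen d + winLen d)) ω ≤
        K * (((2 : ℝ) ^ d.1 * (2 ^ d.2.1) ^ 2 * 2 ^ d.2.2) * wt θ d) := by
  have h1 := ae_le_wt (μ := μ) hθ (Φ := fun d ω => ∑ k ∈ range (2 ^ winExp d),
      ∑ i ∈ range (2 ^ d.1), rowFl μ (fun i j t => e j i t) (2 ^ d.2.1) {i}
        (Ico (k * winLen d) (k * winLen d + winLen d)) ω)
    (fun d ω => Finset.sum_nonneg fun _ _ => Finset.sum_nonneg fun _ _ => rowFl_nonneg _ _ _ _)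
    (fun d => integrable_finsetSum _ fun k _ => integrable_finsetSum _ fun i _ =>
      h.swap.integrable_rowFl _ _ _)
    (B := fun d => (2 : ℝ) ^ d.1 * (2 ^ d.2.1) ^ 2 * 2 ^ d.2.2) (fun d => by positivity) (c := c)
    fun d => by
      rw [integral_finsetSum _ fun k _ => integrable_finsetSum _ fun i _ =>
        h.swap.integrable_rowFl _ _ _]
      have h2 : ∀ k, ∫ ω, ∑ i ∈ range (2 ^ d.1), rowFl μ (fun i j t => e j i t) (2 ^ d.2.1) {i}
          (Ico (k * winLen d) (k * winLen d + winLen d)) ω ∂μ ≤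
          2 ^ d.1 * (c * ((2 ^ d.2.1) ^ 2 * winLen d)) := fun k => by
        rw [integral_finsetSum _ fun i _ => h.swap.integrable_rowFl _ _ _]
        refine (Finset.sum_le_card_nsmul _ _ (c * ((2 ^ d.2.1) ^ 2 * winLen d)) fun i _ =>
          ?_).trans (le_of_eq (by simp))
        simpa using h.swap.integral_rowFl_le (2 ^ d.2.1) {i}
          (Ico (k * winLen d) (k * winLen d + winLen d))
      refine (Finset.sum_le_card_nsmul _ _ _ fun k _ => h2 k).trans (le_of_eq ?_)
      have h3 : ((2 : ℝ) ^ winExp d) * winLen d = 2 ^ d.2.2 := by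
        exact_mod_cast winExp_mul_winLen d
      simp only [card_range, nsmul_eq_mul, Nat.cast_pow, Nat.cast_ofNat]
      rw [← h3]; ring
  filter_upwards [h1] with ω ⟨K, hK, hω⟩
  refine ⟨K, hK, fun d k hk => le_trans ?_ (hω d)⟩
  exact Finset.single_le_sum (f := fun k => ∑ i ∈ range (2 ^ d.1),
    rowFl μ (fun i j t => e j i t) (2 ^ d.2.1) {i}
      (Ico (k * winLen d) (k * winLen d + winLen d)) ω)
    (fun _ _ => Finset.sum_nonneg fun _ _ => rowFl_nonneg _ _ _ _) (mem_range.2 hk)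

/-- A window sum is the difference of two partial sums, both of them covered by the maximal
inequality, plus the second moments over the window. -/
lemma FactorAssumption.ae_window (hF : FactorAssumption μ F) {θ : ℝ} (hθ : 0 < θ)
    (q : Fin k₁ × Fin k₂) : ∃ c, 0 ≤ c ∧ ∀ᵐ ω ∂μ, ∃ K, 0 ≤ K ∧ ∀ (d : ℕ × ℕ × ℕ) (s w T : ℕ),
      s ≤ T → T ≤ s + w → T ≤ 2 ^ d.2.2 →
      ∑ t ∈ Ico s T, F t ω q.1 q.2 ^ 2 ≤ c * w + K * (√(2 ^ d.2.2) * √(wt θ d)) := by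
  obtain ⟨c, hc⟩ := hF.exists_moment
  refine ⟨|c|, abs_nonneg _, ?_⟩
  filter_upwards [hF.ae_sum_sq hθ q.1 q.2] with ω ⟨K, hK, hω⟩
  refine ⟨2 * √K, by positivity, fun d s w T hs hT hN => ?_⟩
  have hW := (wt_pos θ d).le
  have h1 : ∀ τ ≤ 2 ^ d.2.2,
      |∑ t ∈ range τ, (F t ω q.1 q.2 ^ 2 - ∫ ω', F t ω' q.1 q.2 ^ 2 ∂μ)| ≤
        √K * (√(2 ^ d.2.2) * √(wt θ d)) := fun τ hτ => by
    refine abs_le_of_sq_le_sq ((hω d τ hτ).trans (le_of_eq ?_)) (by positivity)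
    rw [mul_pow, mul_pow, Real.sq_sqrt hK, Real.sq_sqrt (by positivity), Real.sq_sqrt hW]
  have h2 := Finset.sum_range_add_sum_Ico
    (fun t => F t ω q.1 q.2 ^ 2 - ∫ ω', F t ω' q.1 q.2 ^ 2 ∂μ) hs
  have h3 := abs_le.1 (h1 T hN)
  have h4 := abs_le.1 (h1 s (hs.trans hN))
  have h5 : ∑ t ∈ Ico s T, ∫ ω', F t ω' q.1 q.2 ^ 2 ∂μ ≤ |c| * w := by
    refine (Finset.sum_le_card_nsmul _ _ |c| fun t _ =>
      (hc t q.1 q.2).2.trans (le_abs_self _)).trans ?_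
    rw [Nat.card_Ico, nsmul_eq_mul, mul_comm]
    have : ((T - s : ℕ) : ℝ) ≤ w := by exact_mod_cast (by omega : T - s ≤ w)
    gcongr
  have h6 := Finset.sum_sub_distrib (s := Ico s T) (fun t => F t ω q.1 q.2 ^ 2)
    fun t => ∫ ω', F t ω' q.1 q.2 ^ 2 ∂μ
  linarith [h3.1, h3.2, h4.1, h4.2]

set_option maxHeartbeats 1000000 in
/-- The interactions of one factor with the errors, at every size. -/
lemma DependenceAssumption.ae_interSq (hFe : DependenceAssumption μ F e)
    (hF : FactorAssumption μ F) (he : ErrorAssumption μ e) {θ : ℝ} (hθ : 0 < θ)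
    (q : Fin k₁ × Fin k₂) : ∀ᵐ ω ∂μ, ∃ K, 0 ≤ K ∧ ∀ p₁ p₂ T : ℕ, 0 < p₁ → 0 < p₂ → 0 < T →
      interSq F e q p₁ p₂ (range T) ω ≤ K * (dwt θ p₁ p₂ T *
        ((T : ℝ) ^ 2 * p₁ + T * p₁ * p₂ + (p₁ : ℝ) ^ 2 * (T * √T * √p₂))) := by
  obtain ⟨c₁, h₁⟩ := hFe.exists_second_moment hF he
  obtain ⟨c₂, h₂⟩ := he.exists_weakDep
  obtain ⟨c₃, hc₃, h₃⟩ := hF.ae_window hθ q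
  filter_upwards [hFe.ae_zetaDev hθ q, h₂.ae_window hθ, h₃] with ω ⟨K₁, hK₁, ha⟩ ⟨K₂, hK₂, hb⟩
    ⟨K₃, hK₃, hc⟩
  have hc₂ := h₂.nonneg
  set L := |c₁| + √K₁ + c₂ + √K₂ + c₃ + K₃ with hL
  have hL0 : 0 ≤ L := by positivity
  have s1 := Real.sqrt_nonneg K₁
  have s2 := Real.sqrt_nonneg K₂
  have hLc₁ : c₁ ≤ L := by linarith [le_abs_self c₁]
  have hLk₁ : √K₁ ≤ L := by linarith [abs_nonneg c₁]
  have hLc₂ : c₂ ≤ L := by linarith [abs_nonneg c₁]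
  have hLk₂ : √K₂ ≤ L := by linarith [abs_nonneg c₁]
  have hLc₃ : c₃ ≤ L := by linarith [abs_nonneg c₁]
  have hLk₃ : K₃ ≤ L := by linarith [abs_nonneg c₁]
  refine ⟨128 * (L + L ^ 2), by positivity, fun p₁ p₂ T hp₁ hp₂ hT => ?_⟩
  set d : ℕ × ℕ × ℕ := (dy p₁, dy p₂, dy T) with hd
  set P : ℝ := 2 ^ dy p₁ with hP
  set M : ℝ := 2 ^ dy p₂ with hM
  set N : ℝ := 2 ^ dy T with hN
  set W : ℝ := wt θ d with hW
  have hW1 : 1 ≤ √W := Real.one_le_sqrt.2 (one_le_wt hθ d)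
  have hWs : √W * √W = W := Real.mul_self_sqrt (wt_pos θ d).le
  have hP1 : 1 ≤ P := one_le_pow₀ (by norm_num)
  have hN1 : 1 ≤ N := one_le_pow₀ (by norm_num)
  have hNs : √N * √N = N := Real.mul_self_sqrt (by positivity)
  have hN1' : 1 ≤ √N := Real.one_le_sqrt.2 hN1
  set w := winLen d with hw
  have hw0 : 0 < w := by rw [hw, winLen]; positivity
  -- The last grid point before T is k w; the sum up to it and the sum over the remaining window are
  -- treated separately.
  set k := T / w with hk
  have hkT : k * w ≤ T := Nat.div_mul_le_self T w
  have hTk : T < k * w + w := by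
    have := Nat.lt_div_mul_add (a := T) hw0
    simpa [hk] using this
  have hkG : k < 2 ^ winExp d := by
    rw [hk, Nat.div_lt_iff_lt_mul hw0, winExp_mul_winLen]
    exact lt_two_pow_dy T
  have hTN : T ≤ 2 ^ d.2.2 := (lt_two_pow_dy T).le
  have hA : interSq F e q (2 ^ dy p₁) (2 ^ dy p₂) (range (k * w)) ω ≤ 2 * L * √W * (N * P * M) := by
    rcases Nat.eq_zero_or_pos k with h0 | h0
    · have : interSq F e q (2 ^ dy p₁) (2 ^ dy p₂) (range (k * w)) ω = 0 := by simp [h0, interSq]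
      rw [this]; positivity
    · have e1 := interSq_range_eq (F := F) (e := e) (fun T i j => h₁ T i j q) (2 ^ dy p₁)
        (2 ^ dy p₂) (k * w) ω
      have e2 : zetaDev μ F e q (2 ^ dy p₁) (2 ^ dy p₂) (k * w) ω ≤ √K₁ * (P * M * √W) := by
        refine le_of_abs_le (abs_le_of_sq_le_sq ((ha d k h0 hkG).trans (le_of_eq ?_))
          (by positivity))
        rw [mul_pow (√K₁), mul_pow (P * M), Real.sq_sqrt hK₁, Real.sq_sqrt (wt_pos θ d).le]
      have e3 : ((k * w : ℕ) : ℝ) ≤ N := by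
        have : k * w ≤ 2 ^ dy T := hkT.trans hTN
        rw [hN]
        exact_mod_cast this
      push_cast at e1 e3
      calc _ ≤ _ := e1
        _ ≤ (k * w) * (L * (P * M * √W) + L * √W * (P * M)) := by
            have : c₁ * (P * M) ≤ L * √W * (P * M) := by
              refine mul_le_mul_of_nonneg_right ?_ (by positivity)
              nlinarith
            have : √K₁ * (P * M * √W) ≤ L * (P * M * √W) := by gcongr
            gcongr
            linarith
        _ ≤ N * (L * (P * M * √W) + L * √W * (P * M)) := by gcongr
        _ = _ := by ring
  have hB : interSq F e q (2 ^ dy p₁) (2 ^ dy p₂) (Ico (k * w) T) ω ≤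
      L ^ 2 * W * (2 * (N ^ 2 * P) + N * P * M + √N * N * P ^ 2) := by
    -- With windows of length one every time is a grid point and nothing remains. Otherwise w M ≤ N
    -- P is available.
    by_cases h1 : w = 1
    · have : Ico (k * w) T = ∅ := by
        rw [Finset.Ico_eq_empty_iff]; simp [hk, h1]
      rw [this]
      have : interSq F e q (2 ^ dy p₁) (2 ^ dy p₂) ∅ ω = 0 := by simp [interSq]
      rw [this]
      have := (wt_pos θ d).le
      positivity
    · have e1 := interSq_Ico_le (F := F) h₂ q (2 ^ dy p₁) (2 ^ dy p₂) (k * w) w T hTk.le ω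
      have e2 := hc d (k * w) w T hkT hTk.le hTN
      have e3 := hb d k hkG
      have e4 : √(((2 ^ dy p₁ : ℕ) : ℝ) * ∑ i ∈ range (2 ^ dy p₁),
          rowFl μ (fun i j t => e j i t) (2 ^ dy p₂) {i} (Ico (k * w) (k * w + w)) ω) ≤
          √K₂ * (P * M * (√N * √W)) := by
        refine Real.sqrt_le_iff.2 ⟨by positivity, ?_⟩
        refine (mul_le_mul_of_nonneg_left e3 (Nat.cast_nonneg _)).trans (le_of_eq ?_)
        simp only [mul_pow]
        rw [Real.sq_sqrt hK₂, Real.sq_sqrt (wt_pos θ d).le, Real.sq_sqrt (by positivity)]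
        push_cast
        ring
      have hwN : (w : ℝ) ≤ N := by
        rw [hN]; exact_mod_cast winLen_le d
      have hwM : (w : ℝ) * M ≤ N * P := by
        rw [hN, hM, hP]; exact_mod_cast winLen_mul_le d h1
      have hS : 0 ≤ ∑ t ∈ Ico (k * w) T, F t ω q.1 q.2 ^ 2 :=
        Finset.sum_nonneg fun _ _ => sq_nonneg _
      have hwp : (0 : ℝ) ≤ w := Nat.cast_nonneg w
      calc _ ≤ _ := e1
        _ ≤ (L * w + L * (√N * √W)) * (L * (P * w) + L * (P * M * (√N * √W))) := by
            refine mul_le_mul (e2.trans ?_) (add_le_add ?_ (e4.trans ?_)) (by positivity)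
              (by positivity)
            · change c₃ * w + K₃ * (√N * √W) ≤ _
              gcongr
            · push_cast
              change c₂ * (P * w) ≤ _
              gcongr
            · gcongr
        _ ≤ _ := by
            have := window_product_le L hP1 hNs hN1' hW1 hwp hwN hwM
            rwa [hWs] at this
  have hX : interSq F e q p₁ p₂ (range T) ω ≤ 4 * (L + L ^ 2) * W *
      (N ^ 2 * P + N * P * M + √N * N * P ^ 2) := by
    refine ((interSq_mono (lt_two_pow_dy p₁).le (lt_two_pow_dy p₂).le _ ω).trans
      (interSq_range_le hkT ω)).trans ?_
    have : √W ≤ W := by nlinarith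
    have a1 : 2 * L * √W * (N * P * M) ≤ 2 * L * W * (N * P * M) := by gcongr
    have hWp := (wt_pos θ d).le
    have b1 : 0 ≤ L * W * (N ^ 2 * P + √N * N * P ^ 2) := by positivity
    have b2 : 0 ≤ L ^ 2 * W * (N * P * M + √N * N * P ^ 2) := by positivity
    linarith
  have hP2 : P ≤ 2 * p₁ := two_pow_dy_le_cast hp₁
  have hM2 : M ≤ 2 * p₂ := two_pow_dy_le_cast hp₂
  have hN2 : N ≤ 2 * T := two_pow_dy_le_cast hT
  have hN3 : √N ≤ 2 * √T := by
    rw [show (2 : ℝ) = √4 by rw [show (4 : ℝ) = 2 ^ 2 by norm_num]; simp,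
      ← Real.sqrt_mul (by norm_num)]
    refine Real.sqrt_le_sqrt (hN2.trans ?_)
    linarith [Nat.cast_nonneg (α := ℝ) T]
  have hp2 : 1 ≤ √(p₂ : ℝ) := Real.one_le_sqrt.2 (by exact_mod_cast hp₂)
  have hWp := (wt_pos θ d).le
  refine hX.trans ?_
  change _ ≤ 128 * (L + L ^ 2) * (W * _)
  calc _ ≤ 4 * (L + L ^ 2) * W * ((2 * T) ^ 2 * (2 * p₁) + (2 * T) * (2 * p₁) * (2 * p₂) +
        2 * √T * (2 * T) * (2 * p₁) ^ 2 * √p₂) := by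
        -- The factor √p₂ is given away, since the target rate p₁ / √(T p₂) allows it.
        have : √N * N * P ^ 2 ≤ 2 * √T * (2 * T) * (2 * p₁) ^ 2 * √p₂ :=
          calc √N * N * P ^ 2 ≤ 2 * √T * (2 * T) * (2 * p₁) ^ 2 := by gcongr
            _ ≤ _ := le_mul_of_one_le_right (by positivity) hp2
        gcongr
    _ ≤ _ := by
        have h5 : 0 ≤ (L + L ^ 2) * W * ((T : ℝ) ^ 2 * p₁) := by positivity
        have h6 : 0 ≤ (L + L ^ 2) * W * ((T : ℝ) * p₁ * p₂) := by positivity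
        have h7 : 0 ≤ (L + L ^ 2) * W * ((p₁ : ℝ) ^ 2 * (T * √T * √p₂)) := by positivity
        linarith

end

/-! ### Loadings and factor covariances of large size -/

lemma abs_dot_mulVec_le_frobenius {n : ℕ} (A : Matrix (Fin n) (Fin n) ℝ) (v : Fin n → ℝ) :
    |v ⬝ᵥ A *ᵥ v| ≤ √(∑ i, ∑ j, A i j ^ 2) * nsq v := by
  have h0 : 0 ≤ ∑ i, ∑ j, A i j ^ 2 := by positivity
  have hv := nsq_nonneg v
  refine abs_le_of_sq_le_sq ?_ (by positivity)
  rw [mul_pow, Real.sq_sqrt h0]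
  refine (dot_sq_le _ _).trans ?_
  have := mul_le_mul_of_nonneg_left (nsq_mulVec_le_frobenius A v) hv
  linarith

lemma LoadingAssumption.eventually_gram {k : ℕ} {L : ℕ → Fin k → ℝ} (h : LoadingAssumption L)
    {δ : ℝ} (hδ : 0 < δ) : ∀ᶠ p : ℕ in atTop, ∀ y,
      (1 - δ) * p * nsq y ≤ nsq (loadingMat L p *ᵥ y) ∧
        nsq (loadingMat L p *ᵥ y) ≤ (1 + δ) * p * nsq y := by
  filter_upwards [h.gram.eventually (gt_mem_nhds hδ), eventually_gt_atTop 0] with p hp hp0 y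
  set D := (p : ℝ)⁻¹ • ((loadingMat L p).transpose * loadingMat L p) - 1 with hD
  have hp' : (0 : ℝ) < p := by exact_mod_cast hp0
  have hy := nsq_nonneg y
  have h1 : y ⬝ᵥ D *ᵥ y = (p : ℝ)⁻¹ * nsq (loadingMat L p *ᵥ y) - nsq y := by
    rw [hD, sub_mulVec, one_mulVec, dotProduct_sub, smul_mulVec, dotProduct_smul, ← mulVec_mulVec,
      dot_mulVec_eq, transpose_transpose]
    rfl
  have h2 : |y ⬝ᵥ D *ᵥ y| ≤ δ * nsq y := by
    refine abs_le_of_sq_le_sq ?_ (by positivity)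
    refine (dot_sq_le _ _).trans ?_
    have h3 := nsq_mulVec_le_specNorm D y
    have h4 := specNorm_nonneg D
    have h5 : specNorm D ^ 2 ≤ δ ^ 2 := by gcongr
    calc nsq y * nsq (D *ᵥ y) ≤ nsq y * (δ ^ 2 * nsq y) := by
          gcongr; exact h3.trans (by gcongr)
      _ = _ := by ring
  rw [h1, abs_le] at h2
  have h3 : nsq (loadingMat L p *ᵥ y) = p * ((p : ℝ)⁻¹ * nsq (loadingMat L p *ᵥ y)) := by
    field_simp
  rw [h3]
  constructor
  · have := mul_le_mul_of_nonneg_left (by linarith [h2.1] :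
      (1 - δ) * nsq y ≤ (p : ℝ)⁻¹ * nsq (loadingMat L p *ᵥ y)) hp'.le
    linarith
  · have := mul_le_mul_of_nonneg_left (by linarith [h2.2] :
      (p : ℝ)⁻¹ * nsq (loadingMat L p *ᵥ y) ≤ (1 + δ) * nsq y) hp'.le
    linarith

lemma eventually_sum_nsq_close {k m : ℕ} {G : ℕ → Matrix (Fin k) (Fin m) ℝ}
    {S : Matrix (Fin k) (Fin k) ℝ}
    (h : Tendsto (fun T : ℕ => (T : ℝ)⁻¹ • ∑ t ∈ range T, G t * (G t)ᵀ) atTop (𝓝 S))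
    {δ : ℝ} (hδ : 0 < δ) : ∀ᶠ T : ℕ in atTop, ∀ y,
      |∑ t ∈ range T, nsq ((G t)ᵀ *ᵥ y) - T * (y ⬝ᵥ S *ᵥ y)| ≤ δ * T * nsq y := by
  set D : ℕ → Matrix (Fin k) (Fin k) ℝ := fun T =>
    (T : ℝ)⁻¹ • ∑ t ∈ range T, G t * (G t)ᵀ - S with hD
  have h1 : Tendsto (fun T => √(∑ i, ∑ j, D T i j ^ 2)) atTop (𝓝 0) := by
    have h2 : Tendsto D atTop (𝓝 0) := by
      have := h.sub_const S
      rwa [sub_self] at this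
    have h3 : Continuous fun A : Matrix (Fin k) (Fin k) ℝ => √(∑ i, ∑ j, A i j ^ 2) := by
      fun_prop
    have := (h3.tendsto 0).comp h2
    simpa [Function.comp_def] using this
  filter_upwards [h1.eventually (gt_mem_nhds hδ), eventually_gt_atTop 0] with T hT hT0 y
  have hT' : (0 : ℝ) < T := by exact_mod_cast hT0
  have h2 : ∑ t ∈ range T, nsq ((G t)ᵀ *ᵥ y) - T * (y ⬝ᵥ S *ᵥ y) = T * (y ⬝ᵥ D T *ᵥ y) := by
    have h3 : y ⬝ᵥ (∑ t ∈ range T, G t * (G t)ᵀ) *ᵥ y = ∑ t ∈ range T, nsq ((G t)ᵀ *ᵥ y) := by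
      rw [sum_mulVec, dotProduct_sum]
      refine Finset.sum_congr rfl fun t _ => ?_
      rw [← mulVec_mulVec, dot_mulVec_eq]; rfl
    rw [hD, sub_mulVec, dotProduct_sub, smul_mulVec, dotProduct_smul, h3, smul_eq_mul]
    field_simp
  rw [h2, abs_mul, abs_of_pos hT']
  have h4 := abs_dot_mulVec_le_frobenius (D T) y
  have hy := nsq_nonneg y
  calc (T : ℝ) * |y ⬝ᵥ D T *ᵥ y| ≤ T * (δ * nsq y) := by
        gcongr; exact h4.trans (by gcongr)
    _ = _ := by ring

/-! ### The regular regime -/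

/-- The bounds that hold for all large sizes. -/
structure Regular {k₁ k₂ p₁ p₂ : ℕ} (R : Matrix (Fin p₁) (Fin k₁) ℝ)
    (C : Matrix (Fin p₂) (Fin k₂) ℝ) (F : ℕ → Matrix (Fin k₁) (Fin k₂) ℝ)
    (E : ℕ → Matrix (Fin p₁) (Fin p₂) ℝ) (T : ℕ) (s f x : ℝ) : Prop where
  row_pos : 0 < p₁
  col_pos : 0 < p₂
  time_pos : 0 < T
  card_le : k₂ ≤ p₂
  row_ge : ∀ y, (p₁ / 2 : ℝ) * nsq y ≤ nsq (R *ᵥ y)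
  row_le : ∀ y, nsq (R *ᵥ y) ≤ 2 * p₁ * nsq y
  col_ge : ∀ y, (p₂ / 2 : ℝ) * nsq y ≤ nsq (C *ᵥ y)
  col_le : ∀ y, nsq (C *ᵥ y) ≤ 2 * p₂ * nsq y
  factor_ge : ∀ y, s * T * nsq y ≤ ∑ t ∈ range T, nsq (F t *ᵥ y)
  factor_le : ∀ y, ∑ t ∈ range T, nsq (F t *ᵥ y) ≤ f * T * nsq y
  error_le : ColBd E T (x * (T * p₁ * p₂))

/-- Crude bound through the norm of the noise alone. It carries no rate, but keeps |r|² small with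
no restriction on the relative growth of the sizes. -/
lemma Regular.nsq_interaction_le {k₁ k₂ p₁ p₂ : ℕ} {R : Matrix (Fin p₁) (Fin k₁) ℝ}
    {C : Matrix (Fin p₂) (Fin k₂) ℝ} {F : ℕ → Matrix (Fin k₁) (Fin k₂) ℝ}
    {E : ℕ → Matrix (Fin p₁) (Fin p₂) ℝ} {T : ℕ} {s f x : ℝ} (h : Regular R C F E T s f x)
    (hx : 0 ≤ x) (y : Fin k₂ → ℝ) :
    nsq (∑ t ∈ range T, (E t)ᵀ *ᵥ R *ᵥ F t *ᵥ y) ≤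
      (x * (T * p₁ * p₂) * (2 * p₁ * (f * T))) * nsq y := by
  refine (h.error_le.dual (by positivity) _).trans ?_
  rw [mul_assoc (x * (T * p₁ * p₂))]
  refine mul_le_mul_of_nonneg_left ?_ (by positivity)
  refine (Finset.sum_le_sum fun t _ => h.row_le (F t *ᵥ y)).trans ?_
  rw [← Finset.mul_sum, mul_assoc (2 * (p₁ : ℝ))]
  exact mul_le_mul_of_nonneg_left (h.factor_le y) (by positivity)

section

variable {Ω : Type*} {k₁ k₂ : ℕ} {R : ℕ → Fin k₁ → ℝ} {C : ℕ → Fin k₂ → ℝ}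
  {F : ℕ → Ω → Matrix (Fin k₁) (Fin k₂) ℝ} {e : ℕ → ℕ → ℕ → Ω → ℝ} {p₁ p₂ T : ℕ} {ω : Ω}

lemma ColBd.min {m n : ℕ} {E : ℕ → Matrix (Fin m) (Fin n) ℝ} {K K' : ℝ} (h : ColBd E T K)
    (h' : ColBd E T K') : ColBd E T (min K K') := fun w => by
  rw [min_mul_of_nonneg _ _ (nsq_nonneg w)]
  exact le_min (h w) (h' w)

/-- The leading eigenvectors are close to the column space of `C`. -/
lemma Regular.exists_decomp {s f x σ K : ℝ} {Q : Matrix (Fin p₂) (Fin k₂) ℝ}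
    (h : Regular (loadingMat R p₁) (loadingMat C p₂) (fun t => F t ω)
      (fun t => errMat e p₁ p₂ t ω) T s f x)
    (hs : 0 < s) (hf : 0 ≤ f) (hx : 0 ≤ x) (hxs : x ≤ s / 32)
    (hQ : IsLeadingEigenvectors (rowCov R C F e p₁ p₂ T ω) Q)
    (hK : 0 ≤ K) (hσ : 0 ≤ σ) (hE : ColBd (fun t => errMat e p₁ p₂ t ω) T K)
    (hS : ∀ y, nsq (∑ t ∈ range T, (errMat e p₁ p₂ t ω)ᵀ *ᵥ loadingMat R p₁ *ᵥ F t ω *ᵥ y) ≤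
      σ * nsq y) :
    ∃ (g : Fin k₂ → Fin k₂ → ℝ) (r : Fin k₂ → Fin p₂ → ℝ),
      (∀ m, Q.col m = loadingMat C p₂ *ᵥ g m + r m) ∧
      ∀ m, nsq (r m) ≤ 512 * (4 * x * f + x ^ 2) / s ^ 2 ∧
        nsq (r m) ≤ 512 * (2 * p₂ * σ + K ^ 2) / (s * (T * p₁ * p₂)) ^ 2 := by
  have hp₁ : (0 : ℝ) < p₁ := by exact_mod_cast h.row_pos
  have hp₂ : (0 : ℝ) < p₂ := by exact_mod_cast h.col_pos
  have hT : (0 : ℝ) < T := by exact_mod_cast h.time_pos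
  set V : ℝ := T * p₁ * p₂ with hV
  have hV0 : 0 < V := by positivity
  have hX : ∀ t, obs R C F e p₁ p₂ t ω =
    loadingMat R p₁ * F t ω * (loadingMat C p₂)ᵀ + errMat e p₁ p₂ t ω := fun _ => rfl
  -- Both available bounds are fed in as minima, so that one and the same r satisfies the rate-free
  -- and the sharp estimate.
  have key : ∀ m : Fin k₂, ∃ g r, Q.col m = loadingMat C p₂ *ᵥ g + r ∧
      nsq r ≤ 2 * (2 * p₂ * min σ (x * V * (2 * p₁ * (f * T))) + (min K (x * V)) ^ 2) /
        (s / 16 * V) ^ 2 := by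
    intro m
    have hk₂ : 1 ≤ k₂ := by have := m.2; omega
    -- The column space of C is a k₂-dimensional test space. Since x ≤ s / 32, the constant s / 8 -
    -- 2x is at least s / 16, and 512 below is 2 · 16².
    have hlow : s / 16 * p₂ ≤ eig (rowCov R C F e p₁ p₂ T ω) (m + 1) := by
      refine le_trans ?_ (eig_antitone rowCov_isHermitian (by omega)
        (show (m : ℕ) + 1 ≤ k₂ from m.2) h.card_le)
      refine le_eig rowCov_isHermitian hk₂ (loadingMat C p₂).mulVecLin (fun y hy => ?_) fun y => ?_
      · have := h.col_ge y
        rw [mulVecLin_apply] at hy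
        rw [hy, nsq_eq_zero.2 rfl] at this
        refine nsq_eq_zero.1 (le_antisymm ?_ (nsq_nonneg y))
        by_contra h0
        have := mul_pos (half_pos hp₂) (not_le.1 h0)
        linarith
      · rw [mulVecLin_apply, rowCov_quad]
        have h1 := sum_nsq_obs_ge hX hs.le h.col_pos h.row_ge h.col_ge h.factor_ge h.error_le y
        have h2 : s / 16 * V * nsq (loadingMat C p₂ *ᵥ y) ≤
            ∑ t ∈ range T, nsq (obs R C F e p₁ p₂ t ω *ᵥ loadingMat C p₂ *ᵥ y) := by
          refine le_trans ?_ h1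
          have := nsq_nonneg (loadingMat C p₂ *ᵥ y)
          gcongr
          linarith
        rw [inv_mul_eq_div, le_div_iff₀ (by positivity)]
        refine le_trans (le_of_eq ?_) h2
        rw [hV]; ring
    have hev : ∑ t ∈ range T, (obs R C F e p₁ p₂ t ω)ᵀ *ᵥ obs R C F e p₁ p₂ t ω *ᵥ Q.col m =
        (T * p₁ * eig (rowCov R C F e p₁ p₂ T ω) (m + 1)) • Q.col m := by
      have h1 := hQ.2 m
      rw [rowCov_mulVec] at h1
      rw [← smul_smul, ← h1, smul_smul, mul_inv_cancel₀ (by positivity), one_smul]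
    have hq : nsq (Q.col m) = 1 := by
      have := congrFun (congrFun hQ.1 m) m
      simpa [nsq, Matrix.mul_apply, dotProduct] using this
    refine MatrixFactor.exists_decomp hX (by positivity) ?_ (le_min hK (by positivity))
      (le_min hσ (by positivity)) h.col_le (hE.min h.error_le) (fun y => ?_) hq hev
    · have := mul_le_mul_of_nonneg_left hlow (by positivity : 0 ≤ (T : ℝ) * p₁)
      refine le_trans (le_of_eq ?_) this
      rw [hV]; ring
    · rw [min_mul_of_nonneg _ _ (nsq_nonneg y)]
      exact le_min (hS y) (h.nsq_interaction_le hx y)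
  choose g r hdec hr using key
  refine ⟨g, r, hdec, fun m => ⟨(hr m).trans ?_, (hr m).trans ?_⟩⟩
  · have h1 : 2 * (2 * p₂ * min σ (x * V * (2 * p₁ * (f * T))) + (min K (x * V)) ^ 2) /
        (s / 16 * V) ^ 2 ≤
        2 * (2 * p₂ * (x * V * (2 * p₁ * (f * T))) + (x * V) ^ 2) / (s / 16 * V) ^ 2 := by
      have : 0 ≤ min K (x * V) := le_min hK (by positivity)
      gcongr
      · exact min_le_right _ _
      · exact min_le_right _ _
    refine h1.trans (le_of_eq ?_)
    have : 2 * p₂ * (x * V * (2 * p₁ * (f * T))) = 4 * x * f * V ^ 2 := by rw [hV]; ring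
    rw [this]
    field_simp
    ring
  · have h1 : 2 * (2 * p₂ * min σ (x * V * (2 * p₁ * (f * T))) + (min K (x * V)) ^ 2) /
        (s / 16 * V) ^ 2 ≤ 2 * (2 * p₂ * σ + K ^ 2) / (s / 16 * V) ^ 2 := by
      have : 0 ≤ min K (x * V) := le_min hK (by positivity)
      gcongr
      · exact min_le_left _ _
      · exact min_le_left _ _
    refine h1.trans (le_of_eq ?_)
    field_simp
    ring

end

/-! ### The regular regime holds for all large sizes. -/

section

variable {Ω : Type*} [MeasurableSpace Ω] {μ : Measure Ω} [IsProbabilityMeasure μ] {k₁ k₂ : ℕ}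
  {R : ℕ → Fin k₁ → ℝ} {C : ℕ → Fin k₂ → ℝ}
  {F : ℕ → Ω → Matrix (Fin k₁) (Fin k₂) ℝ} {e : ℕ → ℕ → ℕ → Ω → ℝ}

lemma tendsto_swap_triple :
    Tendsto (fun p : ℕ × ℕ × ℕ => (p.2.1, p.1, p.2.2)) atTop atTop := by
  have h := tendsto_snd_triple.prodMk (tendsto_fst_triple.prodMk tendsto_thd_triple)
  simpa only [prod_atTop_atTop_eq] using h

lemma ErrorAssumption.ae_eventually_colBd (he : ErrorAssumption μ e) :
    ∀ᵐ ω ∂μ, ∀ x > 0, ∀ᶠ p : ℕ × ℕ × ℕ in atTop,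
      ColBd (fun t => errMat e p.1 p.2.1 t ω) p.2.2 (x * (p.2.2 * p.1 * p.2.1)) := by
  obtain ⟨c, hc⟩ := he.exists_weakDep
  filter_upwards [hc.swap.ae_eventually_rowOn] with ω hω x hx
  filter_upwards [tendsto_swap_triple.eventually (hω x hx)] with p hp
  rw [colBd_iff, mul_right_comm]
  exact hp

lemma ErrorAssumption.ae_eventually_rowBd (he : ErrorAssumption μ e) :
    ∀ᵐ ω ∂μ, ∀ x > 0, ∀ᶠ p : ℕ × ℕ × ℕ in atTop,
      RowBd (fun t => errMat e p.1 p.2.1 t ω) p.2.2 (x * (p.2.2 * p.1 * p.2.1)) := by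
  obtain ⟨c, hc⟩ := he.exists_weakDep
  filter_upwards [hc.ae_eventually_rowOn] with ω hω x hx
  filter_upwards [hω x hx] with p hp
  exact rowBd_iff.2 hp

lemma ae_eventually_regular (hF : FactorAssumption μ F) (hR : LoadingAssumption R)
    (hC : LoadingAssumption C) (he : ErrorAssumption μ e) :
    ∃ s > 0, ∃ f, 0 ≤ f ∧ ∀ᵐ ω ∂μ, ∀ x > 0, ∀ᶠ p : ℕ × ℕ × ℕ in atTop,
      Regular (loadingMat R p.1) (loadingMat C p.2.1) (fun t => F t ω)
        (fun t => errMat e p.1 p.2.1 t ω) p.2.2 s f x := by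
  obtain ⟨S, hS, -, hlim⟩ := hF.cov_right
  obtain ⟨s, hs, hsS⟩ := exists_quad_ge hS
  refine ⟨s / 2, half_pos hs, √(∑ i, ∑ j, S i j ^ 2) + s / 2, by positivity, ?_⟩
  filter_upwards [hlim, he.ae_eventually_colBd] with ω hω hE x hx
  have hG := eventually_sum_nsq_close (G := fun t => (F t ω)ᵀ)
    (by simpa only [transpose_transpose] using hω) (half_pos hs)
  simp only [transpose_transpose] at hG
  filter_upwards [hE x hx, tendsto_thd_triple.eventually hG,
    tendsto_fst_triple.eventually (hR.eventually_gram (δ := 1 / 2) (by norm_num)),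
    tendsto_snd_triple.eventually (hC.eventually_gram (δ := 1 / 2) (by norm_num)),
    tendsto_fst_triple.eventually (eventually_gt_atTop 0),
    tendsto_snd_triple.eventually (eventually_ge_atTop (k₂ + 1)),
    tendsto_thd_triple.eventually (eventually_gt_atTop 0)] with p h1 h2 h3 h4 h5 h6 h7
  have hT : (0 : ℝ) ≤ p.2.2 := Nat.cast_nonneg _
  refine ⟨h5, by omega, h7, by omega, fun y => ?_, fun y => ?_, fun y => ?_, fun y => ?_,
    fun y => ?_, fun y => ?_, h1⟩
  · linarith [(h3 y).1]
  · have : 0 ≤ (p.1 : ℝ) * nsq y := mul_nonneg (Nat.cast_nonneg _) (nsq_nonneg y)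
    linarith [(h3 y).2]
  · linarith [(h4 y).1]
  · have : 0 ≤ (p.2.1 : ℝ) * nsq y := mul_nonneg (Nat.cast_nonneg _) (nsq_nonneg y)
    linarith [(h4 y).2]
  · have := mul_le_mul_of_nonneg_left (hsS y) hT
    linarith [(abs_le.1 (h2 y)).1]
  · have := mul_le_mul_of_nonneg_left
      ((le_abs_self _).trans (abs_dot_mulVec_le_frobenius S y)) hT
    linarith [(abs_le.1 (h2 y)).2]

end

/-! ### The leading eigenvalues of the projected covariance matrix -/

section

variable {Ω : Type*} {k₁ k₂ : ℕ} {R : ℕ → Fin k₁ → ℝ} {C : ℕ → Fin k₂ → ℝ}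
  {F : ℕ → Ω → Matrix (Fin k₁) (Fin k₂) ℝ} {e : ℕ → ℕ → ℕ → Ω → ℝ}
  {Q : (p₁ p₂ T : ℕ) → Ω → Matrix (Fin p₂) (Fin k₂) ℝ} {p₁ p₂ T : ℕ} {ω : Ω}
  {S : Matrix (Fin k₁) (Fin k₁) ℝ} {j : ℕ}

lemma eig_projCov_nonneg (hp₂ : 0 < p₂) (j : ℕ) : 0 ≤ eig (projCov R C F e Q p₁ p₂ T ω) j :=
  eig_nonneg (fun v => by
    rw [projCov_quad hp₂]
    exact mul_nonneg (by positivity) (Finset.sum_nonneg fun _ _ => nsq_nonneg _)) j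

/-- The j - 1 linear conditions that bound the form of S by its j-th eigenvalue are pulled back by
R'. A noise level δ² survives the factor 1 + 1/δ. -/
lemma eig_projCov_le (hp₂ : 0 < p₂) (hT : 0 < T) (hS : S.PosDef) (hj : 1 ≤ j) (hjk : j ≤ k₁)
    {δ : ℝ} (hδ : 0 < δ)
    (hR : ∀ y, nsq (loadingMat R p₁ *ᵥ y) ≤ (1 + δ) * p₁ * nsq y)
    (hC : ∀ y, nsq (loadingMat C p₂ *ᵥ y) ≤ (1 + δ) * p₂ * nsq y)
    (hF : ∀ y, ∑ t ∈ range T, nsq ((F t ω)ᵀ *ᵥ y) ≤ T * (y ⬝ᵥ S *ᵥ y) + δ * T * nsq y)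
    (hE : RowBd (fun t => errMat e p₁ p₂ t ω) T (δ ^ 2 * (T * p₁ * p₂)))
    (hQ : (Q p₁ p₂ T ω)ᵀ * Q p₁ p₂ T ω = 1) :
    eig (projCov R C F e Q p₁ p₂ T ω) j ≤
      ((1 + δ) ^ 3 * (eig S j + δ) + (δ ^ 2 + δ)) * p₁ := by
  have hs := eig_pos hS hj hjk
  obtain ⟨-, L, hL⟩ := exists_test_spaces hS.isHermitian hj hjk
  have hX : ∀ t, obs R C F e p₁ p₂ t ω =
    loadingMat R p₁ * F t ω * (loadingMat C p₂)ᵀ + errMat e p₁ p₂ t ω := fun _ => rfl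
  refine eig_le projCov_isHermitian (by omega : j - 1 < j)
    (L ∘ₗ (loadingMat R p₁)ᵀ.mulVecLin) (by positivity) fun v hv => ?_
  have h1 := sum_nsq_proj_le hX hδ hs.le hR hC hF hE hQ (hL _ hv)
  have hT' : (0 : ℝ) < T := by exact_mod_cast hT
  have hp' : (0 : ℝ) < p₂ := by exact_mod_cast hp₂
  rw [projCov_quad hp₂, inv_mul_eq_div, div_le_iff₀ (by positivity)]
  refine h1.trans (le_of_eq ?_)
  have : (1 + 1 / δ) * δ ^ 2 = δ ^ 2 + δ := by field_simp
  rw [this]; ring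

/-- The test space of S for its j-th eigenvalue is lifted by R (R'R)⁻¹: the lifted vectors lie in
the range of R and are mapped back by R' to the original ones. -/
lemma le_eig_projCov (hp₁ : 0 < p₁) (hp₂ : 0 < p₂) (hT : 0 < T) (hS : S.PosDef) (hj : 1 ≤ j)
    (hjk : j ≤ k₁) {δ : ℝ} (hδ : 0 < δ) (hδ1 : δ ≤ 1 / 5) (hδs : δ ≤ eig S j)
    (hR : ∀ y, (1 - δ) * p₁ * nsq y ≤ nsq (loadingMat R p₁ *ᵥ y))
    (hC : ∀ y, (1 - δ) * p₂ * nsq y ≤ nsq (loadingMat C p₂ *ᵥ y))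
    (hQC : ∀ z, (1 - 5 * δ) * nsq (loadingMat C p₂ *ᵥ z) ≤
      nsq ((Q p₁ p₂ T ω)ᵀ *ᵥ loadingMat C p₂ *ᵥ z))
    (hF : ∀ y, T * (y ⬝ᵥ S *ᵥ y) - δ * T * nsq y ≤ ∑ t ∈ range T, nsq ((F t ω)ᵀ *ᵥ y))
    (hE : RowBd (fun t => errMat e p₁ p₂ t ω) T (δ ^ 2 * (T * p₁ * p₂)))
    (hQ : (Q p₁ p₂ T ω)ᵀ * Q p₁ p₂ T ω = 1) :
    ((1 - 5 * δ) * (1 - δ) ^ 3 * (eig S j - δ) - δ) * p₁ ≤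
      eig (projCov R C F e Q p₁ p₂ T ω) j := by
  obtain ⟨⟨B, hB0, hB⟩, -⟩ := exists_test_spaces hS.isHermitian hj hjk
  have hX : ∀ t, obs R C F e p₁ p₂ t ω =
    loadingMat R p₁ * F t ω * (loadingMat C p₂)ᵀ + errMat e p₁ p₂ t ω := fun _ => rfl
  set A := loadingMat R p₁ with hA
  have hT' : (0 : ℝ) < T := by exact_mod_cast hT
  have hp₁' : (0 : ℝ) < p₁ := by exact_mod_cast hp₁
  have hp₂' : (0 : ℝ) < p₂ := by exact_mod_cast hp₂
  have hinj0 : ∀ y, A *ᵥ y = 0 → y = 0 := fun y hy => by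
    have := hR y
    rw [hy, nsq_eq_zero.2 rfl] at this
    refine nsq_eq_zero.1 (le_antisymm ?_ (nsq_nonneg y))
    by_contra h0
    have := mul_pos (mul_pos (by linarith : 0 < 1 - δ) hp₁') (not_le.1 h0)
    linarith
  have hunit : IsUnit (Aᵀ * A) := by
    rw [← mulVec_injective_iff_isUnit]
    refine (injective_iff_map_eq_zero (Aᵀ * A).mulVecLin).2 fun y hy => hinj0 y ?_
    rw [mulVecLin_apply, ← mulVec_mulVec] at hy
    refine nsq_eq_zero.1 ?_
    have : nsq (A *ᵥ y) = (Aᵀ *ᵥ A *ᵥ y) ⬝ᵥ y := by rw [← dot_mulVec_eq]; rfl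
    rw [this, hy, zero_dotProduct]
  have hinv : ∀ y, Aᵀ *ᵥ A *ᵥ (Aᵀ * A)⁻¹ *ᵥ y = y := fun y => by
    rw [mulVec_mulVec, mulVec_mulVec, mul_nonsing_inv _ ((isUnit_iff_isUnit_det _).1 hunit),
      one_mulVec]
  refine le_eig projCov_isHermitian hj (A.mulVecLin ∘ₗ (Aᵀ * A)⁻¹.mulVecLin ∘ₗ B)
    (fun y hy => hB0 y ?_) fun y => ?_
  · have h1 : A *ᵥ (Aᵀ * A)⁻¹ *ᵥ B y = 0 := hy
    rw [← hinv (B y), h1, mulVec_zero]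
  · change _ * nsq (A *ᵥ (Aᵀ * A)⁻¹ *ᵥ B y) ≤
      (A *ᵥ (Aᵀ * A)⁻¹ *ᵥ B y) ⬝ᵥ _ *ᵥ (A *ᵥ (Aᵀ * A)⁻¹ *ᵥ B y)
    have h1 := le_sum_nsq_proj hX hδ hδ1 hδs hR hC hQC hF hE hQ (w := (Aᵀ * A)⁻¹ *ᵥ B y)
      (by rw [hinv]; exact hB y)
    rw [projCov_quad hp₂, inv_mul_eq_div, le_div_iff₀ (by positivity)]
    refine le_trans (le_of_eq ?_) h1
    have : δ ^ 2 / δ = δ := by field_simp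
    rw [this]; ring

end

/-- Both expressions are continuous in δ and equal s at δ = 0. -/
lemma exists_bounds_close {s r : ℝ} (hs : 0 < s) (hr : 0 < r) : ∃ δ > 0, δ ≤ 1 / 5 ∧ δ ≤ s ∧
    (1 + δ) ^ 3 * (s + δ) + (δ ^ 2 + δ) < s + r ∧
      s - r < (1 - 5 * δ) * (1 - δ) ^ 3 * (s - δ) - δ := by
  have h1 : ContinuousAt (fun δ : ℝ => (1 + δ) ^ 3 * (s + δ) + (δ ^ 2 + δ)) 0 := by fun_prop
  have h2 : ContinuousAt (fun δ : ℝ => (1 - 5 * δ) * (1 - δ) ^ 3 * (s - δ) - δ) 0 := by fun_prop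
  have e1 := h1.eventually_lt_const (u := s + r) (by norm_num; linarith)
  have e2 := h2.eventually_const_lt (u := s - r) (by norm_num; linarith)
  have e3 : ∀ᶠ δ : ℝ in 𝓝 0, δ < 1 / 5 := gt_mem_nhds (by norm_num)
  have e4 : ∀ᶠ δ : ℝ in 𝓝 0, δ < s := gt_mem_nhds hs
  have e5 : ∀ᶠ δ : ℝ in 𝓝[>] 0, 0 < δ := self_mem_nhdsWithin
  obtain ⟨δ, ⟨⟨⟨a, b⟩, c⟩, d⟩, h⟩ :=
    ((((e1.and e2).and e3).and e4).filter_mono nhdsWithin_le_nhds |>.and e5).exists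
  exact ⟨δ, h, c.le, d.le, a, b⟩

section

variable {Ω : Type*} [MeasurableSpace Ω] {μ : Measure Ω} [IsProbabilityMeasure μ] {k₁ k₂ : ℕ}
  {R : ℕ → Fin k₁ → ℝ} {C : ℕ → Fin k₂ → ℝ}
  {F : ℕ → Ω → Matrix (Fin k₁) (Fin k₂) ℝ} {e : ℕ → ℕ → ℕ → Ω → ℝ}
  {Q : (p₁ p₂ T : ℕ) → Ω → Matrix (Fin p₂) (Fin k₂) ℝ}

lemma Regular.exists_small (k : ℕ) (f : ℝ) {s r : ℝ} (hs : 0 < s) (hr : 0 < r) :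
    ∃ x > 0, x ≤ s / 32 ∧ k * (512 * (4 * x * f + x ^ 2) / s ^ 2) ≤ r := by
  have h1 : ContinuousAt (fun x : ℝ => k * (512 * (4 * x * f + x ^ 2) / s ^ 2)) 0 := by fun_prop
  have e1 := h1.eventually_lt_const (u := r) (by norm_num; exact hr)
  have e2 : ∀ᶠ x : ℝ in 𝓝 0, x < s / 32 := gt_mem_nhds (by positivity)
  have e3 : ∀ᶠ x : ℝ in 𝓝[>] 0, 0 < x := self_mem_nhdsWithin
  obtain ⟨x, ⟨a, b⟩, c⟩ := ((e1.and e2).filter_mono nhdsWithin_le_nhds |>.and e3).exists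
  exact ⟨x, c, b.le, a.le⟩

/-- The limit is the j-th eigenvalue of Σ₁, approached from both sides by `eig_projCov_le` and
`le_eig_projCov`. -/
theorem isOmegaAS_eig_projCov (hF : FactorAssumption μ F) (hR : LoadingAssumption R)
    (hC : LoadingAssumption C) (he : ErrorAssumption μ e)
    (hQ : ∀ p₁ p₂ T ω, k₂ ≤ p₂ →
      IsLeadingEigenvectors (rowCov R C F e p₁ p₂ T ω) (Q p₁ p₂ T ω))
    {j : ℕ} (hj : 1 ≤ j) (hjk : j ≤ k₁) :
    IsOmegaAS μ (fun p₁ p₂ T ω => eig (projCov R C F e Q p₁ p₂ T ω) j)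
      (fun p₁ _ _ => (p₁ : ℝ)) := by
  obtain ⟨S, hS, -, hlim⟩ := hF.cov_left
  obtain ⟨s, hs, f, hf, hreg⟩ := ae_eventually_regular hF hR hC he
  have hσ := eig_pos hS hj hjk
  refine ⟨eig S j, hσ, ?_⟩
  filter_upwards [hlim, hreg, he.ae_eventually_rowBd] with ω hω hrω hE
  rw [Metric.tendsto_nhds]
  intro r hr
  obtain ⟨δ, hδ, hδ1, hδs, hup, hlow⟩ := exists_bounds_close hσ hr
  -- The noise level x is chosen after δ, so that the remainders meet the smallness condition of
  -- `nsq_proj_ge`.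
  obtain ⟨x, hx, hxs, hxD⟩ := Regular.exists_small k₂ f hs (sq_pos_of_pos hδ)
  filter_upwards [hrω x hx, hE (δ ^ 2) (by positivity),
    tendsto_thd_triple.eventually (eventually_sum_nsq_close hω hδ),
    tendsto_fst_triple.eventually (hR.eventually_gram hδ),
    tendsto_snd_triple.eventually (hC.eventually_gram hδ)] with p h1 h2 h3 h4 h5
  have hlead := hQ p.1 p.2.1 p.2.2 ω h1.card_le
  have hp₁ : (0 : ℝ) < p.1 := by exact_mod_cast h1.row_pos
  have hT : (0 : ℝ) < p.2.2 := by exact_mod_cast h1.time_pos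
  obtain ⟨g, q, hdec, hq⟩ := h1.exists_decomp hs hf hx.le hxs hlead
    (K := x * (p.2.2 * p.1 * p.2.1)) (by positivity)
    (by positivity) h1.error_le (h1.nsq_interaction_le hx.le)
  have hQC := nsq_proj_ge hδ hδ1 hxD hlead.1 hdec fun m => (hq m).1
  have hU := eig_projCov_le (j := j) h1.col_pos h1.time_pos hS hj hjk hδ
    (fun y => (h4 y).2) (fun y => (h5 y).2)
    (fun y => by linarith [(abs_le.1 (h3 y)).2]) h2 hlead.1
  have hL := le_eig_projCov (j := j) h1.row_pos h1.col_pos h1.time_pos hS hj hjk hδ hδ1 hδs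
    (fun y => (h4 y).1) (fun y => (h5 y).1) hQC
    (fun y => by linarith [(abs_le.1 (h3 y)).1]) h2 hlead.1
  rw [Real.dist_eq, abs_lt]
  rw [← le_div_iff₀ hp₁] at hL
  rw [← div_le_iff₀ hp₁] at hU
  constructor <;> linarith

end

/-! ### The remaining eigenvalues of the projected covariance matrix -/

section

variable {Ω : Type*} {k₁ k₂ : ℕ} {R : ℕ → Fin k₁ → ℝ} {C : ℕ → Fin k₂ → ℝ}
  {F : ℕ → Ω → Matrix (Fin k₁) (Fin k₂) ℝ} {e : ℕ → ℕ → ℕ → Ω → ℝ}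
  {Q : (p₁ p₂ T : ℕ) → Ω → Matrix (Fin p₂) (Fin k₂) ℝ} {p₁ p₂ T : ℕ} {ω : Ω} {B : ℝ}

/-- Frobenius norm of Σ E_t' R F_t: each entry sums k₁ p₁ interactions with bounded loadings as
coefficients, and Cauchy–Schwarz costs that number. -/
lemma nsq_interaction_le (hB : ∀ i a, |R i a| ≤ B) (y : Fin k₂ → ℝ) :
    nsq (∑ t ∈ range T, (errMat e p₁ p₂ t ω)ᵀ *ᵥ loadingMat R p₁ *ᵥ F t ω *ᵥ y) ≤
      (k₁ * p₁ * B ^ 2 * ∑ q, interSq F e q p₁ p₂ (range T) ω) * nsq y := by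
  set S : Matrix (Fin p₂) (Fin k₂) ℝ :=
    ∑ t ∈ range T, (errMat e p₁ p₂ t ω)ᵀ * loadingMat R p₁ * F t ω with hS
  have h1 : ∑ t ∈ range T, (errMat e p₁ p₂ t ω)ᵀ *ᵥ loadingMat R p₁ *ᵥ F t ω *ᵥ y = S *ᵥ y := by
    rw [hS, sum_mulVec]
    simp only [mulVec_mulVec, Matrix.mul_assoc]
  rw [h1]
  refine (nsq_mulVec_le_frobenius S y).trans (mul_le_mul_of_nonneg_right ?_ (nsq_nonneg y))
  have hentry : ∀ j b, S j b = ∑ a, ∑ i : Fin p₁,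
      R i a * ∑ t ∈ range T, F t ω a b * e i j t ω := fun j b => by
    simp only [hS, Matrix.sum_apply, Matrix.mul_apply, Matrix.transpose_apply, errMat, loadingMat,
      Matrix.of_apply, Finset.mul_sum, Finset.sum_mul]
    rw [Finset.sum_comm]
    refine Finset.sum_congr rfl fun a _ => ?_
    rw [Finset.sum_comm]
    exact Finset.sum_congr rfl fun i _ => Finset.sum_congr rfl fun t _ => by ring
  have hsq : ∀ j b, S j b ^ 2 ≤ k₁ * p₁ * B ^ 2 * ∑ a, ∑ i : Fin p₁,
      (∑ t ∈ range T, F t ω a b * e i j t ω) ^ 2 := fun j b => by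
    rw [hentry]
    simp only [← Finset.sum_product', univ_product_univ]
    refine (Finset.sum_mul_sq_le_sq_mul_sq _ (fun z : Fin k₁ × Fin p₁ => R z.2 z.1) _).trans ?_
    refine mul_le_mul_of_nonneg_right ?_ (Finset.sum_nonneg fun _ _ => sq_nonneg _)
    refine (Finset.sum_le_card_nsmul _ _ (B ^ 2) fun z _ => ?_).trans (le_of_eq (by simp))
    exact sq_le_sq' (abs_le.1 (hB _ _)).1 (abs_le.1 (hB _ _)).2
  refine (Finset.sum_le_sum fun j _ => Finset.sum_le_sum fun b _ => hsq j b).trans ?_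
  simp only [← Finset.mul_sum]
  refine mul_le_mul_of_nonneg_left (le_of_eq ?_) (by positivity)
  have hfin : ∀ q, interSq F e q p₁ p₂ (range T) ω = ∑ i : Fin p₁, ∑ j : Fin p₂,
      (∑ t ∈ range T, F t ω q.1 q.2 * e i j t ω) ^ 2 := fun q => by
    rw [interSq, ← Fin.sum_univ_eq_sum_range
      (fun i => ∑ j ∈ range p₂, (∑ t ∈ range T, F t ω q.1 q.2 * e i j t ω) ^ 2)]
    refine Finset.sum_congr rfl fun i _ => ?_
    rw [← Fin.sum_univ_eq_sum_range (fun j => (∑ t ∈ range T, F t ω q.1 q.2 * e i j t ω) ^ 2)]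
  simp only [hfin]
  rw [Fintype.sum_prod_type, Finset.sum_comm]
  conv_rhs => rw [Finset.sum_comm]
  refine Finset.sum_congr rfl fun b _ => ?_
  rw [Finset.sum_comm]
  exact Finset.sum_congr rfl fun a _ => Finset.sum_comm

lemma rowBd_errMat_mul (K : Fin k₂ → ℝ)
    (h : ∀ b, RowOn (fun i _ t => blockSum e (fun j => C j b) (range p₂) i t ω) p₁ {0} (range T)
      (K b)) :
    RowBd (fun t => errMat e p₁ p₂ t ω * loadingMat C p₂) T (∑ b, K b) := by
  intro v
  obtain ⟨v, rfl⟩ := exists_extension v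
  rw [nsq_eq_sum_range]
  have h1 : ∀ t, nsq ((errMat e p₁ p₂ t ω * loadingMat C p₂)ᵀ *ᵥ fun i => v i) =
      ∑ b, (∑ i ∈ range p₁, v i * blockSum e (fun j => C j b) (range p₂) i t ω) ^ 2 := fun t => by
    rw [nsq_eq_sum]
    refine Finset.sum_congr rfl fun b _ => ?_
    rw [← Fin.sum_univ_eq_sum_range
      (fun i => v i * blockSum e (fun j => C j b) (range p₂) i t ω)]
    congr 1
    simp only [mulVec, dotProduct, Matrix.transpose_apply, Matrix.mul_apply, blockSum]
    refine Finset.sum_congr rfl fun i _ => ?_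
    rw [mul_comm, ← Fin.sum_univ_eq_sum_range (fun j => C j b * e i j t ω)]
    simp [errMat, loadingMat, mul_comm]
  simp only [h1]
  rw [Finset.sum_comm, Finset.sum_mul]
  refine Finset.sum_le_sum fun b _ => ?_
  simpa using h b v

/-- On the kernel of R', which is given by k₁ < j equations, the signal disappears. -/
lemma eig_projCov_le_of_noise {j : ℕ} (hj : k₁ < j) (hp₂ : 0 < p₂) {K : ℝ} (hK : 0 ≤ K)
    (h : ∀ v, ∑ t ∈ range T, nsq ((Q p₁ p₂ T ω)ᵀ *ᵥ (errMat e p₁ p₂ t ω)ᵀ *ᵥ v) ≤ K * nsq v) :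
    eig (projCov R C F e Q p₁ p₂ T ω) j ≤ (T * p₂ : ℝ)⁻¹ * K := by
  have hX : ∀ t, obs R C F e p₁ p₂ t ω =
    loadingMat R p₁ * F t ω * (loadingMat C p₂)ᵀ + errMat e p₁ p₂ t ω := fun _ => rfl
  refine eig_le projCov_isHermitian hj (loadingMat R p₁)ᵀ.mulVecLin (by positivity) fun v hv => ?_
  rw [mulVecLin_apply] at hv
  rw [projCov_quad hp₂, mul_assoc]
  refine mul_le_mul_of_nonneg_left ?_ (by positivity)
  simp only [obs_transpose_mulVec hX, hv, mulVec_zero, zero_add]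
  exact h v

end

/-! ### Rates -/

section Rates

variable {T p n W : ℝ}

/-- Multiplied by (T p n)², the rate W (1/n + 1/T + p/√(T n)) becomes n p W (T² p + T p n + p² T √T
√n), the shape of the bound for σ. The contribution (T p)² + n² T p W of K² fits into its first two
terms. -/
lemma decomp_rate {σ K s a b : ℝ} (hT : 0 < T) (hp : 1 ≤ p) (hn : 1 ≤ n) (hW : 1 ≤ W)
    (hs : 0 < s)
    (hσ : σ ≤ a * (p * (W * (T ^ 2 * p + T * p * n + p ^ 2 * (T * √T * √n)))))
    (hK0 : 0 ≤ K) (hK : K ≤ b * (T * p + n * √(T * p) * √W)) :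
    512 * (2 * n * σ + K ^ 2) / (s * (T * p * n)) ^ 2 ≤
      512 * (2 * a + 2 * b ^ 2) / s ^ 2 * (W * (1 / n + 1 / T + p / √(T * n))) := by
  have hn0 : 0 < n := by linarith
  have hp0 : 0 < p := by linarith
  have hW0 : 0 < W := by linarith
  have hu := Real.sqrt_pos.2 hT
  have hz := Real.sqrt_pos.2 hn0
  have hT2 : T = √T ^ 2 := (Real.sq_sqrt hT.le).symm
  have hn2 : n = √n ^ 2 := (Real.sq_sqrt hn0.le).symm
  have hVρ : (T * p * n) ^ 2 * (p / √(T * n)) = n * (p * (p ^ 2 * (T * √T * √n))) := by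
    rw [Real.sqrt_mul hT.le]
    generalize √T = u at *
    generalize √n = z at *
    subst hT2 hn2
    field_simp
  have h1 : (T * p * n) ^ 2 * (W * (1 / n + 1 / T + p / √(T * n))) =
      n * (p * (W * (T ^ 2 * p + T * p * n + p ^ 2 * (T * √T * √n)))) := by
    have : (T * p * n) ^ 2 * (W * (1 / n + 1 / T + p / √(T * n))) =
      W * ((T * p * n) ^ 2 * (1 / n + 1 / T) + (T * p * n) ^ 2 * (p / √(T * n))) := by ring
    rw [this, hVρ]
    field_simp
  have h2 : K ^ 2 ≤ 2 * b ^ 2 * ((T * p * n) ^ 2 * (W * (1 / n + 1 / T + p / √(T * n)))) := by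
    have e1 : K ^ 2 ≤ b ^ 2 * (T * p + n * √(T * p) * √W) ^ 2 := by
      rw [← mul_pow]; gcongr
    have e2 : (T * p + n * √(T * p) * √W) ^ 2 ≤ 2 * ((T * p) ^ 2 + n ^ 2 * (T * p) * W) := by
      have : n ^ 2 * (T * p) * W = (n * √(T * p) * √W) ^ 2 := by
        rw [mul_pow, mul_pow, Real.sq_sqrt (by positivity), Real.sq_sqrt hW0.le]
      rw [this]
      nlinarith [sq_nonneg (T * p - n * √(T * p) * √W)]
    have e3 : (T * p) ^ 2 + n ^ 2 * (T * p) * W ≤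
        (T * p * n) ^ 2 * (W * (1 / n + 1 / T + p / √(T * n))) := by
      rw [h1]
      have a1 : (T * p) ^ 2 * (1 * 1) ≤ (T * p) ^ 2 * (n * W) := by gcongr
      have a2 : n ^ 2 * T * W * (p * 1) ≤ n ^ 2 * T * W * (p * p) := by gcongr
      have a3 : 0 ≤ n * (p * (W * (p ^ 2 * (T * √T * √n)))) := by positivity
      linarith
    nlinarith [sq_nonneg b, mul_le_mul_of_nonneg_left (e2.trans
      (mul_le_mul_of_nonneg_left e3 zero_le_two)) (sq_nonneg b)]
  have h3 : 2 * n * σ ≤ 2 * a * ((T * p * n) ^ 2 * (W * (1 / n + 1 / T + p / √(T * n)))) := by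
    rw [h1]
    have := mul_le_mul_of_nonneg_left hσ (by positivity : 0 ≤ 2 * n)
    linarith
  rw [div_le_iff₀ (by positivity)]
  have : 512 * (2 * a + 2 * b ^ 2) / s ^ 2 * (W * (1 / n + 1 / T + p / √(T * n))) *
      (s * (T * p * n)) ^ 2 =
      512 * (2 * a + 2 * b ^ 2) * ((T * p * n) ^ 2 * (W * (1 / n + 1 / T + p / √(T * n)))) := by
    rw [mul_pow]; field_simp
  rw [this]
  linarith

/-- After normalisation the first part is 1/n + p √W / √(T n), and the second is D (1 + p √W / √(T
n)). There D is bounded by its rate in the first summand and by 1 in the second. -/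
lemma noise_rate {A B D a b d k : ℝ} (hT : 0 < T) (hp : 1 ≤ p) (hn : 1 ≤ n) (hW : 1 ≤ W)
    (ha : 0 ≤ a) (hb : 0 ≤ b) (hk : 0 ≤ k)
    (hA : A ≤ a * (T * n + p * √T * (n * √n) * √W)) (hB : B ≤ b * (T * n + p * √(T * n) * √W))
    (hD0 : 0 ≤ D) (hD1 : D ≤ 1) (hD : D ≤ d * (W * (1 / n + 1 / T + p / √(T * n)))) :
    (T * n)⁻¹ * (k * (16 / n * A + 2 * D * B)) ≤
      k * (16 * a + 2 * (b * (d + 1))) * (W * (1 / n + 1 / T + p / √(T * n))) := by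
  have hn0 : 0 < n := by linarith
  have hp0 : 0 < p := by linarith
  have hW0 : 0 < W := by linarith
  set ρ := 1 / n + 1 / T + p / √(T * n) with hρ
  have hTn : 0 < T * n := by positivity
  have hu := Real.sqrt_pos.2 hTn
  have hWW : √W ≤ W := by
    rw [Real.sqrt_le_left hW0.le]
    nlinarith
  have h1 : (T * n)⁻¹ * (1 / n * A) ≤ a * (W * ρ) := by
    have e1 : (T * n)⁻¹ * (1 / n * A) ≤
        (T * n)⁻¹ * (1 / n * (a * (T * n + p * √T * (n * √n) * √W))) := by gcongr
    have e2 : (T * n)⁻¹ * (1 / n * (a * (T * n + p * √T * (n * √n) * √W))) =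
        a * (1 / n + p / √(T * n) * √W) := by
      have hs : √T * √n = √(T * n) := (Real.sqrt_mul hT.le n).symm
      have : p * √T * (n * √n) * √W = n * p * √(T * n) * √W := by rw [← hs]; ring
      rw [this]
      have h2 : T * n = √(T * n) ^ 2 := (Real.sq_sqrt hTn.le).symm
      generalize √(T * n) = u at *
      have h3 : T = u ^ 2 / n := by field_simp; linarith
      rw [h3]
      field_simp
    rw [e2] at e1
    refine e1.trans ?_
    gcongr
    have a1 : 1 / n * 1 ≤ 1 / n * W := by gcongr
    have a2 : p / √(T * n) * √W ≤ p / √(T * n) * W := by gcongr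
    have a3 : 0 ≤ 1 / T * W := by positivity
    rw [hρ]; linarith
  have h2 : (T * n)⁻¹ * (D * B) ≤ b * (d + 1) * (W * ρ) := by
    have e1 : (T * n)⁻¹ * (D * B) ≤ (T * n)⁻¹ * (D * (b * (T * n + p * √(T * n) * √W))) := by
      gcongr
    have e2 : (T * n)⁻¹ * (D * (b * (T * n + p * √(T * n) * √W))) =
        b * (D * (1 + p / √(T * n) * √W)) := by
      have h2 : T * n = √(T * n) ^ 2 := (Real.sq_sqrt hTn.le).symm
      generalize √(T * n) = u at *
      rw [h2]
      field_simp
    rw [e2] at e1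
    refine e1.trans ?_
    rw [mul_assoc]
    refine mul_le_mul_of_nonneg_left ?_ hb
    have a1 : D * (p / √(T * n) * √W) ≤ 1 * (p / √(T * n) * W) := by gcongr
    have a2 : 0 ≤ W * (1 / n + 1 / T) := by positivity
    have a3 : W * ρ = W * (1 / n + 1 / T) + p / √(T * n) * W := by rw [hρ]; ring
    linarith
  have h3 : (T * n)⁻¹ * (k * (16 / n * A + 2 * D * B)) =
      k * (16 * ((T * n)⁻¹ * (1 / n * A)) + 2 * ((T * n)⁻¹ * (D * B))) := by ring
  rw [h3, mul_assoc]
  gcongr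
  linarith

end Rates

/-! ### The almost sure rate for the remaining eigenvalues. -/

section

variable {Ω : Type*} [MeasurableSpace Ω] {μ : Measure Ω} [IsProbabilityMeasure μ] {k₁ k₂ : ℕ}
  {R : ℕ → Fin k₁ → ℝ} {C : ℕ → Fin k₂ → ℝ}
  {F : ℕ → Ω → Matrix (Fin k₁) (Fin k₂) ℝ} {e : ℕ → ℕ → ℕ → Ω → ℝ}
  {Q : (p₁ p₂ T : ℕ) → Ω → Matrix (Fin p₂) (Fin k₂) ℝ}

lemma dwt_swap (θ : ℝ) (p₁ p₂ T : ℕ) : dwt θ p₂ p₁ T = dwt θ p₁ p₂ T := by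
  simp only [dwt, wt]
  congr 1
  ring

lemma ErrorAssumption.ae_rowBd (he : ErrorAssumption μ e) {θ : ℝ} (hθ : 0 < θ) :
    ∀ᵐ ω ∂μ, ∃ K, 0 ≤ K ∧ ∀ p₁ p₂ T : ℕ, 0 < p₁ → 0 < p₂ → 0 < T →
      RowBd (fun t => errMat e p₁ p₂ t ω) T
        (K * (T * p₂ + p₁ * √(T * p₂) * √(dwt θ p₁ p₂ T))) := by
  obtain ⟨c, hc⟩ := he.exists_weakDep
  filter_upwards [hc.ae_rowOn hθ] with ω ⟨K, hK, h⟩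
  exact ⟨K, hK, fun p₁ p₂ T h1 h2 h3 => rowBd_iff.2 (h p₁ p₂ T h1 h2 h3)⟩

lemma ErrorAssumption.ae_colBd (he : ErrorAssumption μ e) {θ : ℝ} (hθ : 0 < θ) :
    ∀ᵐ ω ∂μ, ∃ K, 0 ≤ K ∧ ∀ p₁ p₂ T : ℕ, 0 < p₁ → 0 < p₂ → 0 < T →
      ColBd (fun t => errMat e p₁ p₂ t ω) T
        (K * (T * p₁ + p₂ * √(T * p₁) * √(dwt θ p₁ p₂ T))) := by
  obtain ⟨c, hc⟩ := he.exists_weakDep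
  filter_upwards [hc.swap.ae_rowOn hθ] with ω ⟨K, hK, h⟩
  refine ⟨K, hK, fun p₁ p₂ T h1 h2 h3 => colBd_iff.2 ?_⟩
  rw [← dwt_swap]
  exact h p₂ p₁ T h2 h1 h3

lemma ErrorAssumption.ae_rowBd_mul (he : ErrorAssumption μ e) (hC : LoadingAssumption C) {θ : ℝ}
    (hθ : 0 < θ) : ∀ᵐ ω ∂μ, ∃ K, 0 ≤ K ∧ ∀ p₁ p₂ T : ℕ, 0 < p₁ → 0 < p₂ → 0 < T →
      RowBd (fun t => errMat e p₁ p₂ t ω * loadingMat C p₂) T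
        (K * (T * p₂ + p₁ * √T * (p₂ * √p₂) * √(dwt θ p₁ p₂ T))) := by
  obtain ⟨c, hc⟩ := he.exists_blockDep
  obtain ⟨B, hB⟩ := hC.bounded
  filter_upwards [ae_all_iff.2 fun b : Fin k₂ => hc.ae_rowOn (fun j => hB j b) hθ] with ω h
  choose K hK h using h
  refine ⟨∑ b, K b, Finset.sum_nonneg fun b _ => hK b, fun p₁ p₂ T h1 h2 h3 => ?_⟩
  rw [Finset.sum_mul]
  exact rowBd_errMat_mul _ fun b => h b p₁ p₂ T h1 h2 h3

lemma DependenceAssumption.ae_interaction (hFe : DependenceAssumption μ F e)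
    (hF : FactorAssumption μ F) (hR : LoadingAssumption R) (he : ErrorAssumption μ e) {θ : ℝ}
    (hθ : 0 < θ) : ∀ᵐ ω ∂μ, ∃ K, 0 ≤ K ∧ ∀ p₁ p₂ T : ℕ, 0 < p₁ → 0 < p₂ → 0 < T → ∀ y,
      nsq (∑ t ∈ range T, (errMat e p₁ p₂ t ω)ᵀ *ᵥ loadingMat R p₁ *ᵥ F t ω *ᵥ y) ≤
        K * (p₁ * (dwt θ p₁ p₂ T *
          ((T : ℝ) ^ 2 * p₁ + T * p₁ * p₂ + (p₁ : ℝ) ^ 2 * (T * √T * √p₂)))) * nsq y := by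
  obtain ⟨B, hB⟩ := hR.bounded
  filter_upwards [ae_all_iff.2 fun q => hFe.ae_interSq hF he hθ q] with ω h
  choose K hK h using h
  refine ⟨k₁ * B ^ 2 * ∑ q, K q, mul_nonneg (by positivity) (Finset.sum_nonneg fun q _ => hK q),
    fun p₁ p₂ T h1 h2 h3 y => (nsq_interaction_le hB y).trans ?_⟩
  refine mul_le_mul_of_nonneg_right ?_ (nsq_nonneg y)
  have := mul_le_mul_of_nonneg_left (Finset.sum_le_sum fun q (_ : q ∈ univ) => h q p₁ p₂ T h1 h2 h3)
    (by positivity : (0 : ℝ) ≤ k₁ * p₁ * B ^ 2)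
  refine this.trans (le_of_eq ?_)
  rw [← Finset.sum_mul]
  ring

lemma ae_eventually_eig_projCov_le (hF : FactorAssumption μ F) (hR : LoadingAssumption R)
    (hC : LoadingAssumption C) (he : ErrorAssumption μ e) (hFe : DependenceAssumption μ F e)
    (hQ : ∀ p₁ p₂ T ω, k₂ ≤ p₂ →
      IsLeadingEigenvectors (rowCov R C F e p₁ p₂ T ω) (Q p₁ p₂ T ω))
    {j : ℕ} (hj : k₁ < j) {θ : ℝ} (hθ : 0 < θ) :
    ∀ᵐ ω ∂μ, ∃ K, ∀ᶠ p : ℕ × ℕ × ℕ in atTop, eig (projCov R C F e Q p.1 p.2.1 p.2.2 ω) j ≤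
      K * (dwt θ p.1 p.2.1 p.2.2 *
        (1 / (p.2.1 : ℝ) + 1 / (p.2.2 : ℝ) + (p.1 : ℝ) / √((p.2.2 : ℝ) * p.2.1))) := by
  obtain ⟨s, hs, f, hf, hreg⟩ := ae_eventually_regular hF hR hC he
  obtain ⟨x, hx, hxs, hxD⟩ := Regular.exists_small 1 f hs one_pos
  filter_upwards [hreg, he.ae_rowBd hθ, he.ae_colBd hθ, he.ae_rowBd_mul hC hθ,
    hFe.ae_interaction hF hR he hθ] with ω h0 ⟨b, hb, hB⟩ ⟨c, hc, hcol⟩ ⟨a, ha, hA⟩ ⟨i, hi, hI⟩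
  refine ⟨k₂ * (16 * a + 2 * (b * (512 * (2 * i + 2 * c ^ 2) / s ^ 2 + 1))), ?_⟩
  filter_upwards [h0 x hx] with p h
  obtain ⟨p₁, p₂, T⟩ := p
  simp only at h ⊢
  have hp₁ := h.row_pos
  have hp₂ := h.col_pos
  have hT := h.time_pos
  have hW := one_le_dwt hθ p₁ p₂ T
  have hT' : (0 : ℝ) < T := by exact_mod_cast hT
  have hp₁' : (1 : ℝ) ≤ p₁ := by exact_mod_cast hp₁
  have hp₂' : (1 : ℝ) ≤ p₂ := by exact_mod_cast hp₂
  have hlead := hQ p₁ p₂ T ω h.card_le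
  have hW0 : 0 ≤ dwt θ p₁ p₂ T := by linarith
  obtain ⟨g, r, hdec, hr⟩ := h.exists_decomp hs hf hx.le hxs hlead
    (K := c * (T * p₁ + p₂ * √(T * p₁) * √(dwt θ p₁ p₂ T))) (by positivity)
    (by positivity) (hcol p₁ p₂ T hp₁ hp₂ hT) (hI p₁ p₂ T hp₁ hp₂ hT)
  have hD := decomp_rate hT' hp₁' hp₂' hW hs (a := i) le_rfl (b := c) (by positivity) le_rfl
  -- The bound 1 comes from the regular regime, the other from the sharp estimates; `noise_rate`
  -- needs both.
  set D := min 1 (512 * (2 * p₂ * (i * (p₁ * (dwt θ p₁ p₂ T * ((T : ℝ) ^ 2 * p₁ + T * p₁ * p₂ +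
    (p₁ : ℝ) ^ 2 * (T * √T * √p₂))))) + (c * (T * p₁ + p₂ * √(T * p₁) * √(dwt θ p₁ p₂ T))) ^ 2) /
    (s * (T * p₁ * p₂)) ^ 2)
  have hrD : ∀ m, nsq (r m) ≤ D := fun m =>
    le_min ((hr m).1.trans (by simpa using hxD)) (hr m).2
  have hD0 : 0 ≤ D := le_min zero_le_one (by positivity)
  have hD1 : D ≤ 1 := min_le_left _ _
  have hnoise := sum_nsq_proj_noise_le hD1 hp₂ h.col_ge hlead.1 hdec hrD
    (hB p₁ p₂ T hp₁ hp₂ hT) (hA p₁ p₂ T hp₁ hp₂ hT)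
  have h1 := eig_projCov_le_of_noise hj hp₂ (by positivity) hnoise (R := R) (C := C) (F := F)
  exact h1.trans (noise_rate hT' hp₁' hp₂' hW ha hb (by positivity) le_rfl le_rfl hD0 hD1
    ((min_le_right _ _).trans hD))

end

/-! ### Comparison with logarithms -/

lemma one_le_log {p : ℕ} (hp : 3 ≤ p) : 1 ≤ Real.log p := by
  rw [Real.le_log_iff_exp_le (by positivity)]
  have : (3 : ℝ) ≤ p := by exact_mod_cast hp
  linarith [Real.exp_one_lt_d9]

lemma dy_add_one_le {p : ℕ} (hp : 3 ≤ p) : (dy p : ℝ) + 1 ≤ 4 * Real.log p := by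
  have h1 := one_le_log hp
  have h2 : (Nat.log 2 p : ℝ) * Real.log 2 ≤ Real.log p := by
    rw [← Real.log_pow]
    refine Real.log_le_log (by positivity) ?_
    exact_mod_cast Nat.pow_log_le_self 2 (by omega)
  have h3 := Real.log_two_gt_d9
  have h4 : (0 : ℝ) ≤ Nat.log 2 p := Nat.cast_nonneg _
  have h5 : (Nat.log 2 p : ℝ) ≤ 2 * Real.log p := by nlinarith
  rw [dy]; push_cast; linarith

/-- Each exponent contributes at most 4 ln, hence 64 = 4³. The weight has power 1 + θ and the
denominator 1 + 2θ, so a negative power of the logarithms is left; ln p₁ ≤ ln² p₁ for p₁ ≥ 3. -/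
lemma dwt_div_le {θ : ℝ} (hθ : 0 < θ) {p₁ p₂ T : ℕ} (h₁ : 3 ≤ p₁) (h₂ : 3 ≤ p₂) (hT : 3 ≤ T) :
    dwt θ p₁ p₂ T / (Real.log p₁ ^ 2 * Real.log p₂ * Real.log T) ^ (1 + 2 * θ) ≤
      64 ^ (1 + θ) * (Real.log p₁ * Real.log p₂ * Real.log T) ^ (-θ) := by
  have l₁ := one_le_log h₁
  have l₂ := one_le_log h₂
  have l₃ := one_le_log hT
  have d₁ := dy_add_one_le h₁
  have d₂ := dy_add_one_le h₂
  have d₃ := dy_add_one_le hT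
  set ℓ := Real.log p₁ * Real.log p₂ * Real.log T with hℓ
  have hℓ0 : 0 < ℓ := by positivity
  have a1 : dwt θ p₁ p₂ T ≤ 64 ^ (1 + θ) * ℓ ^ (1 + θ) := by
    rw [← Real.mul_rpow (by norm_num) hℓ0.le]
    refine Real.rpow_le_rpow (by positivity) ?_ (by linarith)
    calc _ ≤ 4 * Real.log p₁ * (4 * Real.log p₂ * (4 * Real.log T)) := by
          simp only
          gcongr
      _ = 64 * ℓ := by rw [hℓ]; ring
  have a2 : ℓ ^ (1 + 2 * θ) ≤ (Real.log p₁ ^ 2 * Real.log p₂ * Real.log T) ^ (1 + 2 * θ) := by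
    refine Real.rpow_le_rpow hℓ0.le ?_ (by linarith)
    rw [hℓ]
    gcongr
    nlinarith
  have a3 : 0 < ℓ ^ (1 + 2 * θ) := Real.rpow_pos_of_pos hℓ0 _
  calc _ ≤ 64 ^ (1 + θ) * ℓ ^ (1 + θ) / ℓ ^ (1 + 2 * θ) := by gcongr
    _ = _ := by
      rw [mul_div_assoc, ← Real.rpow_sub hℓ0]
      congr 2
      ring

lemma tendsto_log_triple : Tendsto (fun p : ℕ × ℕ × ℕ =>
    Real.log p.1 * Real.log p.2.1 * Real.log p.2.2) atTop atTop := by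
  have h : Tendsto (fun n : ℕ => Real.log n) atTop atTop :=
    Real.tendsto_log_atTop.comp tendsto_natCast_atTop_atTop
  exact ((h.comp tendsto_fst_triple).atTop_mul_atTop₀ (h.comp tendsto_snd_triple)).atTop_mul_atTop₀
    (h.comp tendsto_thd_triple)

/-- The big-O bound is used with θ = ε / 2. The other half of ε makes the ratio tend to zero and
absorbs the random constant. -/
theorem isLittleOAS_eig_projCov {Ω : Type*} [MeasurableSpace Ω] {μ : Measure Ω}
    [IsProbabilityMeasure μ] {k₁ k₂ : ℕ} {R : ℕ → Fin k₁ → ℝ} {C : ℕ → Fin k₂ → ℝ}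
    {F : ℕ → Ω → Matrix (Fin k₁) (Fin k₂) ℝ} {e : ℕ → ℕ → ℕ → Ω → ℝ}
    {Q : (p₁ p₂ T : ℕ) → Ω → Matrix (Fin p₂) (Fin k₂) ℝ}
    (hF : FactorAssumption μ F) (hR : LoadingAssumption R)
    (hC : LoadingAssumption C) (he : ErrorAssumption μ e) (hFe : DependenceAssumption μ F e)
    (hQ : ∀ p₁ p₂ T ω, k₂ ≤ p₂ →
      IsLeadingEigenvectors (rowCov R C F e p₁ p₂ T ω) (Q p₁ p₂ T ω))
    {j : ℕ} (hj : k₁ < j) {ε : ℝ} (hε : 0 < ε) :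
    IsLittleOAS μ (fun p₁ p₂ T ω => eig (projCov R C F e Q p₁ p₂ T ω) j)
      (fun p₁ p₂ T => (1 / (p₂ : ℝ) + 1 / (T : ℝ) + (p₁ : ℝ) / Real.sqrt ((T : ℝ) * (p₂ : ℝ))) *
        (Real.log p₁ ^ 2 * Real.log p₂ * Real.log T) ^ (1 + ε)) := by
  filter_upwards [ae_eventually_eig_projCov_le hF hR hC he hFe hQ hj (half_pos hε)] with ω ⟨K, hK⟩
  have hlim : Tendsto (fun p : ℕ × ℕ × ℕ => |K| * (64 ^ (1 + ε / 2) *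
      (Real.log p.1 * Real.log p.2.1 * Real.log p.2.2) ^ (-(ε / 2)))) atTop (𝓝 0) := by
    have := (((tendsto_rpow_neg_atTop (half_pos hε)).comp tendsto_log_triple).const_mul
      ((64 : ℝ) ^ (1 + ε / 2))).const_mul |K|
    simpa [Function.comp_def] using this
  refine tendsto_of_tendsto_of_tendsto_of_le_of_le' tendsto_const_nhds hlim ?_ ?_
  · filter_upwards [tendsto_snd_triple.eventually (eventually_gt_atTop 0),
      tendsto_fst_triple.eventually (eventually_ge_atTop 3),
      tendsto_snd_triple.eventually (eventually_ge_atTop 3),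
      tendsto_thd_triple.eventually (eventually_ge_atTop 3)] with p h h1 h2 h3
    have l₁ := one_le_log h1
    have l₂ := one_le_log h2
    have l₃ := one_le_log h3
    have := eig_projCov_nonneg (R := R) (C := C) (F := F) (e := e) (Q := Q) (p₁ := p.1)
      (T := p.2.2) (ω := ω) h j
    positivity
  · filter_upwards [hK, tendsto_fst_triple.eventually (eventually_ge_atTop 3),
      tendsto_snd_triple.eventually (eventually_ge_atTop 3),
      tendsto_thd_triple.eventually (eventually_ge_atTop 3)] with p h h1 h2 h3
    have l₁ := one_le_log h1
    have l₂ := one_le_log h2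
    have l₃ := one_le_log h3
    have hp₂ : (0 : ℝ) < p.2.1 := by exact_mod_cast (by omega : 0 < p.2.1)
    set ρ := 1 / (p.2.1 : ℝ) + 1 / (p.2.2 : ℝ) + (p.1 : ℝ) / √((p.2.2 : ℝ) * p.2.1) with hρ
    have hρ0 : 0 < ρ := by positivity
    set L := Real.log p.1 ^ 2 * Real.log p.2.1 * Real.log p.2.2 with hL
    have hL0 : 0 < L := by positivity
    have hLp : 0 < L ^ (1 + ε) := Real.rpow_pos_of_pos hL0 _
    have hd := dwt_div_le (half_pos hε) h1 h2 h3
    rw [mul_div_cancel₀ ε two_ne_zero, ← hL] at hd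
    have hW : 0 ≤ dwt (ε / 2) p.1 p.2.1 p.2.2 := (wt_pos _ _).le
    calc _ ≤ |K| * (dwt (ε / 2) p.1 p.2.1 p.2.2 * ρ) / (ρ * L ^ (1 + ε)) := by
          gcongr
          exact h.trans (by gcongr; exact le_abs_self K)
      _ = |K| * (dwt (ε / 2) p.1 p.2.1 p.2.2 / L ^ (1 + ε)) := by field_simp
      _ ≤ _ := by gcongr

end MatrixFactor

end

theorem theorem2 {Ω : Type*} [MeasurableSpace Ω] (μ : Measure Ω) [IsProbabilityMeasure μ]
    {k₁ k₂ : ℕ} (hk₁ : 0 < k₁) (hk₂ : 0 < k₂)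
    (R : ℕ → Fin k₁ → ℝ) (C : ℕ → Fin k₂ → ℝ)
    (F : ℕ → Ω → Matrix (Fin k₁) (Fin k₂) ℝ) (e : ℕ → ℕ → ℕ → Ω → ℝ)
    (hF : MatrixFactor.FactorAssumption μ F)
    (hR : MatrixFactor.LoadingAssumption R) (hC : MatrixFactor.LoadingAssumption C)
    (he : MatrixFactor.ErrorAssumption μ e)
    (hFe : MatrixFactor.DependenceAssumption μ F e)
    (Q : (p₁ p₂ T : ℕ) → Ω → Matrix (Fin p₂) (Fin k₂) ℝ)
    (hQ : ∀ p₁ p₂ T ω, k₂ ≤ p₂ →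
      MatrixFactor.IsLeadingEigenvectors (MatrixFactor.rowCov R C F e p₁ p₂ T ω)
        (Q p₁ p₂ T ω)) :
    (∀ j : ℕ, 1 ≤ j → j ≤ k₁ →
      MatrixFactor.IsOmegaAS μ
        (fun p₁ p₂ T ω => MatrixFactor.eig (MatrixFactor.projCov R C F e Q p₁ p₂ T ω) j)
        (fun p₁ _ _ => (p₁ : ℝ))) ∧
    (∀ j : ℕ, k₁ < j → ∀ ε : ℝ, 0 < ε →
      MatrixFactor.IsLittleOAS μ
        (fun p₁ p₂ T ω => MatrixFactor.eig (MatrixFactor.projCov R C F e Q p₁ p₂ T ω) j)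
        (fun p₁ p₂ T =>
          (1 / (p₂ : ℝ) + 1 / (T : ℝ) + (p₁ : ℝ) / Real.sqrt ((T : ℝ) * (p₂ : ℝ))) *
            (Real.log p₁ ^ 2 * Real.log p₂ * Real.log T) ^ (1 + ε))) :=
  ⟨fun _ hj hjk => MatrixFactor.isOmegaAS_eig_projCov hF hR hC he hQ hj hjk,
    fun _ hj _ hε => MatrixFactor.isLittleOAS_eig_projCov hF hR hC he hFe hQ hj hε⟩
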